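/- Let $n\ge 4$ and let $W(D_n)$ be the Coxeter group of type $D_n$ with generators $s_{\overline 1},s_1,\dots,s_{n-1}$, where $m(s_i,s_{i+1})=3$ for $1\le i\le n-2$, $m(s_{\overline 1},s_2)=3$, and all other pairs of distinct generators commute. An element $w$ is fully commutative if any two of its reduced expressions are related by a sequence of commutation moves $st\mapsto ts$ with $m(s,t)=2$. The heap of a fully commutative $w$ is of type I if some reduced expression of $w$ contains $s_{\overline 1}s_1$ as a consecutive subword, and of type II otherwise. An L-decorated $n$-diagram is, up to isotopy, a finite family of disjoint curves in a rectangle with nodes $1,\dots,n$ on its north face and $1',\dots,n'$ on its south face: edges joining the $2n$ nodes in pairs, and finitely many loops. Each curve carries finitely many decorations; every decorated curve can be deformed to the left wall without crossing another curve; and a diagram in which all edges join the north face to the south face is undecorated. Diagrams are multiplied by stacking, the first factor on top. Let $\widehat{\mathcal P}_n$ be the $\mathbb Z[\delta]$-algebra spanned by these diagrams modulo the following relations: an undecorated loop equals $\delta$; two adjacent decorations on a curve cancel; in the presence of a loop with one decoration, any other curve loses a decoration. A diagram is irreducible if none of these relations can be applied to it. An irreducible diagram is $D$-admissible of type I if it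 has exactly one loop, which is decorated, and no other decorations; it is $D$-admissible of type II if it has no loops and the total number of decorations is even. For $1\le i\le n-1$, let $d_i$ be the undecorated diagram with edges $\{i,i+1\}$ and $\{i',(i+1)'\}$ and all other edges vertical, and let $d_{\overline 1}$ be $d_1$ with one decoration on each of the edges $\{1,2\}$ and $\{1',2'\}$. Theorem. For every fully commutative $w\in W(D_n)$ with reduced expression $s_{x_1}\cdots s_{x_m}$, the product $d_w=d_{x_1}\cdots d_{x_m}$ in $\widehat{\mathcal P}_n$ is a $D$-admissible diagram, which does not depend on the reduced expression chosen. It is of type I if and only if the heap of $w$ is of type I, and of type II if and only if the heap of $w$ is of type II. Moreover the type I and type II diagrams are indexed by the type I and type II heaps, respectively: $w\mapsto d_w$ is a bijection from the fully commutative elements with heap of type I onto the $D$-admissible diagrams of type I, and a bijection from those with heap of type II onto the $D$-admissible diagrams of type II. -/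

import Mathlib

open Polynomial

namespace TLD

/-! ## The Coxeter system of type `D_n` and fully commutative elements

The generators are indexed by `Fin n`: index `0` is `s_{1̄}` and index `i ≥ 1` is `s_i`. -/

/-- `s_i` and `s_j` are joined in the Coxeter graph of type `D_n`: either `1 ≤ i` and `j = i + 1`,
or `{i, j}` is the pair `1̄`, `2` (indices `0` and `2`). -/
def Linked {n : ℕ} (i j : Fin n) : Prop :=
  (1 ≤ (i : ℕ) ∧ (j : ℕ) = i + 1) ∨ (1 ≤ (j : ℕ) ∧ (i : ℕ) = j + 1) ∨
    ((i : ℕ) = 0 ∧ (j : ℕ) = 2) ∨ ((j : ℕ) = 0 ∧ (i : ℕ) = 2)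

instance {n : ℕ} (i j : Fin n) : Decidable (Linked i j) := by
  unfold Linked; infer_instance

/-- The Coxeter matrix of type `D_n`, with `s_{1̄}` and `s_1` the two ends of the fork. -/
def coxeterMatrix (n : ℕ) : CoxeterMatrix (Fin n) where
  M := Matrix.of fun i j => if i = j then 1 else if Linked i j then 3 else 2
  isSymm := by
    ext i j
    have h : Linked i j ↔ Linked j i := by unfold Linked; tauto
    simp [Matrix.transpose_apply, eq_comm, h]
  diagonal := by simp
  off_diagonal := by
    intro i j h
    simp only [Matrix.of_apply, if_neg h]
    split <;> decide

/-- The Coxeter group `W(D_n)`. -/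
abbrev W (n : ℕ) : Type := (coxeterMatrix n).Group

/-- The word `ω` is a reduced expression for `w`. -/
def IsReducedExpr {n : ℕ} (ω : List (Fin n)) (w : W n) : Prop :=
  (coxeterMatrix n).toCoxeterSystem.IsReduced ω ∧
    (coxeterMatrix n).toCoxeterSystem.wordProd ω = w

/-- A single commutation move `st ↦ ts` with `m(s,t) = 2`. -/
inductive CommMove {n : ℕ} : List (Fin n) → List (Fin n) → Prop
  | swap (l r : List (Fin n)) (s t : Fin n) (h : coxeterMatrix n s t = 2) :
      CommMove (l ++ s :: t :: r) (l ++ t :: s :: r)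

/-- `w` is fully commutative: its reduced expressions form a single commutation class. -/
def IsFullyCommutative {n : ℕ} (w : W n) : Prop :=
  ∀ ω ω' : List (Fin n), IsReducedExpr ω w → IsReducedExpr ω' w →
    Relation.ReflTransGen CommMove ω ω'

/-- The fully commutative elements of `W(D_n)`. -/
abbrev FC (n : ℕ) : Type := {w : W n // IsFullyCommutative w}

/-- The heap of `w` is of type I: `s_{1̄} s_1` is a (consecutive) subword of some reduced
expression for `w`. -/
def HeapTypeI {n : ℕ} (w : W n) : Prop :=
  ∃ ω : List (Fin n), IsReducedExpr ω w ∧ [0, 1] <:+: ω.map Fin.val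

/-- The heap of `w` is of type II if it is not of type I. -/
def HeapTypeII {n : ℕ} (w : W n) : Prop := ¬ HeapTypeI w

/-! ## Decorated diagrams -/

/-- The nodes of the standard `k`-box: `inl i` is the node `i + 1` of the north face,
`inr i` the node `(i + 1)'` of the south face. -/
abbrev Node (k : ℕ) : Type := Fin k ⊕ Fin k

/-- The combinatorial data of a decorated pseudo `k`-diagram, not yet assumed planar: which nodes
are joined by an edge, how many decorations the edge at each node carries, and the list, without
order, of the numbers of decorations on the loops. -/
@[ext]
structure Diagram (k : ℕ) where
  /-- the other end of the edge at a node -/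
  partner : Node k → Node k
  partner_invol : Function.Involutive partner
  partner_ne : ∀ u, partner u ≠ u
  /-- the number of decorations on the edge at a node -/
  deco : Node k → ℕ
  deco_partner : ∀ u, deco (partner u) = deco u
  /-- the numbers of decorations on the loops -/
  loops : Multiset ℕ

/-- Position of a node on the boundary of the box, read clockwise from the left wall:
`1, 2, …, k, k', …, 2', 1'`. -/
def Node.pos {k : ℕ} : Node k → ℕ
  | Sum.inl i => i
  | Sum.inr i => 2 * k - 1 - i

namespace Diagram

variable {k : ℕ}

/-- The edges can be drawn in the box without crossings. -/
def IsPlanar (D : Diagram k) : Prop :=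
  ∀ u v : Node k, ¬ (u.pos < v.pos ∧ v.pos < (D.partner u).pos ∧
    (D.partner u).pos < (D.partner v).pos)

/-- No edge separates the edge at `u` from the left wall of the box. -/
def IsLeftExposed (D : Diagram k) (u : Node k) : Prop :=
  ∀ v : Node k, ¬ (v.pos < u.pos ∧ v.pos < (D.partner u).pos ∧
    u.pos < (D.partner v).pos ∧ (D.partner u).pos < (D.partner v).pos)

/-- L-decorated pseudo `k`-diagrams: planar; a diagram all of whose edges propagate (and so its
`a`-value is `0`) is undecorated; and every decorated edge can be deformed to touch the left wall.
(A decorated loop likewise has to lie in the region next to the left wall, which determines its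
place; the place of an undecorated loop is irrelevant, since such loops are scalars below.) -/
structure IsLDecorated (D : Diagram k) : Prop where
  planar : D.IsPlanar
  undecorated : (∀ i : Fin k, ∃ j : Fin k, D.partner (Sum.inl i) = Sum.inr j) →
    (∀ u, D.deco u = 0) ∧ ∀ m ∈ D.loops, m = 0
  exposed : ∀ u, D.deco u ≠ 0 → D.IsLeftExposed u

/-! ### Concatenation

To multiply `D * E`, the box of `D` is put on top of that of `E`. A node of `D` is tagged `inl`,
one of `E` is tagged `inr`. The south node `i'` of `D` is glued to the north node `i` of `E`. -/

/-- The nodes of two stacked boxes (before gluing). -/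
abbrev Stacked (k : ℕ) : Type := Node k ⊕ Node k

/-- The gluing of the south face of the upper box to the north face of the lower box; the other
nodes are left fixed. -/
def glue : Stacked k → Stacked k
  | Sum.inl (Sum.inl i) => Sum.inl (Sum.inl i)
  | Sum.inl (Sum.inr i) => Sum.inr (Sum.inl i)
  | Sum.inr (Sum.inl i) => Sum.inl (Sum.inr i)
  | Sum.inr (Sum.inr i) => Sum.inr (Sum.inr i)

/-- The node of the large box, if any, at a node of the two stacked boxes. -/
def boundary : Stacked k → Option (Node k)
  | Sum.inl (Sum.inl i) => some (Sum.inl i)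
  | Sum.inl (Sum.inr _) => none
  | Sum.inr (Sum.inl _) => none
  | Sum.inr (Sum.inr i) => some (Sum.inr i)

/-- The nodes of the large box among the nodes of the two stacked boxes. -/
def outer : Node k → Stacked k
  | Sum.inl i => Sum.inl (Sum.inl i)
  | Sum.inr i => Sum.inr (Sum.inr i)

theorem glue_invol : Function.Involutive (glue (k := k)) := by
  rintro ((i | i) | (i | i)) <;> rfl

theorem boundary_glue (x : Stacked k) : boundary (glue x) = boundary x := by
  rcases x with ((i | i) | (i | i)) <;> rfl

theorem boundary_outer (u : Node k) : boundary (outer u) = some u := by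
  rcases u with (i | i) <;> rfl

theorem glue_outer (u : Node k) : glue (outer u) = outer u := by
  rcases u with (i | i) <;> rfl

theorem outer_of_boundary {x : Stacked k} {u : Node k} (h : boundary x = some u) :
    x = outer u := by
  rcases x with ((i | i) | (i | i)) <;> simp_all [boundary] <;> subst h <;> rfl

theorem boundary_of_glue_eq {x : Stacked k} (h : glue x = x) : (boundary x).isSome := by
  rcases x with ((i | i) | (i | i)) <;> simp_all [boundary, glue]

/-- Go to the other end of the edge at a node of the two stacked boxes. -/
def cross (D E : Diagram k) : Stacked k → Stacked k := Sum.map D.partner E.partner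

theorem cross_invol (D E : Diagram k) : Function.Involutive (cross D E) := by
  rintro (u | u) <;> simp [cross, D.partner_invol u, E.partner_invol u]

theorem cross_ne (D E : Diagram k) (x : Stacked k) : cross D E x ≠ x := by
  rcases x with (u | u) <;> simp [cross, D.partner_ne u, E.partner_ne u]

/-- One step of the walk along a glued edge: pass through the gluing, then follow an edge. -/
def step (D E : Diagram k) : Equiv.Perm (Stacked k) :=
  glue_invol.toPerm.trans (cross_invol D E).toPerm

theorem step_apply (D E : Diagram k) (x : Stacked k) : step D E x = cross D E (glue x) := rfl

theorem step_glue_step (D E : Diagram k) (x : Stacked k) :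
    step D E (glue (step D E x)) = glue x := by
  simp only [step_apply, glue_invol _, cross_invol D E _]

theorem step_pow_reverse (D E : Diagram k) (x y : Stacked k) (j i : ℕ)
    (h : (step D E)^[j + i] x = glue y) :
    (step D E)^[j] y = glue ((step D E)^[i] x) := by
  induction j generalizing i with
  | zero => simpa [glue_invol y] using (congrArg glue h).symm
  | succ j ih =>
    have h2 := ih (i + 1) (by rw [← h]; congr 1; omega)
    rw [Function.iterate_succ_apply', h2, Function.iterate_succ_apply', step_glue_step]

theorem exists_return (D E : Diagram k) (u : Node k) :
    ∃ m, (boundary ((step D E)^[m + 1] (outer u))).isSome := by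
  obtain ⟨m, hm, h⟩ := (isOfFinOrder_of_finite (step D E)).exists_pow_eq_one
  refine ⟨m - 1, ?_⟩
  rw [Nat.sub_add_cancel hm, ← Equiv.Perm.coe_pow, h]
  simp [boundary_outer]

/-- The walk that starts at the node `u` of the large box meets the boundary of the large box
again for the first time after `walkLength D E u + 1` steps. -/
def walkLength (D E : Diagram k) (u : Node k) : ℕ := Nat.find (exists_return D E u)

/-- The end of the walk that starts at the node `u` of the large box. -/
def walkEnd (D E : Diagram k) (u : Node k) : Node k :=
  (boundary ((step D E)^[walkLength D E u + 1] (outer u))).get (Nat.find_spec (exists_return D E u))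

theorem iterate_walkLength (D E : Diagram k) (u : Node k) :
    (step D E)^[walkLength D E u + 1] (outer u) = outer (walkEnd D E u) :=
  outer_of_boundary (by simp [walkEnd])

theorem not_boundary_of_lt (D E : Diagram k) (u : Node k) {j : ℕ} (h0 : 0 < j)
    (hj : j < walkLength D E u + 1) : ¬ (boundary ((step D E)^[j] (outer u))).isSome := by
  obtain ⟨j, rfl⟩ := Nat.exists_eq_succ_of_ne_zero h0.ne'
  exact Nat.find_min (exists_return D E u) (by unfold walkLength at hj; omega)

theorem iterate_reverse (D E : Diagram k) (u : Node k) {j i : ℕ}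
    (h : j + i = walkLength D E u + 1) :
    (step D E)^[j] (outer (walkEnd D E u)) = glue ((step D E)^[i] (outer u)) :=
  step_pow_reverse D E _ _ j i (by rw [h, iterate_walkLength, glue_outer])

theorem walkEnd_invol (D E : Diagram k) : Function.Involutive (walkEnd D E) := by
  intro u
  have hl : walkLength D E (walkEnd D E u) = walkLength D E u := by
    rw [walkLength, Nat.find_eq_iff]
    constructor
    · rw [iterate_reverse D E u (i := 0) (by omega)]
      simp [glue_outer, boundary_outer]
    · intro j hj
      rw [iterate_reverse D E u (i := walkLength D E u - j) (by omega), boundary_glue]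
      exact not_boundary_of_lt D E u (by omega) (by omega)
  have h := iterate_walkLength D E (walkEnd D E u)
  rw [hl, iterate_reverse D E u (i := 0) (by omega)] at h
  have h2 := congrArg boundary h
  simpa [glue_outer, boundary_outer, eq_comm] using h2

theorem walkEnd_ne (D E : Diagram k) (u : Node k) : walkEnd D E u ≠ u := by
  intro hu
  rcases Nat.even_or_odd' (walkLength D E u + 1) with ⟨j, hj | hj⟩
  · have h := iterate_reverse D E u (j := j) (i := j) (by omega)
    rw [hu] at h
    exact not_boundary_of_lt D E u (j := j) (by omega) (by omega) (boundary_of_glue_eq h.symm)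
  · have h := iterate_reverse D E u (j := j + 1) (i := j) (by omega)
    rw [hu, Function.iterate_succ_apply', step_apply] at h
    exact cross_ne D E _ h

/-- The nodes of the stacked boxes that lie on the same glued edge or loop as `x`: those that the
walk from `x` meets, before or after passing through the gluing. -/
def component (D E : Diagram k) (x : Stacked k) : Finset (Stacked k) :=
  Finset.univ.filter fun y => (step D E).SameCycle x y ∨ (step D E).SameCycle x (glue y)

/-- The number of decorations on a union `C` of edges of the two stacked diagrams, given through
its nodes: every edge is counted at both of its ends, hence the factor `1/2`. -/
def decoOn (D E : Diagram k) (C : Finset (Stacked k)) : ℕ :=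
  (∑ x ∈ C, Sum.elim D.deco E.deco x) / 2

/-- The loops that arise by gluing, as sets of nodes. -/
def newLoops (D E : Diagram k) : Finset (Finset (Stacked k)) :=
  (Finset.univ.image (component D E)).filter fun C => ∀ x ∈ C, boundary x = none

theorem component_walkEnd (D E : Diagram k) (u : Node k) :
    component D E (outer (walkEnd D E u)) = component D E (outer u) := by
  have h : (step D E).SameCycle (outer u) (outer (walkEnd D E u)) :=
    ⟨(walkLength D E u + 1 : ℕ), by
      rw [zpow_natCast, Equiv.Perm.coe_pow, iterate_walkLength]⟩
  ext y
  simp only [component, Finset.mem_filter, Finset.mem_univ, true_and]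
  exact or_congr ⟨h.trans, h.symm.trans⟩ ⟨h.trans, h.symm.trans⟩

/-- Concatenation: `D * E` is `D` on top of `E`. The edges of `D * E` are the walks between nodes
of the large box; all decorations on the pieces of a glued edge or loop are kept. -/
instance : Mul (Diagram k) where
  mul D E :=
    { partner := walkEnd D E
      partner_invol := walkEnd_invol D E
      partner_ne := walkEnd_ne D E
      deco := fun u => decoOn D E (component D E (outer u))
      deco_partner := fun u => by rw [component_walkEnd]
      loops := D.loops + E.loops + (newLoops D E).val.map (decoOn D E) }

/-- The diagram `d_e`: all edges are vertical, no decorations, no loops. -/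
instance : One (Diagram k) where
  one :=
    { partner := Sum.swap
      partner_invol := Sum.swap_swap
      partner_ne := by rintro (i | i) <;> simp
      deco := fun _ => 0
      deco_partner := fun _ => rfl
      loops := 0 }

/-! ### Reduction of diagrams -/

/-- `Reduces D c E`: one of the defining relations rewrites `D` as `c • E`.

* an undecorated loop is replaced by the scalar `δ = X`;
* two decorations on one edge, or on one loop, cancel;
* in the presence of a loop with one decoration, any edge and any other loop loses a decoration. -/
inductive Reduces : Diagram k → ℤ[X] → Diagram k → Prop
  | loop (D E : Diagram k) (hp : D.partner = E.partner) (hd : D.deco = E.deco)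
      (hl : D.loops = 0 ::ₘ E.loops) : Reduces D X E
  | cancelEdge (D E : Diagram k) (u : Node k) (hp : D.partner = E.partner)
      (hu : D.deco u = E.deco u + 2)
      (hd : ∀ v, v ≠ u → v ≠ D.partner u → D.deco v = E.deco v)
      (hl : D.loops = E.loops) : Reduces D 1 E
  | cancelLoop (D E : Diagram k) (m : ℕ) (L : Multiset ℕ) (hp : D.partner = E.partner)
      (hd : D.deco = E.deco) (hD : D.loops = (m + 2) ::ₘ L) (hE : E.loops = m ::ₘ L) :
      Reduces D 1 E
  | absorbEdge (D E : Diagram k) (u : Node k) (hp : D.partner = E.partner)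
      (hu : D.deco u = E.deco u + 1)
      (hd : ∀ v, v ≠ u → v ≠ D.partner u → D.deco v = E.deco v)
      (hl : D.loops = E.loops) (hmem : 1 ∈ D.loops) : Reduces D 1 E
  | absorbLoop (D E : Diagram k) (m : ℕ) (L : Multiset ℕ) (hp : D.partner = E.partner)
      (hd : D.deco = E.deco) (hD : D.loops = 1 ::ₘ (m + 1) ::ₘ L)
      (hE : E.loops = 1 ::ₘ m ::ₘ L) : Reduces D 1 E

/-- No relation can be applied to `D`. -/
def IsIrreducible (D : Diagram k) : Prop := ∀ (c : ℤ[X]) (E : Diagram k), ¬ Reduces D c E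

end Diagram

/-- The L-decorated pseudo `k`-diagrams. -/
abbrev LDiagram (k : ℕ) : Type := {D : Diagram k // D.IsLDecorated}

/-- The span of the defining relations in the free `ℤ[δ]`-module on the L-decorated diagrams. Since
the relations are imposed on all diagrams, on edges as well as on loops, this span is stable under
concatenation with diagrams: it is the ideal generated by the relations. -/
noncomputable def relations (k : ℕ) : Submodule ℤ[X] (LDiagram k →₀ ℤ[X]) :=
  Submodule.span ℤ[X]
    {x | ∃ (D E : LDiagram k) (c : ℤ[X]), D.1.Reduces c E.1 ∧
      x = Finsupp.single D 1 - Finsupp.single E c}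

/-- The algebra of L-decorated diagrams modulo the defining relations (as a `ℤ[δ]`-module); the
product of the classes of two diagrams is the class of their concatenation. -/
abbrev DiagramAlgebra (k : ℕ) : Type := (LDiagram k →₀ ℤ[X]) ⧸ relations k

namespace LDiagram

variable {k : ℕ}

/-- The element of the diagram algebra given by a diagram. -/
noncomputable def toAlgebra (D : LDiagram k) : DiagramAlgebra k :=
  (relations k).mkQ (Finsupp.single D 1)

/-- The total number of decorations on the edges (each edge has two ends) and loops. -/
def numDecorations (D : LDiagram k) : ℕ := (∑ u, D.1.deco u) / 2 + D.1.loops.sum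

/-- `D`-admissible of type I: irreducible, with exactly one loop, which is decorated, and no other
decorations. -/
def IsTypeI (D : LDiagram k) : Prop :=
  D.1.IsIrreducible ∧ (∃ m, m ≠ 0 ∧ D.1.loops = {m}) ∧ ∀ u, D.1.deco u = 0

/-- `D`-admissible of type II: irreducible, without loops, and with an even total number of
decorations. -/
def IsTypeII (D : LDiagram k) : Prop :=
  D.1.IsIrreducible ∧ D.1.loops = 0 ∧ Even (numDecorations D)

end LDiagram

/-! ### Simple diagrams -/

/-- The left one of the two adjacent nodes joined in the simple diagram of index `j`: the nodes
`1, 2` for `d_{1̄}` (index `0`), and the nodes `i, i + 1` for `d_i` (index `i ≥ 1`); nodes are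
counted from `0` here. -/
def leftNode {n : ℕ} (j : Fin n) : Fin n := ⟨(j : ℕ) - 1, by omega⟩

/-- The right one of the two adjacent nodes joined in the simple diagram of index `j`. -/
def rightNode {n : ℕ} (hn : 4 ≤ n) (j : Fin n) : Fin n := ⟨(j : ℕ) - 1 + 1, by omega⟩

theorem leftNode_ne_rightNode {n : ℕ} (hn : 4 ≤ n) (j : Fin n) :
    leftNode j ≠ rightNode hn j := by
  simp [leftNode, rightNode, Fin.ext_iff]

/-- The edges of the simple diagram of index `j`: the two adjacent nodes are joined in the north
face and in the south face, and all other edges are vertical. -/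
def simplePartner {n : ℕ} (hn : 4 ≤ n) (j : Fin n) (u : Node n) : Node n :=
  if u = Sum.inl (leftNode j) then Sum.inl (rightNode hn j)
  else if u = Sum.inl (rightNode hn j) then Sum.inl (leftNode j)
  else if u = Sum.inr (leftNode j) then Sum.inr (rightNode hn j)
  else if u = Sum.inr (rightNode hn j) then Sum.inr (leftNode j)
  else u.swap

/-- The simple diagrams `d_{1̄}` (index `0`) and `d_i` (index `i ≥ 1`) in the standard `n`-box. In
`d_{1̄}` each of the two non-propagating edges carries one decoration; the others are
undecorated. -/
def simpleDiagram {n : ℕ} (hn : 4 ≤ n) (j : Fin n) : Diagram n where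
  partner := simplePartner hn j
  partner_invol := by
    have h := leftNode_ne_rightNode hn j
    rintro (i | i) <;> by_cases h1 : i = leftNode j <;> by_cases h2 : i = rightNode hn j <;>
      simp_all [simplePartner, eq_comm]
  partner_ne := by
    have h := leftNode_ne_rightNode hn j
    rintro (i | i) <;> by_cases h1 : i = leftNode j <;> by_cases h2 : i = rightNode hn j <;>
      simp_all [simplePartner, eq_comm]
  deco := fun u =>
    if (j : ℕ) = 0 ∧ (u.elim id id = leftNode j ∨ u.elim id id = rightNode hn j) then 1 else 0
  deco_partner := by
    have h := leftNode_ne_rightNode hn j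
    rintro (i | i) <;> by_cases h1 : i = leftNode j <;> by_cases h2 : i = rightNode hn j <;>
      simp_all [simplePartner, eq_comm]
  loops := 0

/-- The concatenation `d_{x₁} d_{x₂} ⋯ d_{xₘ}` of simple diagrams along a word. -/
def wordDiagram {n : ℕ} (hn : 4 ≤ n) (ω : List (Fin n)) : Diagram n :=
  (ω.map (simpleDiagram hn)).prod

end TLD

/-! Modulo the relations, and up to powers of `δ`, a diagram is a perfect matching with decorations
counted mod 2 and a mark (`flag`) for an odd loop, which wipes out all other decorations. This is a
`Cfg`. Vertical edges are added on the right, so that one node set serves every width. Left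
multiplication by a simple diagram becomes `op k`, which joins two adjacent north nodes and also
joins their former partners; `em k` is the exponent of `δ` that splits off. These operations satisfy
the Temperley-Lieb relations of type `D`.

On the combinatorial side, `Red` words are those whose commutation class contains neither `s s` nor
`s t s` with `s`, `t` linked. The heart of the proof is that such a word is determined up to
commutations by its diagram (`Red.ceq_of_nf_eq`), that it produces no power of `δ`
(`Red.expo_eq_zero`), and that an odd loop forces an adjacent pair `0 1`
(`Red.exists_fork_of_flag`). This goes by induction on a bound `g` for the letters. By `Red.factor`,
a `Red` word is `c u` up to commutations, with `u` in the letters `< g` and `c` empty, a path or a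
hook. The letters that fix the diagram reveal where the path starts (`path_fixed`), the action of a
path can be undone (`act_path_inj`), and the operation `vert g` tells whether `c` is empty
(`path_not_vert`). A hook forces `u = []` and acts like a path applied to the identity with an odd
loop, a matching that no word produces.

Words are tied to the group by the representation `s ↦ 1 - d_s` at `δ = 2`. Applied to the identity
diagram, the product along `w` has a nonzero leading term at the diagram of `w`, and the other terms
come from shorter words. Hence a word that is no longer than a `Red` word and represents the same
element is commutation equivalent to it (`Red.ceq_of_refl_prod_eq`). So the `Red` words are exactly
the reduced expressions of fully commutative elements, and `w ↦ d_w` is injective.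

For surjectivity, an admissible matching without odd loop is factored by peeling off generators from
the left until it fits in a narrower box (`Good.exists_word`). With an odd loop, one builds the
undecorated matching and replaces its first letter by a word that joins the same nodes and creates
the loop (`exists_word_of_flag`).

Finally, concatenation with a simple diagram is computed from its definition by walks and shown to
match `op` (`Diagram.toCfg_simple_mul`). The number of loops of a word diagram is the exponent of
`δ`, plus one if there is an odd loop. A reduced word therefore gives no loop, or a single odd one,
and relations with coefficient 1 lead to a normal form (`exists_normal`), which its `Cfg` determines
(`Diagram.IsNormal.eq_of_toCfg_eq`). -/

namespace TLD

/-! ## Decorated matchings modulo the relations -/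

section Join

variable {V : Type*} [DecidableEq V]

/-- Join `a` to `b`, and the former partners of `a` and `b` to each other. -/
def joinFun (a b : V) (f : V → V) (v : V) : V :=
  if v = a then b else if v = b then a else if v = f a then f b else if v = f b then f a else f v

/-- The parities of the decorations after joining `a` and `b` by an edge of parity `e`. -/
def joinDeco (a b : V) (e : ZMod 2) (f : V → V) (g : V → ZMod 2) (v : V) : ZMod 2 :=
  if v = a ∨ v = b then e else if v = f a ∨ v = f b then g a + g b + e else g v

end Join

theorem zmod_two_eq_zero_or_one (x : ZMod 2) : x = 0 ∨ x = 1 := by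
  revert x; decide

/-- A perfect matching with decorations counted modulo two; `flag` records the presence of a loop
with an odd number of decorations, which absorbs all other decorations. -/
@[ext]
structure Cfg (V : Type*) where
  f : V → V
  g : V → ZMod 2
  flag : Prop
  invol : ∀ v, f (f v) = v
  ne : ∀ v, f v ≠ v
  g_f : ∀ v, g (f v) = g v
  g_flag : flag → ∀ v, g v = 0

namespace Cfg

variable {V : Type*} [DecidableEq V]

open Classical in
/-- Join `a` and `b` by an edge of parity `e`. -/
noncomputable def join (a b : V) (e : ZMod 2) (h : a ≠ b) (x : Cfg V) : Cfg V where
  f := joinFun a b x.f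
  g v := if x.flag ∨ (x.f a = b ∧ x.g a ≠ e) then 0 else joinDeco a b e x.f x.g v
  flag := x.flag ∨ (x.f a = b ∧ x.g a ≠ e)
  invol v := by
    have := x.invol; have := x.ne
    grind [joinFun]
  ne v := by
    have := x.invol; have := x.ne
    grind [joinFun]
  g_f v := by
    have := x.invol; have := x.ne; have := x.g_f
    grind [joinFun, joinDeco]
  g_flag hf v := by simp [hf]

open Classical in
/-- The number of undecorated loops split off when joining `a` and `b`. -/
noncomputable def emit (a b : V) (e : ZMod 2) (x : Cfg V) : ℕ :=
  if x.f a = b ∧ (x.flag ∨ x.g a = e) then 1 else 0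

theorem join_g {a b : V} {e : ZMod 2} (hab : a ≠ b) (x : Cfg V)
    (h : ¬ (x.join a b e hab).flag) (v : V) :
    (x.join a b e hab).g v = joinDeco a b e x.f x.g v :=
  if_neg h

theorem joinFun_comm {a b c d : V} (f : V → V) (hi : ∀ v, f (f v) = v) (hn : ∀ v, f v ≠ v)
    (hab : a ≠ b) (hcd : c ≠ d) (hac : a ≠ c) (had : a ≠ d) (hbc : b ≠ c) (hbd : b ≠ d) :
    joinFun a b (joinFun c d f) = joinFun c d (joinFun a b f) := by
  ext v
  grind (splits := 20) [joinFun]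

theorem joinDeco_comm {a b c d : V} (e e' : ZMod 2) (f : V → V) (g : V → ZMod 2)
    (hi : ∀ v, f (f v) = v) (hn : ∀ v, f v ≠ v) (hg : ∀ v, g (f v) = g v)
    (hab : a ≠ b) (hcd : c ≠ d) (hac : a ≠ c) (had : a ≠ d) (hbc : b ≠ c) (hbd : b ≠ d) (v : V) :
    joinDeco a b e (joinFun c d f) (joinDeco c d e' f g) v =
      joinDeco c d e' (joinFun a b f) (joinDeco a b e f g) v := by
  grind (splits := 20) [joinFun, joinDeco]

/-- Only the connections among `a`, `b`, `c`, `d` matter. When both new edges lie on one loop, its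
parity is the sum of the old parities and `e + e'`, whichever edge closes it. -/
theorem loop_iff {a b c d : V} (e e' : ZMod 2) (f : V → V) (g : V → ZMod 2)
    (hi : ∀ v, f (f v) = v) (hn : ∀ v, f v ≠ v) (hg : ∀ v, g (f v) = g v)
    (hab : a ≠ b) (hcd : c ≠ d) (hac : a ≠ c) (had : a ≠ d) (hbc : b ≠ c) (hbd : b ≠ d) :
    (f c = d ∧ g c ≠ e' ∨ joinFun c d f a = b ∧ joinDeco c d e' f g a ≠ e) ↔
      (f a = b ∧ g a ≠ e ∨ joinFun a b f c = d ∧ joinDeco a b e f g c ≠ e') := by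
  have h1 : f a = b ↔ f b = a := ⟨fun h => by rw [← h, hi], fun h => by rw [← h, hi]⟩
  have h2 : f c = d ↔ f d = c := ⟨fun h => by rw [← h, hi], fun h => by rw [← h, hi]⟩
  have h3 : f a = c ↔ f c = a := ⟨fun h => by rw [← h, hi], fun h => by rw [← h, hi]⟩
  have h4 : f b = d ↔ f d = b := ⟨fun h => by rw [← h, hi], fun h => by rw [← h, hi]⟩
  have h5 : f a = d ↔ f d = a := ⟨fun h => by rw [← h, hi], fun h => by rw [← h, hi]⟩
  have h6 : f b = c ↔ f c = b := ⟨fun h => by rw [← h, hi], fun h => by rw [← h, hi]⟩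
  by_cases k1 : f a = b <;> by_cases k2 : f c = d <;> by_cases k3 : f a = c <;>
    by_cases k4 : f b = d <;> by_cases k5 : f a = d <;> by_cases k6 : f b = c <;>
    grind [joinFun, joinDeco]

theorem join_comm {a b c d : V} (e e' : ZMod 2) (hab : a ≠ b) (hcd : c ≠ d) (hac : a ≠ c)
    (had : a ≠ d) (hbc : b ≠ c) (hbd : b ≠ d) (x : Cfg V) :
    (x.join c d e' hcd).join a b e hab = (x.join a b e hab).join c d e' hcd := by
  have hf := joinFun_comm x.f x.invol x.ne hab hcd hac had hbc hbd
  by_cases hx : x.flag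
  · ext1
    · simpa [join] using hf
    · simp [join, hx]
    · simp [join, hx]
  have hfl : ((x.join c d e' hcd).join a b e hab).flag =
      ((x.join a b e hab).join c d e' hcd).flag := by
    have := loop_iff e e' x.f x.g x.invol x.ne x.g_f hab hcd hac had hbc hbd
    simp only [join, hx, false_or]
    grind
  ext1
  · simpa [join] using hf
  · ext v
    by_cases hfl' : ((x.join c d e' hcd).join a b e hab).flag
    · rw [g_flag _ hfl', g_flag _ (hfl ▸ hfl')]
    · have hfl2 := hfl ▸ hfl'
      have := joinDeco_comm e e' x.f x.g x.invol x.ne x.g_f hab hcd hac had hbc hbd v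
      simp only [join, hx, false_or] at hfl' hfl2 ⊢
      rw [if_neg hfl', if_neg hfl2]
      simpa only [if_neg (not_or.1 hfl').1, if_neg (not_or.1 hfl2).1] using this
  · exact hfl

/-- An odd loop raises the flag instead of being counted, and once the flag is up every further loop
is counted. So two odd loops contribute one in either order. -/
theorem emit_comm {a b c d : V} (e e' : ZMod 2) (hab : a ≠ b) (hcd : c ≠ d) (hac : a ≠ c)
    (had : a ≠ d) (hbc : b ≠ c) (hbd : b ≠ d) (x : Cfg V) :
    (x.join c d e' hcd).emit a b e + x.emit c d e' =
      (x.join a b e hab).emit c d e' + x.emit a b e := by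
  obtain ⟨f, g, fl, hi, hn, hg, hgf⟩ := x
  have h1 : f a = b ↔ f b = a := ⟨fun h => by rw [← h, hi], fun h => by rw [← h, hi]⟩
  have h2 : f c = d ↔ f d = c := ⟨fun h => by rw [← h, hi], fun h => by rw [← h, hi]⟩
  have h3 : f a = c ↔ f c = a := ⟨fun h => by rw [← h, hi], fun h => by rw [← h, hi]⟩
  have h4 : f b = d ↔ f d = b := ⟨fun h => by rw [← h, hi], fun h => by rw [← h, hi]⟩
  have h5 : f a = d ↔ f d = a := ⟨fun h => by rw [← h, hi], fun h => by rw [← h, hi]⟩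
  have h6 : f b = c ↔ f c = b := ⟨fun h => by rw [← h, hi], fun h => by rw [← h, hi]⟩
  simp only [join, emit]
  by_cases k1 : f a = b <;> by_cases k2 : f c = d <;> by_cases k3 : f a = c <;>
    by_cases k4 : f b = d <;> by_cases k5 : f a = d <;> by_cases k6 : f b = c <;>
    by_cases hfl : fl <;> grind [joinFun, joinDeco]

theorem join_symm {a b : V} (e : ZMod 2) (hab : a ≠ b) (x : Cfg V) :
    x.join a b e hab = x.join b a e hab.symm := by
  obtain ⟨f, g, fl, hi, hn, hg, hgf⟩ := x
  have h1 : f a = b ↔ f b = a := ⟨fun h => by rw [← h, hi], fun h => by rw [← h, hi]⟩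
  have h2 : (fl ∨ f a = b ∧ g a ≠ e) ↔ (fl ∨ f b = a ∧ g b ≠ e) := by grind
  ext1
  · ext v; simp only [join]; grind [joinFun]
  · ext v; simp only [join, h2]; grind [joinDeco]
  · simp only [join, h2]

/-- The fixed points of `join` are the matchings that already contain the new edge. This makes
"divisible on the left by a generator" a property that can be read off the diagram. -/
theorem join_eq_self {a b : V} {e : ZMod 2} (hab : a ≠ b) {x : Cfg V} :
    x.join a b e hab = x ↔ x.f a = b ∧ (x.flag ∨ x.g a = e) := by
  obtain ⟨f, g, fl, hi, hn, hg, hgf⟩ := x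
  constructor
  · intro h
    have h1 := congrArg Cfg.f h
    have h2 := congrArg Cfg.flag h
    have h3 := congrFun h1 a
    simp only [join, eq_iff_iff] at h2 h3
    grind [joinFun]
  · intro ⟨h1, h2⟩
    have h3 : f b = a := by simp only at h1; rw [← h1, hi]
    have h4 : (fl ∨ f a = b ∧ g a ≠ e) ↔ fl := by grind
    ext1
    · ext v; simp only [join]; grind [joinFun]
    · ext v; simp only [join, h4]; grind [joinDeco]
    · simp only [join, h4]

theorem join_f_left {a b : V} (e : ZMod 2) (hab : a ≠ b) (x : Cfg V) :
    (x.join a b e hab).f a = b := by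
  simp [join, joinFun]

theorem join_idem {a b : V} (e : ZMod 2) (hab : a ≠ b) (x : Cfg V) :
    (x.join a b e hab).join a b e hab = x.join a b e hab := by
  rw [join_eq_self]
  refine ⟨join_f_left e hab x, ?_⟩
  grind [join, joinDeco]

theorem emit_eq_one {a b : V} {e : ZMod 2} (hab : a ≠ b) {x : Cfg V}
    (h : x.join a b e hab = x) : x.emit a b e = 1 := by
  rw [join_eq_self] at h
  simp [emit, h]

/-- This is `d_s d_t d_s = d_s`. By idempotence it suffices to start from a fixed point `y` of the
first join: the partner of `c` is moved to `a` and then back to `c`, and both `e` and `e'` enter its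
parity twice, hence cancel mod 2. -/
theorem join_braid {a b c : V} (e e' : ZMod 2) (hab : a ≠ b) (hbc : b ≠ c) (hac : a ≠ c)
    (x : Cfg V) : ((x.join a b e hab).join b c e' hbc).join a b e hab = x.join a b e hab := by
  have key : ∀ y : Cfg V, y.join a b e hab = y →
      (y.join b c e' hbc).join a b e hab = y := by
    intro y hy
    rw [join_eq_self] at hy
    obtain ⟨h1, h2⟩ := hy
    have hb : y.f b = a := by rw [← h1, y.invol]
    have k1 : (y.join b c e' hbc).flag ↔ y.flag := by grind [join]
    have k2 : (y.join b c e' hbc).f a ≠ b := by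
      have := (y.join b c e' hbc).invol a
      have := join_f_left e' hbc y
      grind
    have k3 : ((y.join b c e' hbc).join a b e hab).flag ↔ y.flag := by
      rw [← k1]; exact ⟨fun h => h.resolve_right fun h => k2 h.1, Or.inl⟩
    obtain ⟨f, g, fl, hi, hn, hg, hgf⟩ := y
    simp only at h1 h2 hb k1 k3
    ext1
    · ext v
      simp only [join]
      grind (splits := 20) [joinFun]
    · ext v
      by_cases hfl : fl
      · rw [g_flag _ (k3.2 hfl)]; exact (hgf hfl v).symm
      · have k4 := mt k3.1 hfl
        have k5 := mt k1.1 hfl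
        rw [join_g _ _ k4, funext fun w => join_g _ _ k5 w]
        simp only [join]
        grind (splits := 20) [joinFun, joinDeco]
    · exact propext k3
  exact key _ (join_idem e hab x)

theorem join_join_flag {a b : V} {e e' : ZMod 2} (hee : e ≠ e') (hab : a ≠ b) (x : Cfg V) :
    ((x.join a b e' hab).join a b e hab).flag := by
  by_cases k : (x.join a b e' hab).flag
  · exact Or.inl k
  · refine Or.inr ⟨join_f_left e' hab x, ?_⟩
    have : (x.join a b e' hab).g a = e' := by
      simp only [join] at k ⊢
      simp [k, joinDeco]
    rw [this]; exact hee.symm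

/-- Needed for the commuting letters `0` and `1`, which join the same nodes with different parities.
In either order an odd loop appears, and it makes all parities irrelevant. -/
theorem join_comm_self {a b : V} (e e' : ZMod 2) (hab : a ≠ b) (x : Cfg V) :
    (x.join a b e' hab).join a b e hab = (x.join a b e hab).join a b e' hab := by
  by_cases hee : e = e'
  · rw [hee]
  have h1 : ∀ e e' : ZMod 2, e ≠ e' → ((x.join a b e' hab).join a b e hab).flag :=
    fun e e' h => join_join_flag h hab x
  ext1
  · simp only [join]
  · ext v
    rw [g_flag _ (h1 e e' hee), g_flag _ (h1 e' e (Ne.symm hee))]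
  · exact propext ⟨fun _ => h1 e' e (Ne.symm hee), fun _ => h1 e e' hee⟩

theorem emit_comm_self {a b : V} (e e' : ZMod 2) (hab : a ≠ b) (x : Cfg V) :
    (x.join a b e' hab).emit a b e + x.emit a b e' =
      (x.join a b e hab).emit a b e' + x.emit a b e := by
  by_cases hee : e = e'
  · rw [hee]
  have h : ∀ e : ZMod 2, (x.join a b e hab).f a = b := fun e => join_f_left e hab x
  have h2 : ∀ e : ZMod 2, ¬ (x.join a b e hab).flag → (x.join a b e hab).g a = e := by
    intro e h
    rw [join_g _ _ h]; simp [joinDeco]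
  have h3 : ∀ e : ZMod 2, (x.join a b e hab).flag = (x.flag ∨ (x.f a = b ∧ x.g a ≠ e)) :=
    fun _ => rfl
  have h4 : ∀ z : ZMod 2, z = e ∨ z = e' := by
    revert e e'; decide
  have h5 := h2 e
  have h6 := h2 e'
  have h7 := h e
  have h8 := h e'
  have h9 := h3 e
  have h10 := h3 e'
  have := h4 (x.g a)
  clear h4 h2 h h3
  simp only [emit]
  grind

end Cfg

/-! ## Words and commutation classes

Letters are natural numbers: the letter `0` stands for `s_{1̄}`, the letter `i ≥ 1` for `s_i`. -/

/-- The letters `s` and `t` are joined in the Coxeter graph. -/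
def Lk (s t : ℕ) : Prop :=
  (1 ≤ s ∧ t = s + 1) ∨ (1 ≤ t ∧ s = t + 1) ∨ (s = 0 ∧ t = 2) ∨ (t = 0 ∧ s = 2)

/-- The letters `s` and `t` are distinct and commute. -/
def Cm (s t : ℕ) : Prop := s ≠ t ∧ ¬ Lk s t

theorem Lk.symm {s t : ℕ} (h : Lk s t) : Lk t s := by unfold Lk at *; omega

theorem Lk.ne {s t : ℕ} (h : Lk s t) : s ≠ t := by unfold Lk at *; omega

theorem Cm.symm {s t : ℕ} (h : Cm s t) : Cm t s := ⟨h.1.symm, fun h' => h.2 h'.symm⟩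

/-- Exchange two adjacent commuting letters. -/
inductive Swap : List ℕ → List ℕ → Prop
  | mk (l r : List ℕ) (s t : ℕ) (h : Cm s t) : Swap (l ++ s :: t :: r) (l ++ t :: s :: r)

/-- Equality up to commutations. -/
abbrev CEq : List ℕ → List ℕ → Prop := Relation.ReflTransGen Swap

theorem Swap.symm {x y : List ℕ} : Swap x y → Swap y x
  | ⟨l, r, s, t, h⟩ => ⟨l, r, t, s, h.symm⟩

theorem Swap.perm {x y : List ℕ} : Swap x y → x.Perm y
  | ⟨l, r, s, t, _⟩ => (List.Perm.swap t s r).append_left l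

theorem Swap.append {x y : List ℕ} (p q : List ℕ) : Swap x y → Swap (p ++ x ++ q) (p ++ y ++ q)
  | ⟨l, r, s, t, h⟩ => by simpa using Swap.mk (p ++ l) (r ++ q) s t h

namespace CEq

theorem symm {x y : List ℕ} (h : CEq x y) : CEq y x := by
  induction h with
  | refl => exact .refl
  | tail _ h ih => exact .head h.symm ih

theorem perm {x y : List ℕ} (h : CEq x y) : x.Perm y := by
  induction h with
  | refl => exact .refl _
  | tail _ h ih => exact ih.trans h.perm

theorem length_eq {x y : List ℕ} (h : CEq x y) : x.length = y.length := h.perm.length_eq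

theorem append {x y : List ℕ} (p q : List ℕ) (h : CEq x y) : CEq (p ++ x ++ q) (p ++ y ++ q) :=
  Relation.ReflTransGen.lift (fun z => p ++ z ++ q) (fun _ _ => Swap.append p q) _ _ h

theorem append_left {x y : List ℕ} (p : List ℕ) (h : CEq x y) : CEq (p ++ x) (p ++ y) := by
  simpa using h.append p []

theorem cons {x y : List ℕ} (s : ℕ) (h : CEq x y) : CEq (s :: x) (s :: y) := by
  simpa using h.append [s] []

theorem move {s : ℕ} {p : List ℕ} (r : List ℕ) (h : ∀ x ∈ p, Cm s x) :
    CEq (s :: (p ++ r)) (p ++ s :: r) := by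
  induction p with
  | nil => exact .refl
  | cons x p ih =>
    have h1 : Swap (s :: x :: (p ++ r)) (x :: s :: (p ++ r)) := Swap.mk [] _ _ _ (h x (by simp))
    exact .head h1 ((ih fun y hy => h y (by simp [hy])).cons x)

end CEq

/-- The word contains `s s`, or `s t s` for linked letters `s`, `t`. -/
def Bad (w : List ℕ) : Prop :=
  (∃ l r s, w = l ++ s :: s :: r) ∨ ∃ l r s t, Lk s t ∧ w = l ++ s :: t :: s :: r

/-- No word in the commutation class contains `s s`, or `s t s` for linked letters `s`, `t`. -/
def Red (w : List ℕ) : Prop := ∀ w', CEq w w' → ¬ Bad w'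

theorem Bad.append {w : List ℕ} (p q : List ℕ) : Bad w → Bad (p ++ w ++ q)
  | .inl ⟨l, r, s, h⟩ => .inl ⟨p ++ l, r ++ q, s, by simp [h]⟩
  | .inr ⟨l, r, s, t, h, h'⟩ => .inr ⟨p ++ l, r ++ q, s, t, h, by simp [h']⟩

namespace Red

theorem ceq {x y : List ℕ} (h : Red x) (hxy : CEq x y) : Red y := fun w hw => h w (hxy.trans hw)

theorem right {p x : List ℕ} (h : Red (p ++ x)) : Red x := fun w hw hb =>
  h _ (hw.append_left p) (by simpa using hb.append p [])

theorem tail {s : ℕ} {x : List ℕ} (h : Red (s :: x)) : Red x := right (p := [s]) h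

theorem not_ss {s : ℕ} {u p r : List ℕ} (h : Red (u ++ s :: (p ++ s :: r)))
    (hp : ∀ x ∈ p, Cm s x) : False :=
  h _ ((CEq.move _ hp).append_left u) (.inl ⟨u ++ p, r, s, by simp⟩)

/-- The outer copies of `s` slide through `p` and `q` until they are adjacent to `t`. -/
theorem not_sts {s t : ℕ} {u p q r : List ℕ} (h : Red (u ++ s :: (p ++ t :: (q ++ s :: r))))
    (hst : Lk s t) (hp : ∀ x ∈ p, Cm s x) (hq : ∀ x ∈ q, Cm s x) : False := by
  refine h (u ++ (p ++ s :: t :: (s :: (q ++ r)))) ?_ (.inr ⟨u ++ p, q ++ r, s, t, hst, by simp⟩)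
  refine CEq.append_left u ((CEq.move _ hp).trans ?_)
  exact (((CEq.move r hq).symm.cons t).cons s).append_left p

end Red

/-- `k` is the first letter of some word in the commutation class. -/
def Desc (k : ℕ) (w : List ℕ) : Prop := ∃ v, CEq w (k :: v)

/-! ### Coset factorization -/

/-- The words `i, i + 1, …, g` for `i ≥ 1`, and `0, 2, 3, …, g`. -/
def path (i g : ℕ) : List ℕ := if i = 0 then 0 :: List.Ico 2 (g + 1) else List.Ico i (g + 1)

/-- The word `j, …, 2, 0, 1, 2, …, g`. -/
def hook (j g : ℕ) : List ℕ := (List.Ico 2 (j + 1)).reverse ++ 0 :: 1 :: List.Ico 2 (g + 1)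

theorem path_zero (g : ℕ) : path 0 g = 0 :: List.Ico 2 (g + 1) := rfl

theorem path_pos {i : ℕ} (hi : 1 ≤ i) (g : ℕ) : path i g = List.Ico i (g + 1) :=
  if_neg (by omega)

theorem path_cons {i g : ℕ} (hi : 1 ≤ i) (hg : i ≤ g) : path i g = i :: path (i + 1) g := by
  rw [path_pos hi, path_pos (by omega), List.Ico.eq_cons (by omega)]

theorem path_zero_cons (g : ℕ) : path 0 g = 0 :: path 2 g := rfl

theorem Ico_split {i s g : ℕ} (h1 : i ≤ s) (h2 : s ≤ g) :
    List.Ico i (g + 1) = List.Ico i s ++ s :: List.Ico (s + 1) (g + 1) := by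
  rw [← List.Ico.append_consecutive h1 (by omega : s ≤ g + 1),
    List.Ico.eq_cons (by omega : s < g + 1)]

theorem Ico_split_two {i s g : ℕ} (h1 : i ≤ s) (h2 : s + 1 ≤ g) :
    List.Ico i (g + 1) = List.Ico i s ++ s :: (s + 1) :: List.Ico (s + 2) (g + 1) := by
  rw [Ico_split h1 (by omega), List.Ico.eq_cons (by omega : s + 1 < g + 1)]

/-- The new `s` slides past the earlier letters of the path and meets `s - 1, s`, or `0, 2` when `s
= 2` and `i = 0`. The excluded pair `i = 0`, `s = 1` is where a hook begins. -/
theorem not_red_cons_path {i s g : ℕ} {u : List ℕ} (his : i < s) (hi : s = 1 → i ≠ 0) (hs : s ≤ g) :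
    ¬ Red (s :: (path i g ++ u)) := by
  intro h
  rcases Nat.eq_zero_or_pos i with rfl | hi'
  · rcases Nat.lt_or_ge s 3 with h3 | h3
    · have hs2 : s = 2 := by omega
      subst hs2
      rw [path_zero, Ico_split le_rfl hs] at h
      refine Red.not_sts (u := []) (p := []) (q := []) (s := 2) (t := 0)
        (r := List.Ico 3 (g + 1) ++ u) (by simpa using h) ?_ ?_ ?_ <;> simp [Lk]
    · obtain ⟨s, rfl⟩ : ∃ s', s = s' + 1 := ⟨s - 1, by omega⟩
      rw [path_zero, Ico_split_two (by omega : 2 ≤ s) hs] at h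
      refine Red.not_sts (u := []) (p := 0 :: List.Ico 2 s) (q := []) (s := s + 1) (t := s)
        (r := List.Ico (s + 2) (g + 1) ++ u) (by simpa using h) ?_ ?_ ?_
      · unfold Lk; omega
      · intro x hx
        simp only [List.mem_cons, List.Ico.mem] at hx
        simp only [Cm, Lk]; omega
      · simp
  · obtain ⟨s, rfl⟩ : ∃ s', s = s' + 1 := ⟨s - 1, by omega⟩
    rw [path_pos hi', Ico_split_two (by omega : i ≤ s) hs] at h
    refine Red.not_sts (u := []) (p := List.Ico i s) (q := []) (s := s + 1) (t := s)
      (r := List.Ico (s + 2) (g + 1) ++ u) (by simpa using h) ?_ ?_ ?_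
    · unfold Lk; omega
    · intro x hx
      simp only [List.Ico.mem] at hx
      simp only [Cm, Lk]; omega
    · simp

theorem hook_succ {j g : ℕ} (hj : 1 ≤ j) : hook (j + 1) g = (j + 1) :: hook j g := by
  simp [hook, List.Ico.succ_top (by omega : 2 ≤ j + 1)]

theorem hook_one (g : ℕ) : hook 1 g = 0 :: 1 :: path 2 g := by
  simp [hook, path]

/-- Above `j + 1` the letter meets `s - 1, s` on the ascending side. Below `j` it meets a linked
neighbour and then itself: `s + 1, s` on the descending side, or `2` followed by `0` or `1` at the
fork. At the remaining values it meets itself directly. -/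
theorem not_red_cons_hook {j s g : ℕ} {u : List ℕ} (hj : 1 ≤ j) (hsj : s ≠ j + 1) (hs : s ≤ g) :
    ¬ Red (s :: (hook j g ++ u)) := by
  intro h
  rcases Nat.lt_or_ge (j + 1) s with h1 | h1
  · obtain ⟨s, rfl⟩ : ∃ s', s = s' + 1 := ⟨s - 1, by omega⟩
    rw [hook, Ico_split_two (by omega : 2 ≤ s) hs] at h
    refine Red.not_sts (u := []) (p := (List.Ico 2 (j + 1)).reverse ++ 0 :: 1 :: List.Ico 2 s)
      (q := []) (s := s + 1) (t := s)
      (r := List.Ico (s + 2) (g + 1) ++ u) (by simpa using h) ?_ ?_ ?_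
    · unfold Lk; omega
    · intro x hx
      simp only [List.mem_cons, List.mem_append, List.mem_reverse, List.Ico.mem] at hx
      simp only [Cm, Lk]; omega
    · simp
  rcases Nat.lt_or_ge s 2 with h2 | h2
  · rcases Nat.lt_or_ge j 2 with h3 | h3
    · obtain rfl : j = 1 := by omega
      rw [hook_one] at h
      interval_cases s
      · exact Red.not_ss (u := []) (p := []) (r := 1 :: path 2 g ++ u) h (by simp)
      · exact Red.not_ss (u := []) (p := [0]) (r := path 2 g ++ u) h (by simp [Cm, Lk])
    · rw [hook, Ico_split le_rfl (by omega : 2 ≤ j)] at h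
      have hc : ∀ x ∈ (List.Ico 3 (j + 1)).reverse, Cm s x := by
        intro x hx
        simp only [List.mem_reverse, List.Ico.mem] at hx
        simp only [Cm, Lk]; omega
      interval_cases s
      · exact Red.not_sts (u := []) (p := (List.Ico 3 (j + 1)).reverse) (t := 2) (q := [])
          (r := 1 :: List.Ico 2 (g + 1) ++ u) (by simpa using h) (by simp [Lk]) hc (by simp)
      · exact Red.not_sts (u := []) (p := (List.Ico 3 (j + 1)).reverse) (t := 2) (q := [0])
          (r := List.Ico 2 (g + 1) ++ u) (by simpa using h) (by simp [Lk]) hc (by simp [Cm, Lk])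
  · rcases Nat.lt_or_ge s j with h3 | h3
    · rw [hook, Ico_split_two h2 (by omega : s + 1 ≤ j)] at h
      refine Red.not_sts (u := []) (p := (List.Ico (s + 2) (j + 1)).reverse) (t := s + 1) (q := [])
          (r := (List.Ico 2 s).reverse ++ 0 :: 1 :: List.Ico 2 (g + 1) ++ u) (s := s)
          (by simpa using h) ?_ ?_ ?_
      · unfold Lk; omega
      · intro x hx
        simp only [List.mem_reverse, List.Ico.mem] at hx
        simp only [Cm, Lk]; omega
      · simp
    · obtain rfl : s = j := by omega
      obtain ⟨s, rfl⟩ : ∃ s', s = s' + 1 := ⟨s - 1, by omega⟩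
      rw [hook_succ (by omega)] at h
      exact Red.not_ss (u := []) (p := []) h (by simp)

/-- A word that starts with a coset representative for the letters `< g` in the letters `≤ g`. -/
inductive IsChain (g : ℕ) : List ℕ → Prop
  | nil : IsChain g []
  | path (i : ℕ) (hi : i ≤ g) : IsChain g (path i g)
  | hook (j : ℕ) (h1 : 1 ≤ j) (hj : j ≤ g) : IsChain g (hook j g)

/-- Letters are prepended one at a time. A new letter either extends the chain, or commutes with all
of it and joins `u`, or creates a forbidden pattern. -/
theorem Red.factor {g : ℕ} (hg : 2 ≤ g) {w : List ℕ} (h : Red w) (hw : ∀ x ∈ w, x ≤ g) :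
    ∃ c u, CEq w (c ++ u) ∧ (∀ x ∈ u, x < g) ∧ IsChain g c := by
  induction w with
  | nil => exact ⟨[], [], .refl, by simp, .nil⟩
  | cons s w ih =>
    obtain ⟨c, u, hcu, hu, hc⟩ := ih h.tail fun x hx => hw x (by simp [hx])
    have h' := h.ceq (hcu.cons s)
    have hs : s ≤ g := hw s (by simp)
    rcases hc with _ | ⟨i, hi⟩ | ⟨j, h1, hj⟩
    · rcases hs.lt_or_eq with hs | rfl
      · exact ⟨[], s :: u, hcu.cons s, by simpa using ⟨hs, hu⟩, .nil⟩
      · refine ⟨_, u, (hcu.cons s).trans ?_, hu, .path s le_rfl⟩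
        rw [path_pos (by omega), List.Ico.succ_singleton]
        exact .refl
    · rcases lt_trichotomy s i with h2 | rfl | h2
      · by_cases h3 : Lk s i
        · refine ⟨_, u, (hcu.cons s).trans ?_, hu, .path s hs⟩
          by_cases h4 : s = 0
          · have : i = 2 := by unfold Lk at h3; omega
            subst h4 this
            exact .refl
          · have : i = s + 1 := by unfold Lk at h3; omega
            subst this
            rw [path_cons (by omega) hs]
            exact .refl
        · by_cases h4 : i = 1
          -- The letter `0` in front of the path from `1` does not extend it as a path: the
          -- commuting pair `0 1` opens a hook.
          · have : s = 0 := by omega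
            subst h4 this
            refine ⟨_, u, (hcu.cons 0).trans ?_, hu, .hook 1 le_rfl (by omega)⟩
            rw [hook_one, path_cons le_rfl hi]
            exact .refl
          · refine ⟨_, s :: u, (hcu.cons s).trans (CEq.move u ?_), ?_, .path i hi⟩
            · intro x hx
              rw [path_pos (by omega), List.Ico.mem] at hx
              simp only [Cm, Lk] at h3 ⊢; omega
            · simpa using ⟨by omega, hu⟩
      · exfalso
        rcases Nat.eq_zero_or_pos s with rfl | h2
        · exact Red.not_ss (u := []) (p := []) h' (by simp)
        · rw [path_cons h2 hi] at h'
          exact Red.not_ss (u := []) (p := []) h' (by simp)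
      · by_cases h3 : s = 1 ∧ i = 0
        · obtain ⟨rfl, rfl⟩ := h3
          refine ⟨_, u, (hcu.cons 1).trans ?_, hu, .hook 1 le_rfl (by omega)⟩
          rw [hook_one]
          exact .single (Swap.mk [] (path 2 g ++ u) 1 0 (by simp [Cm, Lk]))
        · exact absurd h' (not_red_cons_path h2 (by omega) hs)
    · by_cases h2 : s = j + 1
      · subst h2
        refine ⟨_, u, (hcu.cons _).trans ?_, hu, .hook (j + 1) (by omega) hs⟩
        rw [hook_succ h1]
        exact .refl
      · exact absurd h' (not_red_cons_hook h1 h2 hs)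

theorem mem_path {i g x : ℕ} : x ∈ path i g ↔ (x = i ∧ i = 0) ∨ (i ≤ x ∧ x ≤ g ∧ 1 ≤ i) ∨
    (i = 0 ∧ 2 ≤ x ∧ x ≤ g) := by
  rcases Nat.eq_zero_or_pos i with rfl | h
  · simp [path_zero]
  · rw [path_pos h, List.Ico.mem]; omega

/-- If `u` could start with `k`, this `k` would slide left through the end of the path up to the
letter after the `k` of the path, giving `k (k+1) k`, or `0 2 0` at the fork. -/
theorem Red.not_desc_of_mem_path {i g k : ℕ} {u : List ℕ} (h : Red (path i g ++ u))
    (hk : k ∈ path i g) (hkg : k < g) : ¬ Desc k u := by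
  rintro ⟨v, hv⟩
  have h := h.ceq (hv.append_left _)
  rw [mem_path] at hk
  have hc : ∀ x ∈ List.Ico (k + 2) (g + 1), Cm k x ∨ k = 0 := by
    intro x hx
    rw [List.Ico.mem] at hx
    simp only [Cm, Lk]; omega
  rcases Nat.eq_zero_or_pos k with rfl | hk0
  · obtain rfl : i = 0 := by omega
    rw [path_zero] at h
    rcases Nat.lt_or_ge g 2 with hg | hg
    · rw [List.Ico.eq_nil_of_le (by omega)] at h
      exact Red.not_ss (u := []) (p := []) h (by simp)
    · rw [Ico_split le_rfl hg] at h
      refine Red.not_sts (u := []) (p := []) (t := 2) (q := List.Ico 3 (g + 1)) (s := 0) (r := v)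
        (by simpa using h) (by simp [Lk]) (by simp) ?_
      intro x hx
      rw [List.Ico.mem] at hx
      simp only [Cm, Lk]; omega
  · have hq : ∀ x ∈ List.Ico (k + 2) (g + 1), Cm k x := fun x hx => (hc x hx).resolve_right
      (by omega)
    have hl : Lk k (k + 1) := by unfold Lk; omega
    rcases Nat.eq_zero_or_pos i with rfl | h2
    · rw [path_zero, Ico_split_two (by omega : 2 ≤ k) hkg] at h
      exact Red.not_sts (u := 0 :: List.Ico 2 k) (p := []) (t := k + 1)
        (q := List.Ico (k + 2) (g + 1)) (s := k) (r := v)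
        (by simpa using h) hl (by simp) hq
    · rw [path_pos h2, Ico_split_two (by omega : i ≤ k) hkg] at h
      exact Red.not_sts (u := List.Ico i k) (p := []) (t := k + 1)
        (q := List.Ico (k + 2) (g + 1)) (s := k) (r := v)
        (by simpa using h) hl (by simp) hq

/-- The ascending part of a hook contains every letter up to `g`, so each possible first letter of
`u` is blocked by the argument for paths. The letter `0` slides past the `1` of the hook to meet `0
2`. -/
theorem Red.eq_nil_of_hook {j g : ℕ} (hg : 2 ≤ g) {u : List ℕ} (h : Red (hook j g ++ u))
    (hu : ∀ x ∈ u, x < g) : u = [] := by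
  rcases u with _ | ⟨k, u⟩
  · rfl
  exfalso
  have hk : k < g := hu k (by simp)
  rw [hook] at h
  rcases Nat.eq_zero_or_pos k with rfl | hk0
  · rw [Ico_split le_rfl hg] at h
    refine Red.not_sts (u := (List.Ico 2 (j + 1)).reverse) (p := [1]) (t := 2)
      (q := List.Ico 3 (g + 1)) (s := 0) (r := u)
      (by simpa using h) (by simp [Lk]) (by simp [Cm, Lk]) ?_
    intro x hx
    rw [List.Ico.mem] at hx
    simp only [Cm, Lk]; omega
  · refine Red.not_desc_of_mem_path (i := 1) (g := g) (u := k :: u) (k := k) ?_ ?_ hk ⟨u, .refl⟩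
    · refine Red.right (p := (List.Ico 2 (j + 1)).reverse ++ [0]) ?_
      rw [path_cons le_rfl (by omega)]
      simpa [path] using h
    · rw [mem_path]; omega

open Cfg

/-! ## The action of words on decorated matchings -/

/-- The nodes of a box of infinite width. -/
abbrev Nd : Type := ℕ ⊕ ℕ

/-- The left one of the nodes joined by the letter `k`. -/
def ndL (k : ℕ) : Nd := Sum.inl (k - 1)

/-- The right one of the nodes joined by the letter `k`. -/
def ndR (k : ℕ) : Nd := Sum.inl (k - 1 + 1)

/-- The parity of the decorations on the new edges for the letter `k`. -/
def par (k : ℕ) : ZMod 2 := if k = 0 then 1 else 0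

theorem ndL_ne_ndR (k : ℕ) : ndL k ≠ ndR k := by simp [ndL, ndR]

/-- Multiplication on the left by the simple diagram of index `k`. -/
noncomputable def op (k : ℕ) (x : Cfg Nd) : Cfg Nd := x.join (ndL k) (ndR k) (par k) (ndL_ne_ndR k)

/-- The exponent of `δ` in this product. -/
noncomputable def em (k : ℕ) (x : Cfg Nd) : ℕ := x.emit (ndL k) (ndR k) (par k)

/-- Join the north and the south node of index `g`. -/
noncomputable def vert (g : ℕ) (x : Cfg Nd) : Cfg Nd := x.join (Sum.inl g) (Sum.inr g) 0 (by simp)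

theorem op_idem (k : ℕ) (x : Cfg Nd) : op k (op k x) = op k x := join_idem _ _ _

theorem em_op (k : ℕ) (x : Cfg Nd) : em k (op k x) = 1 := emit_eq_one _ (op_idem k x)

theorem op_eq_self {k : ℕ} {x : Cfg Nd} :
    op k x = x ↔ x.f (ndL k) = ndR k ∧ (x.flag ∨ x.g (ndL k) = par k) := join_eq_self _

theorem op_comm {s t : ℕ} (h : Cm s t) (x : Cfg Nd) : op s (op t x) = op t (op s x) := by
  by_cases h1 : s ≤ 1 ∧ t ≤ 1
  · have h2 : ndL s = ndL t := by simp only [ndL, Sum.inl.injEq]; omega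
    have h3 : ndR s = ndR t := by simp only [ndR, Sum.inl.injEq]; omega
    simp only [op, h2, h3]
    exact join_comm_self _ _ _ _
  · simp only [Cm, Lk] at h
    apply join_comm <;> simp only [ndL, ndR, ne_eq, Sum.inl.injEq] <;> omega

theorem em_comm {s t : ℕ} (h : Cm s t) (x : Cfg Nd) :
    em s (op t x) + em t x = em t (op s x) + em s x := by
  by_cases h1 : s ≤ 1 ∧ t ≤ 1
  · have h2 : ndL s = ndL t := by simp only [ndL, Sum.inl.injEq]; omega
    have h3 : ndR s = ndR t := by simp only [ndR, Sum.inl.injEq]; omega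
    simp only [op, em, h2, h3]
    exact emit_comm_self _ _ _ _
  · simp only [Cm, Lk] at h
    apply emit_comm <;> simp only [ndL, ndR, ne_eq, Sum.inl.injEq] <;> omega

/-- Linked letters share exactly one of their two nodes; this is the situation of `join_braid`. -/
theorem Lk.cases {s t : ℕ} (h : Lk s t) :
    (ndR s = ndL t ∧ ndL s ≠ ndR t) ∨ (ndL s = ndR t ∧ ndR s ≠ ndL t) := by
  simp only [ndL, ndR, ne_eq, Sum.inl.injEq]
  unfold Lk at h
  omega

theorem op_braid {s t : ℕ} (h : Lk s t) (x : Cfg Nd) : op s (op t (op s x)) = op s x := by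
  rcases h.cases with ⟨h1, h2⟩ | ⟨h1, h2⟩
  · have := join_braid (par s) (par t) (ndL_ne_ndR s) (h1 ▸ ndL_ne_ndR t) h2 x
    simpa only [op, h1] using this
  · have := join_braid (par s) (par t) (ndL_ne_ndR s).symm (h1 ▸ (ndL_ne_ndR t).symm) h2 x
    simp only [op]
    rw [join_symm _ (ndL_ne_ndR s), join_symm _ (ndL_ne_ndR t), join_symm _ (ndL_ne_ndR s)]
    simpa only [h1] using this

theorem op_f_ne {s t : ℕ} (h : Lk s t) {x : Cfg Nd} (hx : op t x = x) : x.f (ndL s) ≠ ndR s := by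
  have h0 := (op_eq_self.1 hx).1
  have hi := x.invol
  rcases h.cases with ⟨h1, h2⟩ | ⟨h1, h2⟩ <;> grind

theorem em_eq_zero {s : ℕ} {x : Cfg Nd} (h : x.f (ndL s) ≠ ndR s) : em s x = 0 := by
  simp [em, emit, h]

theorem op_flag_iff {s : ℕ} {x : Cfg Nd} (h : x.f (ndL s) ≠ ndR s) : (op s x).flag ↔ x.flag := by
  simp [op, join, h]

theorem not_op_op {s t : ℕ} (h : Lk s t) {x : Cfg Nd} (hs : op s x = x) (ht : op t x = x) :
    False :=
  op_f_ne h ht (op_eq_self.1 hs).1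

theorem vert_comm {k g : ℕ} (hk : k < g) (hg : 2 ≤ g) (x : Cfg Nd) :
    vert g (op k x) = op k (vert g x) := by
  apply join_comm <;> simp [ndL, ndR] <;> omega

theorem vert_eq_self {g : ℕ} {x : Cfg Nd} :
    vert g x = x ↔ x.f (Sum.inl g) = Sum.inr g ∧ (x.flag ∨ x.g (Sum.inl g) = 0) := join_eq_self _

theorem ndR_of_pos {g : ℕ} (hg : 1 ≤ g) : ndR g = Sum.inl g := by simp [ndR]; omega

/-- `vert g` behaves like a generator linked to `g` and commuting with the smaller letters, except
that it fixes the identity. It can therefore take the place of the letter `g + 1` at the end of a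
path. -/
theorem vert_op_vert {g : ℕ} (hg : 1 ≤ g) (x : Cfg Nd) : vert g (op g (vert g x)) = vert g x := by
  have h : Sum.inl g ≠ ndL g := by simp [ndL]; omega
  have := join_braid (x := x) 0 (par g) (a := Sum.inr g) (b := Sum.inl g) (c := ndL g)
    (by simp) h (by simp [ndL])
  simp only [vert, op]
  rw [join_symm _ _ x, join_symm _ (ndL_ne_ndR g), join_symm]
  simpa only [ndR_of_pos hg] using this

theorem op_vert_op {s g : ℕ} (hs : ndR s = Sum.inl g) (x : Cfg Nd) :
    op s (vert g (op s x)) = op s x := by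
  have := join_braid (x := x) (par s) 0 (a := ndL s) (b := Sum.inl g) (c := Sum.inr g)
    (hs ▸ ndL_ne_ndR s) (by simp) (by simp [ndL])
  simp only [vert, op]
  simpa only [hs] using this

theorem not_op_vert {g : ℕ} (hg : 1 ≤ g) {x : Cfg Nd} (h : vert g x = x) :
    x.f (ndL g) ≠ ndR g := by
  have h0 := (vert_eq_self.1 h).1
  have hi := x.invol
  rw [ndR_of_pos hg]
  have : ndL g ≠ Sum.inr g := by simp [ndL]
  grind

/-- The identity diagram. -/
def one : Cfg Nd where
  f := Sum.swap
  g _ := 0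
  flag := False
  invol := Sum.swap_swap
  ne := by rintro (i | i) <;> simp
  g_f _ := rfl
  g_flag h := h.elim

/-- The identity diagram with a decorated loop. -/
def oneFlag : Cfg Nd where
  f := Sum.swap
  g _ := 0
  flag := True
  invol := Sum.swap_swap
  ne := by rintro (i | i) <;> simp
  g_f _ := rfl
  g_flag _ _ := rfl

theorem op_one_ne (k : ℕ) : op k one ≠ one := by
  intro h
  have := (op_eq_self.1 h).1
  simp [one, ndL, ndR] at this

theorem op_oneFlag_ne (k : ℕ) : op k oneFlag ≠ oneFlag := by
  intro h
  have := (op_eq_self.1 h).1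
  simp [oneFlag, ndL, ndR] at this

theorem vert_one (g : ℕ) : vert g one = one := by simp [vert_eq_self, one]

theorem vert_oneFlag (g : ℕ) : vert g oneFlag = oneFlag := by simp [vert_eq_self, oneFlag]

/-- The action of a word. -/
noncomputable def act (w : List ℕ) (x : Cfg Nd) : Cfg Nd := w.foldr op x

/-- The total exponent of `δ` in the action of a word. -/
noncomputable def expo : List ℕ → Cfg Nd → ℕ
  | [], _ => 0
  | s :: w, x => em s (act w x) + expo w x

/-- The diagram of a word. -/
noncomputable abbrev nf (w : List ℕ) : Cfg Nd := act w one

@[simp] theorem act_nil (x : Cfg Nd) : act [] x = x := rfl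

@[simp] theorem act_cons (s : ℕ) (w : List ℕ) (x : Cfg Nd) : act (s :: w) x = op s (act w x) := rfl

theorem act_append (v w : List ℕ) (x : Cfg Nd) : act (v ++ w) x = act v (act w x) := by
  simp [act]

theorem expo_append (v w : List ℕ) (x : Cfg Nd) :
    expo (v ++ w) x = expo v (act w x) + expo w x := by
  induction v with
  | nil => simp [expo]
  | cons s v ih => simp [expo, ih, act_append, add_assoc]

theorem act_ceq {v w : List ℕ} (h : CEq v w) (x : Cfg Nd) : act v x = act w x := by
  induction h with
  | refl => rfl
  | tail _ h ih =>
    obtain ⟨l, r, s, t, h⟩ := h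
    rw [ih]
    simp [act_append, op_comm h]

theorem expo_ceq {v w : List ℕ} (h : CEq v w) (x : Cfg Nd) : expo v x = expo w x := by
  induction h with
  | refl => rfl
  | tail _ h ih =>
    obtain ⟨l, r, s, t, h⟩ := h
    rw [ih]
    have := em_comm h (act r x)
    simp only [expo_append, expo, act_cons, op_comm h]
    omega

/-- Every word can be rewritten to a reduced one. -/
theorem exists_red (w : List ℕ) : ∃ v, Red v ∧ v.length ≤ w.length ∧
    (v.length = w.length → CEq w v) ∧ (∀ x, act v x = act w x) ∧ ∀ k ∈ v, k ∈ w := by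
  induction h : w.length using Nat.strong_induction_on generalizing w with
  | _ n ih =>
  subst h
  by_cases hw : Red w
  · exact ⟨w, hw, le_rfl, fun _ => .refl, fun _ => rfl, fun _ => id⟩
  obtain ⟨w', hww', hb⟩ : ∃ w', CEq w w' ∧ Bad w' := by simpa [Red] using hw
  obtain ⟨w'', hl, hact, hmem⟩ : ∃ w'', w''.length < w'.length ∧ (∀ x, act w'' x = act w' x) ∧
      ∀ k ∈ w'', k ∈ w' := by
    rcases hb with ⟨l, r, s, rfl⟩ | ⟨l, r, s, t, hst, rfl⟩
    · exact ⟨l ++ s :: r, by simp, fun x => by simp [act_append, op_idem], by simp⟩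
    · exact ⟨l ++ s :: r, by simp, fun x => by simp [act_append, op_braid hst], by simp; grind⟩
  have hlen := hww'.length_eq
  obtain ⟨v, h1, h2, h3, h4, h5⟩ := ih _ (by omega) w'' rfl
  exact ⟨v, h1, by omega, by omega, fun x => by rw [h4, hact, act_ceq hww'],
    fun k hk => hww'.perm.mem_iff.2 (hmem k (h5 k hk))⟩

theorem op_nf_of_desc {k : ℕ} {w : List ℕ} (h : Desc k w) (x : Cfg Nd) :
    op k (act w x) = act w x := by
  obtain ⟨v, hv⟩ := h
  rw [act_ceq hv, act_cons, op_idem]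

theorem vert_act {g : ℕ} (hg : 2 ≤ g) {w : List ℕ} (hw : ∀ x ∈ w, x < g) (x : Cfg Nd) :
    vert g (act w x) = act w (vert g x) := by
  induction w with
  | nil => rfl
  | cons s w ih =>
    rw [act_cons, vert_comm (hw s (by simp)) hg, ih fun y hy => hw y (by simp [hy]), act_cons]

theorem vert_nf {g : ℕ} (hg : 2 ≤ g) {w : List ℕ} (hw : ∀ x ∈ w, x < g) :
    vert g (nf w) = nf w := by
  rw [vert_act hg hw, vert_one]

theorem lt_of_op_nf {g k : ℕ} (hg : 2 ≤ g) {w : List ℕ} (hw : ∀ x ∈ w, x < g)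
    (h : op k (nf w) = nf w) : k < g := by
  by_contra hk
  exact not_op_vert (by omega) (vert_nf (by omega) fun x hx => (hw x hx).trans_le (not_lt.1 hk))
    (op_eq_self.1 h).1

theorem act_move {k : ℕ} {c : List ℕ} (h : ∀ x ∈ c, Cm k x) (x : Cfg Nd) :
    op k (act c x) = act c (op k x) := by
  have := act_ceq (CEq.move [] h) x
  simpa [act_append] using this

/-! ## The diagrams of coset representatives -/

theorem path_self {g : ℕ} (hg : 1 ≤ g) : path g g = [g] := by
  rw [path_pos hg, List.Ico.succ_singleton]

theorem lk_succ {i : ℕ} (hi : 1 ≤ i) : Lk i (i + 1) := by unfold Lk; omega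

theorem lk_zero_two : Lk 0 2 := by unfold Lk; omega

theorem op_path_self {i g : ℕ} (hi : i ≤ g) (x : Cfg Nd) :
    op i (act (path i g) x) = act (path i g) x := by
  rcases Nat.eq_zero_or_pos i with rfl | h
  · rw [path_zero_cons, act_cons, op_idem]
  · rw [path_cons h hi, act_cons, op_idem]

theorem op_path_succ {i g : ℕ} (hi : 1 ≤ i) (hig : i < g) (x : Cfg Nd) :
    op (i + 1) (act (path i g) x) = act (path (i + 1) g) x := by
  rw [path_cons hi hig.le, path_cons (by omega) hig, act_cons, act_cons,
    op_braid (lk_succ hi).symm]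

theorem op_path_zero {g : ℕ} (hg : 2 ≤ g) (x : Cfg Nd) :
    op 2 (act (path 0 g) x) = act (path 2 g) x := by
  rw [path_zero_cons, path_cons (by omega) hg, act_cons, act_cons, op_braid lk_zero_two.symm]

/-- Downward induction from the end of the path, in which the fork makes `0` follow `2` rather than
`1`. -/
theorem path_induction {g : ℕ} {P : ℕ → Prop} (hg : 2 ≤ g) (base : P g)
    (succ : ∀ i, 1 ≤ i → i < g → P (i + 1) → P i) (zero : P 2 → P 0) {i : ℕ} (hi : i ≤ g) :
    P i := by
  have h : ∀ d, d < g → P (g - d) := by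
    intro d hd
    induction d with
    | zero => exact base
    | succ d ih =>
      refine succ _ (by omega) (by omega) ?_
      rw [show g - (d + 1) + 1 = g - d by omega]
      exact ih (by omega)
  rcases Nat.eq_zero_or_pos i with rfl | h'
  · have := h (g - 2) (by omega)
    rw [show g - (g - 2) = 2 by omega] at this
    exact zero this
  · have := h (g - i) (by omega)
    rwa [show g - (g - i) = i by omega] at this

/-- The path is undone from the left: applying the next letter removes the first one by the braid
relation, and at the end `vert g` recovers `x` from `op g x`. -/
theorem act_path_inj {g i : ℕ} (hg : 2 ≤ g) (hi : i ≤ g) {x y : Cfg Nd} (hx : vert g x = x)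
    (hy : vert g y = y) (h : act (path i g) x = act (path i g) y) : x = y := by
  have key : act (path i g) x = act (path i g) y → x = y := by
    refine path_induction (P := fun i => act (path i g) x = act (path i g) y → x = y) hg ?_ ?_ ?_ hi
    · intro h
      rw [path_self (by omega)] at h
      have h2 := congrArg (vert g) h
      simp only [act_cons, act_nil] at h2
      rwa [← hx, ← hy, vert_op_vert (by omega), vert_op_vert (by omega), hx, hy] at h2
    · intro i h1 h2 ih h
      apply ih
      rw [← op_path_succ h1 h2, ← op_path_succ h1 h2, h]
    · intro ih h
      apply ih
      rw [← op_path_zero hg, ← op_path_zero hg, h]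
  exact key h

/-- After the part of the path already applied, one of the two nodes to be joined next is used by an
edge to a third node (for the last letter `g`, by the vertical edge at `g`), so no loop closes. -/
theorem expo_path {g i : ℕ} (hg : 2 ≤ g) (hi : i ≤ g) {x : Cfg Nd} (hx : vert g x = x) :
    expo (path i g) x = 0 := by
  refine path_induction (P := fun i => expo (path i g) x = 0) hg ?_ ?_ ?_ hi
  · rw [path_self (by omega)]
    simp [expo, em_eq_zero (not_op_vert (by omega) hx)]
  · intro i h1 h2 ih
    rw [path_cons h1 h2.le, expo, ih,
      em_eq_zero (op_f_ne (lk_succ h1) (op_path_self (by omega) x))]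
  · intro ih
    rw [path_zero_cons, expo, ih, em_eq_zero (op_f_ne lk_zero_two (op_path_self (by omega) x))]

theorem flag_path {g i : ℕ} (hg : 2 ≤ g) (hi : i ≤ g) {x : Cfg Nd} (hx : vert g x = x) :
    (act (path i g) x).flag ↔ x.flag := by
  refine path_induction (P := fun i => (act (path i g) x).flag ↔ x.flag) hg ?_ ?_ ?_ hi
  · rw [path_self (by omega)]
    exact op_flag_iff (not_op_vert (by omega) hx)
  · intro i h1 h2 ih
    rw [← ih, path_cons h1 h2.le, act_cons,
      op_flag_iff (op_f_ne (lk_succ h1) (op_path_self (by omega) x))]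
  · intro ih
    rw [← ih, path_zero_cons, act_cons,
      op_flag_iff (op_f_ne lk_zero_two (op_path_self (by omega) x))]

/-! ### Letters that fix the diagram of a path -/

/-- If `A`, `B`, `C` satisfy the relations of three consecutive generators, then `C` fixes
`A B y` for a fixed point `y` of `C` only if `A` fixes `y`. -/
theorem fixed_of_braid {X : Type*} {A B C : X → X} (hAC : ∀ x, A (C x) = C (A x))
    (hB : ∀ x, B (A (B x)) = B x) (hC : ∀ x, C (B (C x)) = C x) {y : X} (hy : C y = y)
    (h : C (A (B y)) = A (B y)) : A y = y := by
  -- The element `C (B (A y))` is computed twice: it equals `y` because `A y = A (B y)`, and it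
  -- equals `A y` because `A` commutes with `C`.
  have h1 : A y = A (B y) := by
    rw [← h, ← hAC]; conv_rhs => rw [← hy]
    rw [hC, hy]
  have h2 : C (B (A y)) = y := by
    rw [h1, hB]; conv_lhs => rw [← hy]
    rw [hC, hy]
  have h3 : C (B (A y)) = A y := by
    conv_lhs => rw [← hy, hAC, hC, ← hAC, hy]
  rw [← h3, h2]

/-- Applying `i + 1, i + 2, …` strips the path from the left and commutes with `k`, as long as the
first letter is below `k - 2`. In the remaining case the letters `k - 2, k - 1, k` are consecutive
and `fixed_of_braid` applies. -/
theorem fixed_of_path {g i k : ℕ} (hik : i + 2 ≤ k) (hi : 1 ≤ i) (hk : k ≤ g)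
    {x : Cfg Nd} (h : op k (act (path i g) x) = act (path i g) x) :
    op (k - 2) (act (path k g) x) = act (path k g) x := by
  obtain ⟨d, rfl⟩ : ∃ d, k = i + 2 + d := ⟨k - (i + 2), by omega⟩
  induction d generalizing i with
  | zero =>
    rw [path_cons hi (by omega), path_cons (by omega) (by omega)] at h
    exact fixed_of_braid (A := op i) (B := op (i + 1)) (C := op (i + 2))
      (fun x => op_comm (by unfold Cm Lk; omega) x) (fun x => op_braid (lk_succ hi).symm x)
      (fun x => op_braid (lk_succ (by omega)).symm x) (op_path_self (by omega) x) h
  | succ d ih =>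
    have := ih (i := i + 1) (by omega) (by omega) (by omega) (by
      rw [← op_path_succ hi (by omega), ← op_comm (by unfold Cm Lk; omega)]
      rw [show i + 1 + 2 + d = i + 2 + (d + 1) by omega, h])
    rwa [show i + 1 + 2 + d = i + 2 + (d + 1) by omega] at this

/-- No letter of the path below `g` fixes `x`. -/
def Avoids (i g : ℕ) (x : Cfg Nd) : Prop := ∀ k ∈ path i g, k < g → op k x ≠ x

theorem cm_path {i g k : ℕ} (hi : k + 1 < i) (h : ¬ Lk k i) : ∀ x ∈ path i g, Cm k x := by
  intro x hx
  rw [mem_path] at hx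
  unfold Cm Lk at *; omega

theorem op_fixed_of_cm {i g k : ℕ} (hg : 2 ≤ g) (hi : i ≤ g) (hk : k < g)
    (hc : ∀ x ∈ path i g, Cm k x) {x : Cfg Nd} (hx : vert g x = x)
    (h : op k (act (path i g) x) = act (path i g) x) : op k x = x := by
  refine act_path_inj hg hi ?_ hx ?_
  · rw [vert_comm hk hg, hx]
  · rw [← act_move hc, h]

/-- This makes the start of the path visible in the diagram. A letter below `i` that is not linked
to `i` commutes with the path and so must fix `x`. A letter above would make `k - 2`, or `0` when
the path is `0, 2, 3, …` and `k = 3`, fix `x` although it lies on the path. Linked letters cannot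
both fix a diagram. Only the fork pair `0`, `1` escapes; the flag settles it later. -/
theorem path_fixed {i g k : ℕ} (hg : 2 ≤ g) (hi : i ≤ g) (hk : k ≤ g) {x : Cfg Nd}
    (hx : vert g x = x) (ha : Avoids i g x) (h : op k (act (path i g) x) = act (path i g) x) :
    k = i ∨ (k + 1 < i ∧ (∀ y ∈ path i g, Cm k y) ∧ op k x = x) ∨
      (i = 0 ∧ k = 1) ∨ (i = 1 ∧ k = 0) := by
  by_cases hki : k = i
  · exact .inl hki
  have hl : ¬ Lk k i := fun hl => not_op_op hl h (op_path_self hi x)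
  rcases lt_or_gt_of_ne hki with h1 | h1
  · by_cases h2 : i = 1
    · omega
    · have h3 : k + 1 < i := by unfold Lk at hl; omega
      exact .inr (.inl ⟨h3, cm_path h3 hl, op_fixed_of_cm hg hi (by omega) (cm_path h3 hl) hx h⟩)
  · by_cases h01 : i = 0 ∧ k = 1
    · exact .inr (.inr (.inl h01))
    exfalso
    have main : ∀ j, j ∈ path i g → j < g → j + 1 < k → ¬ Lk j k →
        op j (act (path k g) x) = act (path k g) x → False := fun j h1 h2 h3 h4 h5 =>
      ha j h1 h2 (op_fixed_of_cm hg hk h2 (cm_path h3 h4) hx h5)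
    rcases Nat.eq_zero_or_pos i with rfl | hi0
    · have hk3 : 3 ≤ k := by unfold Lk at hl; omega
      rcases hk3.eq_or_lt with rfl | hk4
      · refine main 0 (by rw [mem_path]; omega) (by omega) (by omega) (by unfold Lk; omega) ?_
        rw [path_zero_cons, path_cons (by omega) hg] at h
        exact fixed_of_braid (A := op 0) (B := op 2) (C := op 3)
          (fun x => op_comm (by unfold Cm Lk; omega) x) (fun x => op_braid lk_zero_two.symm x)
          (fun x => op_braid (lk_succ (by omega)).symm x) (op_path_self (by omega) x) h
      · refine main (k - 2) (by rw [mem_path]; omega) (by omega) (by omega)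
          (by unfold Lk; omega) (fixed_of_path (i := 2) (by omega) (by omega) hk ?_)
        rw [← op_path_zero hg, op_comm (by unfold Cm Lk; omega), h]
    · have hk3 : i + 2 ≤ k := by unfold Lk at hl; omega
      exact main (k - 2) (by rw [mem_path]; omega) (by omega) (by omega)
            (by unfold Lk; omega) (fixed_of_path hk3 hi0 hk h)

/-- The argument of `fixed_of_path` with `vert g` in the role of the letter `k`. -/
theorem fixed_of_path_vert {i g : ℕ} (hi : 1 ≤ i) (hig : i < g) {x : Cfg Nd} (hx : vert g x = x)
    (h : vert g (act (path i g) x) = act (path i g) x) : op (g - 1) x = x := by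
  obtain ⟨d, rfl⟩ : ∃ d, g = i + 1 + d := ⟨g - (i + 1), by omega⟩
  induction d generalizing i with
  | zero =>
    rw [path_cons hi (by omega), path_self (by omega)] at h
    exact fixed_of_braid (A := op i) (B := op (i + 1)) (C := vert (i + 1))
      (fun x => (vert_comm (by omega) (by omega) x).symm) (fun x => op_braid (lk_succ hi).symm x)
      (fun x => vert_op_vert (by omega) x) hx h
  | succ d ih =>
    have e : i + 1 + 1 + d = i + 1 + (d + 1) := by omega
    have := ih (i := i + 1) (by omega) (by omega) (by rwa [e]) (by
        rw [e, ← op_path_succ hi (by omega), vert_comm (by omega) (by omega), h])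
    rwa [e] at this

/-- Diagrams of words in the letters `< g` are fixed by `vert g`; this separates them from those of
words that involve `g`. -/
theorem path_not_vert {i g : ℕ} (hg : 2 ≤ g) (hi : i ≤ g) {x : Cfg Nd}
    (hx : vert g x = x) (ha : Avoids i g x) : vert g (act (path i g) x) ≠ act (path i g) x := by
  intro h
  rcases hi.eq_or_lt with rfl | hi
  · exact not_op_vert (by omega) h (op_eq_self.1 (op_path_self le_rfl x)).1
  rcases Nat.eq_zero_or_pos i with rfl | hi0
  · rcases hg.eq_or_lt with rfl | hg3
    · refine ha 0 (by rw [mem_path]; omega) (by omega) ?_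
      rw [path_zero_cons, path_self (by omega)] at h
      exact fixed_of_braid (A := op 0) (B := op 2) (C := vert 2)
        (fun x => (vert_comm (by omega) (by omega) x).symm) (fun x => op_braid lk_zero_two.symm x)
        (fun x => vert_op_vert (by omega) x) hx h
    · refine ha (g - 1) (by rw [mem_path]; omega) (by omega)
        (fixed_of_path_vert (by omega) hg3 hx ?_)
      rw [← op_path_zero hg, vert_comm (by omega) hg, h]
  · exact ha (g - 1) (by rw [mem_path]; omega) (by omega) (fixed_of_path_vert hi0 hi hx h)

/-! ### Hooks and the odd loop -/

theorem Cfg.ext_of_flag {V : Type*} {x y : Cfg V} (hx : x.flag) (hy : y.flag) (h : x.f = y.f) :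
    x = y := by
  ext1
  · exact h
  · ext v; rw [x.g_flag hx, y.g_flag hy]
  · simp [hx, hy]

theorem op_f_congr {x y : Cfg Nd} (h : x.f = y.f) (k : ℕ) : (op k x).f = (op k y).f := by
  simp [op, join, h]

theorem act_f_congr {x y : Cfg Nd} (h : x.f = y.f) (w : List ℕ) : (act w x).f = (act w y).f := by
  induction w with
  | nil => exact h
  | cons s w ih => exact op_f_congr ih s

theorem op_zero_f (x : Cfg Nd) : (op 0 x).f = (op 1 x).f := rfl

theorem op_flag_of_flag {x : Cfg Nd} (h : x.flag) (k : ℕ) : (op k x).flag := Or.inl h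

theorem op_zero_one_flag (x : Cfg Nd) : (op 0 (op 1 x)).flag :=
  join_join_flag (e := 1) (e' := 0) (by decide) _ x

theorem op_zero_one_f (x : Cfg Nd) : (op 0 (op 1 x)).f = (op 1 x).f := by
  rw [op_zero_f, op_idem]

theorem act_flag_of_flag {x : Cfg Nd} (h : x.flag) (w : List ℕ) : (act w x).flag := by
  induction w with
  | nil => exact h
  | cons s w ih => exact op_flag_of_flag ih s

/-- The pair `0 1` draws the same edges as `1` alone and creates an odd loop, which erases all
decorations. The descending letters of the hook then strip the path by the braid relation. -/
theorem nf_hook {j g : ℕ} (h1 : 1 ≤ j) (hj : j ≤ g) :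
    nf (hook j g) = act (path j g) oneFlag := by
  induction j, h1 using Nat.le_induction with
  | base =>
    refine Cfg.ext_of_flag ?_ (act_flag_of_flag trivial _) ?_
    · rw [hook_one]; exact op_zero_one_flag _
    · rw [hook_one, path_cons le_rfl hj]
      simp only [nf, act_cons]
      rw [op_zero_one_f]
      exact op_f_congr (act_f_congr (x := one) (y := oneFlag) rfl _) _
  | succ j h1 ih =>
    rw [hook_succ h1, nf, act_cons, ← nf, ih (by omega), op_path_succ h1 hj]

theorem expo_hook {j g : ℕ} (hg : 2 ≤ g) (h1 : 1 ≤ j) (hj : j ≤ g) : expo (hook j g) one = 0 := by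
  induction j, h1 using Nat.le_induction with
  | base =>
    have h2 : act (1 :: path 2 g) one = act (path 1 g) one := by rw [path_cons le_rfl hj]
    have h3 : expo (1 :: path 2 g) one = 0 := by
      have := expo_path hg hj (vert_one g)
      rwa [path_cons le_rfl hj] at this
    rw [hook_one, expo, h3, h2]
    have h4 : ¬ (act (path 1 g) one).flag := by
      rw [flag_path hg hj (vert_one g)]; exact id
    -- The edge made by the letter `1` is undecorated, so the loop closed by `0` is odd: it raises
    -- the flag and contributes no power of `δ`.
    have h5 := op_eq_self.1 (op_path_self hj one)
    have h6 := h5.2.resolve_left h4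
    have h7 : (act (path 1 g) one).g (ndL 0) = 0 := h6
    simp [em, emit, h4, h7, par]
  | succ j h1 ih =>
    rw [hook_succ h1, expo, ih (by omega), ← nf, nf_hook h1 (by omega),
      em_eq_zero (op_f_ne (lk_succ h1).symm (op_path_self (by omega) oneFlag))]

/-! ## Reduced words are determined by their diagrams -/

/-- What is proved by induction for the reduced words in the letters `< g`. -/
structure Faithful (g : ℕ) : Prop where
  expo : ∀ w, Red w → (∀ x ∈ w, x < g) → expo w one = 0
  flag : ∀ w, Red w → (∀ x ∈ w, x < g) → (nf w).flag → ∃ l r, CEq w (l ++ 0 :: 1 :: r)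
  desc : ∀ w, Red w → (∀ x ∈ w, x < g) → ∀ k, op k (nf w) = nf w → Desc k w
  inj : ∀ v w, Red v → Red w → (∀ x ∈ v, x < g) → (∀ x ∈ w, x < g) → nf v = nf w → CEq v w

/-- Base of the induction: the letters `0` and `1` commute. -/
theorem Red.of_lt_two {w : List ℕ} (h : Red w) (hw : ∀ x ∈ w, x < 2) :
    CEq w [] ∨ CEq w [0] ∨ CEq w [1] ∨ CEq w [0, 1] := by
  induction w with
  | nil => exact .inl .refl
  | cons s w ih =>
    have hs : s = 0 ∨ s = 1 := by have := hw s (by simp); omega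
    have h10 : CEq [1, 0] [0, 1] := .single (Swap.mk [] [] 1 0 (by simp [Cm, Lk]))
    rcases ih h.tail fun x hx => hw x (by simp [hx]) with h1 | h1 | h1 | h1 <;>
      have h2 := h.ceq (h1.cons s) <;> have h3 := h1.cons s <;> rcases hs with rfl | rfl
    · exact .inr (.inl h3)
    · exact .inr (.inr (.inl h3))
    · exact (h2.not_ss (u := []) (p := []) (by simp)).elim
    · exact .inr (.inr (.inr (h3.trans h10)))
    · exact .inr (.inr (.inr h3))
    · exact (h2.not_ss (u := []) (p := []) (by simp)).elim
    · exact (h2.not_ss (u := []) (p := []) (by simp)).elim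
    · exact (h2.not_ss (u := []) (p := [0]) (by simp [Cm, Lk])).elim

theorem one_f_ne (k : ℕ) : one.f (ndL k) ≠ ndR k := by simp [one, ndL, ndR]

theorem Red.desc_of_lt_two {w : List ℕ} (h : Red w) (hw : ∀ x ∈ w, x < 2) {k : ℕ} :
    op k (nf w) = nf w ↔ k ∈ w := by
  have h10 : CEq [0, 1] [1, 0] := .single (Swap.mk [] [] 0 1 (by simp [Cm, Lk]))
  have hfl : ∀ k, ¬ (op k one).flag := fun k => by rw [op_flag_iff (one_f_ne k)]; exact id
  have hg : ∀ j k, j < 2 → (op k one).g (ndL j) = par k ∨ 2 ≤ k := by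
    intro j k hj
    have := join_g (ndL_ne_ndR k) one (hfl k) (ndL j)
    by_cases hk : 2 ≤ k
    · exact .inr hk
    · refine .inl (this.trans ?_)
      have : ndL j = ndL k := by simp only [ndL, Sum.inl.injEq]; omega
      simp [joinDeco, this]
  constructor
  · intro hk
    have hk2 := lt_of_op_nf le_rfl hw hk
    rcases h.of_lt_two hw with h1 | h1 | h1 | h1 <;> rw [nf, act_ceq h1] at hk <;>
      rw [h1.perm.mem_iff]
    · exact absurd hk (op_one_ne k)
    · have h2 := (op_eq_self.1 hk).2.resolve_left (hfl 0)
      have h3 := (hg k 0 hk2).resolve_right (by omega)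
      interval_cases k
      · simp
      · exact absurd (h3.symm.trans h2) (by decide)
    · have h2 := (op_eq_self.1 hk).2.resolve_left (hfl 1)
      have h3 := (hg k 1 hk2).resolve_right (by omega)
      interval_cases k
      · exact absurd (h3.symm.trans h2) (by decide)
      · simp
    · interval_cases k <;> simp
  · intro hk
    apply op_nf_of_desc
    have hk2 := hw k hk
    rcases h.of_lt_two hw with h1 | h1 | h1 | h1 <;> rw [h1.perm.mem_iff] at hk
    · simp at hk
    · exact ⟨_, by simpa [List.mem_singleton.1 hk] using h1⟩
    · exact ⟨_, by simpa [List.mem_singleton.1 hk] using h1⟩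
    · interval_cases k
      · exact ⟨_, h1⟩
      · exact ⟨_, h1.trans h10⟩

theorem faithful_two : Faithful 2 where
  expo w h hw := by
    have hfl : ∀ k, ¬ (op k one).flag := fun k => by rw [op_flag_iff (one_f_ne k)]; exact id
    rcases h.of_lt_two hw with h1 | h1 | h1 | h1 <;> rw [expo_ceq h1]
    · rfl
    · simp [expo, em_eq_zero (one_f_ne 0)]
    · simp [expo, em_eq_zero (one_f_ne 1)]
    · have h2 : (op 1 one).g (ndL 0) = 0 := by
        rw [op, join_g _ _ (hfl 1)]; simp [joinDeco, ndL, par]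
      have h3 := em_eq_zero (one_f_ne 1)
      simp only [expo, act_cons, act_nil, h3]
      simp [em, emit, hfl, h2, par]
  flag w h hw hf := by
    have hfl : ∀ k, ¬ (op k one).flag := fun k => by rw [op_flag_iff (one_f_ne k)]; exact id
    rcases h.of_lt_two hw with h1 | h1 | h1 | h1
    · rw [nf, act_ceq h1] at hf; exact hf.elim
    · rw [nf, act_ceq h1] at hf; exact (hfl 0 hf).elim
    · rw [nf, act_ceq h1] at hf; exact (hfl 1 hf).elim
    · exact ⟨[], [], h1⟩
  desc w h hw k hk := by
    have hk' := (h.desc_of_lt_two hw).1 hk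
    have h10 : CEq [0, 1] [1, 0] := .single (Swap.mk [] [] 0 1 (by simp [Cm, Lk]))
    have hk2 := hw k hk'
    rcases h.of_lt_two hw with h1 | h1 | h1 | h1 <;> rw [h1.perm.mem_iff] at hk'
    · simp at hk'
    · exact ⟨_, by simpa [List.mem_singleton.1 hk'] using h1⟩
    · exact ⟨_, by simpa [List.mem_singleton.1 hk'] using h1⟩
    · interval_cases k
      · exact ⟨_, h1⟩
      · exact ⟨_, h1.trans h10⟩
  inj v w hv hw hv' hw' h := by
    have hmem : ∀ k, k ∈ v ↔ k ∈ w := fun k => by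
      rw [← hv.desc_of_lt_two hv', ← hw.desc_of_lt_two hw', h]
    have h0 := hmem 0
    have h1 := hmem 1
    rcases hv.of_lt_two hv' with h2 | h2 | h2 | h2 <;>
      rcases hw.of_lt_two hw' with h3 | h3 | h3 | h3 <;>
      rw [h2.perm.mem_iff, h3.perm.mem_iff] at h0 h1 <;>
      first
        | exact h2.trans h3.symm
        | (exfalso; revert h0 h1; simp)

/-- The possible forms of the diagram of a reduced word that involves the letter `g`. -/
structure PathForm (g : ℕ) (w : List ℕ) (i : ℕ) (x : Cfg Nd) : Prop where
  le : i ≤ g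
  vert : vert g x = x
  avoids : Avoids i g x
  nf : nf w = act (path i g) x
  expo : expo w one = 0
  cases : (∃ u, Red u ∧ (∀ k ∈ u, k < g) ∧ CEq w (path i g ++ u) ∧ x = TLD.nf u ∧
    (i ≤ 1 → ¬ x.flag)) ∨ (1 ≤ i ∧ x = oneFlag ∧ CEq w (hook i g))

theorem desc_of_ne_nil {u : List ℕ} (hu : u ≠ []) : ∃ k ∈ u, Desc k u := by
  rcases u with _ | ⟨k, u⟩
  · exact absurd rfl hu
  · exact ⟨k, by simp, u, .refl⟩

/-- The induction hypothesis `desc` turns the purely combinatorial fact that no letter of the path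
can start `u` into `Avoids`, a property of the diagram of `u`. -/
theorem Faithful.pathForm {g : ℕ} (hg : 2 ≤ g) (hF : Faithful g) {w : List ℕ} (h : Red w)
    (hw : ∀ x ∈ w, x < g + 1) :
    (∃ u, Red u ∧ (∀ x ∈ u, x < g) ∧ CEq w u) ∨ ∃ i x, PathForm g w i x := by
  obtain ⟨c, u, hcu, hu, hc⟩ := h.factor hg fun x hx => Nat.lt_succ_iff.1 (hw x hx)
  have h' := h.ceq hcu
  have hru : Red u := h'.right
  rcases hc with _ | ⟨i, hi⟩ | ⟨j, h1, hj⟩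
  · exact .inl ⟨u, hru, hu, hcu⟩
  · have hv := vert_nf hg hu
    have hd : ∀ k ∈ path i g, k < g → ¬ Desc k u := fun k hk hkg =>
      h'.not_desc_of_mem_path hk hkg
    have ha : Avoids i g (nf u) := fun k hk hkg he => hd k hk hkg (hF.desc u hru hu k he)
    refine .inr ⟨i, nf u, hi, hv, ha, ?_, ?_, .inl ⟨u, hru, hu, hcu, rfl, ?_⟩⟩
    · rw [nf, act_ceq hcu, act_append]
    · rw [expo_ceq hcu, expo_append, hF.expo u hru hu, expo_path hg hi hv]
    -- Suppose the diagram of `u` had an odd loop and `i ≤ 1`. A first letter `k ≥ 2` of `u` would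
    -- lie on the path, so `k ≤ 1`. The letters `i` and `k` join the same nodes and the flag makes
    -- parities irrelevant, so `i` fixes the diagram as well, contrary to `Avoids`.
    · intro hi1 hfl
      have hne : u ≠ [] := by rintro rfl; exact hfl
      obtain ⟨k, hk, hdk⟩ := desc_of_ne_nil hne
      have hk1 : k ≤ 1 := by
        by_contra hk1
        exact hd k (by rw [mem_path]; have := hu k hk; omega) (hu k hk) hdk
      have hop := op_eq_self.1 (op_nf_of_desc hdk one)
      have hi' : op i (nf u) = nf u := by
        rw [op_eq_self]
        refine ⟨?_, .inl hfl⟩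
        have e1 : ndL i = ndL k := by simp only [ndL, Sum.inl.injEq]; omega
        have e2 : ndR i = ndR k := by simp only [ndR, Sum.inl.injEq]; omega
        rw [e1, e2]; exact hop.1
      exact ha i (by rw [mem_path]; omega) (by omega) hi'
  · obtain rfl := h'.eq_nil_of_hook hg hu
    rw [List.append_nil] at hcu
    refine .inr ⟨j, oneFlag, hj, vert_oneFlag g, fun k _ _ => op_oneFlag_ne k, ?_, ?_,
      .inr ⟨h1, rfl, hcu⟩⟩
    · rw [nf, act_ceq hcu, ← nf, nf_hook h1 hj]
    · rw [expo_ceq hcu, expo_hook hg h1 hj]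

/-! ### Recovering the factorization from the diagram -/

namespace PathForm

variable {g : ℕ} {w : List ℕ} {i : ℕ} {x : Cfg Nd}

/-- Without an odd loop, the letters `0` and `1` would require opposite parities on the same edge.
-/
theorem flag_of_both (hg : 2 ≤ g) (h : PathForm g w i x) (h0 : op 0 (TLD.nf w) = TLD.nf w)
    (h1 : op 1 (TLD.nf w) = TLD.nf w) : x.flag := by
  by_contra hx
  rw [← flag_path hg h.le h.vert, ← h.nf] at hx
  have e0 := (op_eq_self.1 h0).2.resolve_left hx
  have e1 := (op_eq_self.1 h1).2.resolve_left hx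
  exact absurd (e0.symm.trans e1) (by decide)

theorem desc_of_fixed (hg : 2 ≤ g) (hF : Faithful g) (h : PathForm g w i x) {k : ℕ} (hk : k ≤ g)
    (hop : op k (TLD.nf w) = TLD.nf w) : Desc k w := by
  have hi := op_path_self h.le x
  rw [← h.nf] at hi
  have := h.nf ▸ hop
  rcases path_fixed hg h.le hk h.vert h.avoids this with rfl | ⟨h1, h2, h3⟩ | h1
  · rcases h.cases with ⟨u, -, -, hu, -⟩ | ⟨h1, -, hu⟩
    · rcases Nat.eq_zero_or_pos k with rfl | h0
      · exact ⟨_, hu⟩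
      · rw [path_cons h0 hk] at hu
        exact ⟨_, hu⟩
    · rcases h1.eq_or_lt with rfl | h2
      · rw [hook_one] at hu
        exact ⟨_, hu.trans (.single (Swap.mk [] _ 0 1 (by simp [Cm, Lk])))⟩
      · obtain ⟨k, rfl⟩ : ∃ k', k = k' + 1 := ⟨k - 1, by omega⟩
        rw [hook_succ (by omega)] at hu
        exact ⟨_, hu⟩
  · rcases h.cases with ⟨u, hru, hu, hcu, rfl, -⟩ | ⟨-, rfl, -⟩
    · obtain ⟨v, hv⟩ := hF.desc u hru hu k h3
      exact ⟨_, hcu.trans ((hv.append_left _).trans (CEq.move v h2).symm)⟩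
    · exact absurd h3 (op_oneFlag_ne k)
  · have hfl : x.flag := by
      rcases h1 with ⟨rfl, rfl⟩ | ⟨rfl, rfl⟩
      · exact h.flag_of_both hg hi hop
      · exact h.flag_of_both hg hop hi
    rcases h.cases with ⟨u, -, -, -, -, h2⟩ | ⟨h2, -, hu⟩
    · exact absurd hfl (h2 (by omega))
    · obtain ⟨rfl, rfl⟩ : i = 1 ∧ k = 0 := by omega
      rw [hook_one] at hu
      exact ⟨_, hu⟩

/-- By `path_fixed` in both directions, the two starting letters agree, once the pair `0`, `1` is
excluded by the flag. Then `act_path_inj` cancels the path and the induction hypothesis applies to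
what remains. -/
theorem ceq_of_nf_eq (hg : 2 ≤ g) (hF : Faithful g) (h : PathForm g w i x) {w' : List ℕ} {i' : ℕ}
    {x' : Cfg Nd} (h' : PathForm g w' i' x') (hww' : TLD.nf w = TLD.nf w') : CEq w w' := by
  have h1 := op_path_self h.le x
  have h1' := op_path_self h'.le x'
  rw [← h.nf] at h1
  rw [← h'.nf] at h1'
  have key : ∀ {w i x w' i' x'}, PathForm g w i x → PathForm g w' i' x' →
      TLD.nf w = TLD.nf w' → i = 0 → i' = 1 → False := by
    rintro w i x w' i' x' h h' hww' rfl rfl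
    have h1 := op_path_self h.le x
    have h1' := op_path_self h'.le x'
    rw [← h.nf] at h1
    rw [← h'.nf, ← hww'] at h1'
    rcases h.cases with ⟨u, -, -, -, -, h2⟩ | ⟨h2, -⟩
    · exact h2 (by omega) (h.flag_of_both hg h1 h1')
    · omega
  have hi : i = i' := by
    have h2 := path_fixed hg h.le h'.le h.vert h.avoids (by rw [← h.nf, hww', h1'])
    have h3 := path_fixed hg h'.le h.le h'.vert h'.avoids (by rw [← h'.nf, ← hww', h1])
    have h4 : ¬ (i = 0 ∧ i' = 1) := fun e => key h h' hww' e.1 e.2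
    have h5 : ¬ (i' = 0 ∧ i = 1) := fun e => key h' h hww'.symm e.1 e.2
    rcases h2 with h2 | ⟨h2, -⟩ | h2 <;> rcases h3 with h3 | ⟨h3, -⟩ | h3 <;> omega
  subst hi
  obtain rfl : x = x' := act_path_inj hg h.le h.vert h'.vert (by rw [← h.nf, ← h'.nf, hww'])
  -- A nonempty word has a diagram fixed by its first letter, whereas no letter fixes `oneFlag`; so
  -- a path and a hook are never confused.
  have hne : ∀ u, TLD.nf u ≠ oneFlag := by
    intro u hu
    rcases u with _ | ⟨k, u⟩
    · exact (show (TLD.nf []).flag from hu ▸ trivial).elim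
    · exact op_oneFlag_ne k (hu ▸ op_nf_of_desc ⟨u, .refl⟩ one)
  rcases h.cases with ⟨u, hru, hu, hcu, rfl, -⟩ | ⟨-, rfl, hcu⟩ <;>
    rcases h'.cases with ⟨u', hru', hu', hcu', hx, -⟩ | ⟨-, hx, hcu'⟩
  · exact hcu.trans (((hF.inj u u' hru hru' hu hu' hx).append_left _).trans hcu'.symm)
  · exact absurd hx (hne u)
  · exact absurd hx.symm (hne u')
  · exact hcu.trans hcu'.symm

end PathForm

theorem Faithful.succ {g : ℕ} (hg : 2 ≤ g) (hF : Faithful g) : Faithful (g + 1) where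
  expo w h hw := by
    rcases hF.pathForm hg h hw with ⟨u, hru, hu, hwu⟩ | ⟨i, x, hp⟩
    · rw [expo_ceq hwu, hF.expo u hru hu]
    · exact hp.expo
  flag w h hw hfl := by
    rcases hF.pathForm hg h hw with ⟨u, hru, hu, hwu⟩ | ⟨i, x, hp⟩
    · rw [nf, act_ceq hwu] at hfl
      obtain ⟨l, r, hlr⟩ := hF.flag u hru hu hfl
      exact ⟨l, r, hwu.trans hlr⟩
    · rw [hp.nf, flag_path hg hp.le hp.vert] at hfl
      rcases hp.cases with ⟨u, hru, hu, hcu, rfl, -⟩ | ⟨-, -, hcu⟩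
      · obtain ⟨l, r, hlr⟩ := hF.flag u hru hu hfl
        refine ⟨path i g ++ l, r, ?_⟩
        simpa using hcu.trans (hlr.append_left _)
      · exact ⟨_, _, hcu⟩
  desc w h hw k hk := by
    rcases hF.pathForm hg h hw with ⟨u, hru, hu, hwu⟩ | ⟨i, x, hp⟩
    · rw [nf, act_ceq hwu] at hk
      obtain ⟨v, hv⟩ := hF.desc u hru hu k hk
      exact ⟨v, hwu.trans hv⟩
    · exact hp.desc_of_fixed hg hF (Nat.lt_succ_iff.1 (lt_of_op_nf (by omega) hw hk)) hk
  inj v w hv hw hv' hw' hvw := by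
    have hne : ∀ {u i x w}, (∀ k ∈ u, k < g) → PathForm g w i x → nf u ≠ nf w := by
      intro u i x w hu hp he
      refine path_not_vert hg hp.le hp.vert hp.avoids ?_
      rw [← hp.nf, ← he, vert_nf hg hu]
    rcases hF.pathForm hg hv hv' with ⟨u, hru, hu, hwu⟩ | ⟨i, x, hp⟩ <;>
      rcases hF.pathForm hg hw hw' with ⟨u', hru', hu', hwu'⟩ | ⟨i', x', hp'⟩
    · have : nf u = nf u' := by rw [nf, nf, ← act_ceq hwu, ← act_ceq hwu']; exact hvw
      exact hwu.trans ((hF.inj u u' hru hru' hu hu' this).trans hwu'.symm)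
    · exact absurd (by rw [nf, ← act_ceq hwu]; exact hvw) (hne hu hp')
    · exact absurd (by rw [nf, ← act_ceq hwu']; exact hvw.symm) (hne hu' hp)
    · exact hp.ceq_of_nf_eq hg hF hp' hvw

theorem faithful {g : ℕ} (hg : 2 ≤ g) : Faithful g := by
  induction g, hg using Nat.le_induction with
  | base => exact faithful_two
  | succ g hg ih => exact ih.succ hg

theorem exists_bound (w : List ℕ) : ∃ g, 2 ≤ g ∧ ∀ x ∈ w, x < g := by
  induction w with
  | nil => exact ⟨2, le_rfl, by simp⟩
  | cons s w ih =>
    obtain ⟨g, h2, hg⟩ := ih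
    refine ⟨g + s + 1, by omega, ?_⟩
    intro x hx
    rcases List.mem_cons.1 hx with rfl | hx
    · omega
    · have := hg x hx; omega

theorem Red.expo_eq_zero {w : List ℕ} (h : Red w) : expo w one = 0 := by
  obtain ⟨g, h2, hg⟩ := exists_bound w
  exact (faithful h2).expo w h hg

theorem Red.exists_fork_of_flag {w : List ℕ} (h : Red w) (hf : (nf w).flag) :
    ∃ l r, CEq w (l ++ 0 :: 1 :: r) := by
  obtain ⟨g, h2, hg⟩ := exists_bound w
  exact (faithful h2).flag w h hg hf

theorem Red.ceq_of_nf_eq {v w : List ℕ} (hv : Red v) (hw : Red w) (h : nf v = nf w) :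
    CEq v w := by
  obtain ⟨g, h2, hg⟩ := exists_bound (v ++ w)
  exact (faithful h2).inj v w hv hw (fun x hx => hg x (by simp [hx]))
    (fun x hx => hg x (by simp [hx])) h

/-! ## The representation of the Coxeter group on diagrams, with `δ = 2` -/

/-- The operator of the letter `k` on the free module on the diagrams. -/
noncomputable def opLin (k : ℕ) : Module.End ℤ (Cfg Nd →₀ ℤ) :=
  Finsupp.linearCombination ℤ fun x => Finsupp.single (op k x) (2 ^ em k x)

theorem opLin_single (k : ℕ) (x : Cfg Nd) (c : ℤ) :
    opLin k (Finsupp.single x c) = Finsupp.single (op k x) (c * 2 ^ em k x) := by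
  simp [opLin, Finsupp.linearCombination_single]

theorem opLin_mul_self (k : ℕ) : opLin k * opLin k = 2 * opLin k := by
  rw [two_mul]
  refine Finsupp.lhom_ext fun x c => ?_
  simp only [Module.End.mul_apply, LinearMap.add_apply, opLin_single, op_idem, em_op,
    ← Finsupp.single_add]
  congr 1; ring

theorem opLin_comm {s t : ℕ} (h : Cm s t) : opLin s * opLin t = opLin t * opLin s := by
  refine Finsupp.lhom_ext fun x c => ?_
  simp only [Module.End.mul_apply, opLin_single, op_comm h, mul_assoc, ← pow_add]
  rw [add_comm, em_comm h, add_comm]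

theorem opLin_braid {s t : ℕ} (h : Lk s t) : opLin s * opLin t * opLin s = opLin s := by
  refine Finsupp.lhom_ext fun x c => ?_
  have h1 : em t (op s x) = 0 := em_eq_zero (op_f_ne h.symm (op_idem s x))
  have h2 : em s (op t (op s x)) = 0 := em_eq_zero (op_f_ne h (op_idem t _))
  simp only [Module.End.mul_apply, opLin_single, op_braid h, h1, h2, pow_zero, mul_one]

/-- The reflection in the letter `k`. -/
noncomputable def refl (k : ℕ) : Module.End ℤ (Cfg Nd →₀ ℤ) := 1 - opLin k

/-- Here `δ = 2` is needed: `(1 - b)² = 1 - 2 b + b²`. -/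
theorem refl_mul_self (k : ℕ) : refl k * refl k = 1 := by
  have := opLin_mul_self k
  simp only [refl, mul_sub, sub_mul, one_mul, mul_one, this]
  noncomm_ring

theorem refl_comm {s t : ℕ} (h : Cm s t) : refl s * refl t = refl t * refl s := by
  have := opLin_comm h
  simp only [refl, mul_sub, sub_mul, one_mul, mul_one, this]
  noncomm_ring

/-- With `b_s² = 2 b_s` and `b_s b_t b_s = b_s`, the left side expands to `1 - b_s - b_t + b_s b_t +
b_t b_s`, which is symmetric. -/
theorem refl_braid {s t : ℕ} (h : Lk s t) :
    refl s * refl t * refl s = refl t * refl s * refl t := by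
  have h1 := opLin_braid h
  have h2 := opLin_braid h.symm
  have h3 := opLin_mul_self s
  have h4 := opLin_mul_self t
  simp only [refl, mul_sub, sub_mul, one_mul, mul_one, h1, h2, h3, h4]
  noncomm_ring

/-- The combinations of the diagrams of words of length `< m`. -/
noncomputable def short (m : ℕ) : Submodule ℤ (Cfg Nd →₀ ℤ) :=
  Finsupp.supported ℤ ℤ {x | ∃ v : List ℕ, v.length < m ∧ nf v = x}

theorem short_mono {m m' : ℕ} (h : m ≤ m') : short m ≤ short m' :=
  Finsupp.supported_mono fun _ ⟨v, hv, hx⟩ => ⟨v, hv.trans_le h, hx⟩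

theorem single_mem_short {m : ℕ} {v : List ℕ} (h : v.length < m) (c : ℤ) :
    Finsupp.single (nf v) c ∈ short m :=
  Finsupp.single_mem_supported _ _ ⟨v, h, rfl⟩

theorem opLin_mem_short {m : ℕ} {y : Cfg Nd →₀ ℤ} (hy : y ∈ short m) (k : ℕ) :
    opLin k y ∈ short (m + 1) := by
  rw [opLin, Finsupp.linearCombination_apply]
  refine Submodule.sum_mem _ fun x hx => Submodule.smul_mem _ _ ?_
  obtain ⟨v, hv, rfl⟩ := (Finsupp.mem_supported _ _).1 hy hx
  exact single_mem_short (v := k :: v) (by simpa using hv) _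

/-- Triangularity: choosing `1` instead of `- opLin s` in some factor deletes a letter, so the only
contribution that is not from a shorter word is the leading one. -/
theorem refl_prod_apply (w : List ℕ) : ∃ y ∈ short w.length,
    (w.map refl).prod (Finsupp.single one 1) =
      Finsupp.single (nf w) ((-1) ^ w.length * 2 ^ expo w one) + y := by
  induction w with
  | nil => exact ⟨0, Submodule.zero_mem _, by simp [expo]⟩
  | cons s w ih =>
    obtain ⟨y, hy, he⟩ := ih
    refine ⟨Finsupp.single (nf w) ((-1) ^ w.length * 2 ^ expo w one) + y - opLin s y, ?_, ?_⟩
    · refine Submodule.sub_mem _ (Submodule.add_mem _ (single_mem_short (by simp) _) ?_)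
        (opLin_mem_short hy s)
      exact short_mono (by simp) hy
    · rw [List.map_cons, List.prod_cons, Module.End.mul_apply, he, refl, LinearMap.sub_apply,
        Module.End.one_apply, map_add, opLin_single]
      have : Finsupp.single (op s (nf w)) ((-1) ^ w.length * 2 ^ expo w one * 2 ^ em s (nf w)) =
          - Finsupp.single (nf (s :: w))
            ((-1 : ℤ) ^ (s :: w).length * 2 ^ expo (s :: w) one) := by
        rw [← Finsupp.single_neg]
        congr 1
        simp only [expo, List.length_cons, pow_succ, pow_add]
        ring
      rw [this]
      abel

/-- A word shorter than `w` with the same diagram could be rewritten to a `Red` word that is no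
longer, and faithfulness would make that word as long as `w`. -/
theorem Red.apply_short {w : List ℕ} (h : Red w) {m : ℕ} (hm : m ≤ w.length) {y : Cfg Nd →₀ ℤ}
    (hy : y ∈ short m) : y (nf w) = 0 := by
  by_contra hne
  obtain ⟨v, hv, hvw⟩ := (Finsupp.mem_supported _ _).1 hy (Finsupp.mem_support_iff.2 hne)
  obtain ⟨v', hr, hl, -, ha, -⟩ := exists_red v
  have := (hr.ceq_of_nf_eq h ((ha one).trans hvw)).length_eq
  omega

/-- Compare coefficients at the diagram of `w`. That of the `w` side is `±2` to some power, so `v`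
must have the same diagram. Rewriting `v` to a `Red` word cannot shorten it, since the result is
equivalent to `w`; so only commutations were used. -/
theorem Red.ceq_of_refl_prod_eq {v w : List ℕ} (h : Red w) (hl : v.length ≤ w.length)
    (he : (v.map refl).prod = (w.map refl).prod) : CEq v w := by
  obtain ⟨y, hy, hy'⟩ := refl_prod_apply v
  obtain ⟨z, hz, hz'⟩ := refl_prod_apply w
  rw [he, hz'] at hy'
  have h1 := DFunLike.congr_fun hy' (nf w)
  rw [Finsupp.add_apply, Finsupp.add_apply, h.apply_short hl hy, h.apply_short le_rfl hz,
    Finsupp.single_eq_same, add_zero, add_zero] at h1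
  have hnf : nf v = nf w := by
    by_contra hne
    rw [Finsupp.single_eq_of_ne (Ne.symm hne)] at h1
    simp at h1
  obtain ⟨v', hr, hl', hc, ha, -⟩ := exists_red v
  have h2 := hr.ceq_of_nf_eq h ((ha one).trans hnf)
  have := h2.length_eq
  exact (hc (by omega)).trans h2

/-! ## Fully commutative elements -/

variable {n : ℕ}

theorem linked_iff {s t : Fin n} : Linked s t ↔ Lk s t := Iff.rfl

theorem coxeterMatrix_eq_two {s t : Fin n} : coxeterMatrix n s t = 2 ↔ Cm s t := by
  change (if s = t then 1 else if Linked s t then 3 else 2) = 2 ↔ _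
  rw [Cm, ne_eq, Fin.val_inj, ← linked_iff]
  split_ifs <;> simp_all

theorem coxeterMatrix_eq_three {s t : Fin n} (h : Lk s t) : coxeterMatrix n s t = 3 := by
  change (if s = t then 1 else if Linked s t then 3 else 2) = 3
  rw [if_neg (fun e => h.ne (congrArg Fin.val e)), if_pos (linked_iff.2 h)]

theorem pow_eq_one_iff_of_sq {G : Type*} [Monoid G] {a b : G} (ha : a * a = 1) (hb : b * b = 1) :
    (a * b = b * a → (a * b) ^ 2 = 1) ∧ (a * b * a = b * a * b → (a * b) ^ 3 = 1) := by
  constructor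
  · intro h
    rw [pow_two, mul_assoc, ← mul_assoc b, ← h, mul_assoc a b b, hb, mul_one, ha]
  · intro h
    calc (a * b) ^ 3 = (a * b * a) * (b * a * b) := by
          simp only [pow_succ, pow_zero, one_mul, mul_assoc]
      _ = (a * b * a) * (a * b * a) := by rw [h]
      _ = a * b * (a * a) * b * a := by simp only [mul_assoc]
      _ = a * (b * b) * a := by rw [ha]; simp only [mul_assoc, mul_one]
      _ = 1 := by rw [hb, mul_one, ha]

/-- The representation of the Coxeter group on the free module on the diagrams. -/
theorem exists_rep (n : ℕ) : ∃ ρ : W n →* Module.End ℤ (Cfg Nd →₀ ℤ),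
    ∀ s : Fin n, ρ ((coxeterMatrix n).toCoxeterSystem.simple s) = refl s := by
  have h : (coxeterMatrix n).IsLiftable fun s : Fin n => refl s := by
    intro s t
    have key := pow_eq_one_iff_of_sq (refl_mul_self s) (refl_mul_self t)
    by_cases hst : s = t
    · subst hst
      simp [refl_mul_self]
    by_cases hl : Lk s t
    · rw [coxeterMatrix_eq_three hl]
      exact key.2 (refl_braid hl)
    · have hc : Cm s t := ⟨fun e => hst (Fin.ext e), hl⟩
      rw [coxeterMatrix_eq_two.2 hc]
      exact key.1 (refl_comm hc)
  exact ⟨(coxeterMatrix n).toCoxeterSystem.lift ⟨_, h⟩, fun s =>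
    CoxeterSystem.lift_apply_simple _ h s⟩

theorem refl_prod_eq_of_wordProd_eq {v w : List (Fin n)}
    (h : (coxeterMatrix n).toCoxeterSystem.wordProd v =
      (coxeterMatrix n).toCoxeterSystem.wordProd w) :
    ((v.map Fin.val).map refl).prod = ((w.map Fin.val).map refl).prod := by
  obtain ⟨ρ, hρ⟩ := exists_rep n
  have key : ∀ u : List (Fin n), ρ ((coxeterMatrix n).toCoxeterSystem.wordProd u) =
      ((u.map Fin.val).map refl).prod := by
    intro u
    simp only [CoxeterSystem.wordProd, map_list_prod, List.map_map]
    congr 2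
    ext1 s
    exact hρ s
  rw [← key, ← key, h]

theorem Swap.lift {w : List (Fin n)} {v : List ℕ} (h : Swap (w.map Fin.val) v) :
    ∃ w', v = w'.map Fin.val ∧ CommMove w w' := by
  generalize hx : w.map Fin.val = x at h
  obtain ⟨l, r, s, t, h⟩ := h
  rw [List.map_eq_append_iff] at hx
  obtain ⟨l', r', rfl, rfl, hx⟩ := hx
  simp only [List.map_eq_cons_iff] at hx
  obtain ⟨s', r', rfl, rfl, t', r, rfl, rfl, rfl⟩ := hx
  exact ⟨l' ++ t' :: s' :: r, by simp, .swap _ _ _ _ (coxeterMatrix_eq_two.2 h)⟩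

theorem CommMove.swap_val {v w : List (Fin n)} (h : CommMove v w) :
    Swap (v.map Fin.val) (w.map Fin.val) := by
  obtain ⟨l, r, s, t, h⟩ := h
  simpa using Swap.mk (l.map Fin.val) (r.map Fin.val) s t (coxeterMatrix_eq_two.1 h)

theorem CEq.lift {w : List (Fin n)} {v : List ℕ} (h : CEq (w.map Fin.val) v) :
    ∃ w', v = w'.map Fin.val ∧ Relation.ReflTransGen CommMove w w' := by
  induction h with
  | refl => exact ⟨w, rfl, .refl⟩
  | tail _ h ih =>
    obtain ⟨w', rfl, hw⟩ := ih
    obtain ⟨w'', rfl, hw'⟩ := h.lift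
    exact ⟨w'', rfl, hw.tail hw'⟩

theorem ceq_val_iff {v w : List (Fin n)} :
    CEq (v.map Fin.val) (w.map Fin.val) ↔ Relation.ReflTransGen CommMove v w := by
  constructor
  · intro h
    obtain ⟨w', h1, h2⟩ := h.lift
    rwa [← List.map_injective_iff.2 Fin.val_injective h1] at h2
  · intro h
    induction h with
    | refl => exact .refl
    | tail _ h ih => exact ih.tail h.swap_val

/-! ### `Red` words and reduced expressions -/

theorem simple_mul_comm {s t : Fin n} (h : Cm s t) :
    (coxeterMatrix n).toCoxeterSystem.simple s * (coxeterMatrix n).toCoxeterSystem.simple t =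
    (coxeterMatrix n).toCoxeterSystem.simple t * (coxeterMatrix n).toCoxeterSystem.simple s := by
  have := (coxeterMatrix n).toCoxeterSystem.simple_mul_simple_pow s t
  rw [coxeterMatrix_eq_two.2 h, pow_two] at this
  have := eq_inv_of_mul_eq_one_left this
  rwa [mul_inv_rev, CoxeterSystem.inv_simple, CoxeterSystem.inv_simple] at this

theorem simple_braid {s t : Fin n} (h : Lk s t) :
    (coxeterMatrix n).toCoxeterSystem.simple s * ((coxeterMatrix n).toCoxeterSystem.simple t *
      (coxeterMatrix n).toCoxeterSystem.simple s) =
    (coxeterMatrix n).toCoxeterSystem.simple t * ((coxeterMatrix n).toCoxeterSystem.simple s *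
      (coxeterMatrix n).toCoxeterSystem.simple t) := by
  have := (coxeterMatrix n).toCoxeterSystem.simple_mul_simple_pow s t
  rw [coxeterMatrix_eq_three h, pow_succ, pow_two] at this
  have := eq_inv_of_mul_eq_one_left
    (a := (coxeterMatrix n).toCoxeterSystem.simple s * ((coxeterMatrix n).toCoxeterSystem.simple t *
      (coxeterMatrix n).toCoxeterSystem.simple s))
    (b := (coxeterMatrix n).toCoxeterSystem.simple t * ((coxeterMatrix n).toCoxeterSystem.simple s *
      (coxeterMatrix n).toCoxeterSystem.simple t)) (by rw [← this]; simp only [mul_assoc])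
  rw [this]
  simp only [mul_inv_rev, CoxeterSystem.inv_simple, mul_assoc]

theorem CommMove.wordProd_eq {v w : List (Fin n)} (h : CommMove v w) :
    (coxeterMatrix n).toCoxeterSystem.wordProd v =
      (coxeterMatrix n).toCoxeterSystem.wordProd w := by
  obtain ⟨l, r, s, t, h⟩ := h
  rw [CoxeterSystem.wordProd_append, CoxeterSystem.wordProd_append]
  simp only [CoxeterSystem.wordProd_cons, ← mul_assoc]
  rw [mul_assoc _ _ ((coxeterMatrix n).toCoxeterSystem.simple t),
    simple_mul_comm (coxeterMatrix_eq_two.1 h), ← mul_assoc]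

theorem wordProd_eq_of_reflTransGen {v w : List (Fin n)} (h : Relation.ReflTransGen CommMove v w) :
    (coxeterMatrix n).toCoxeterSystem.wordProd v =
      (coxeterMatrix n).toCoxeterSystem.wordProd w := by
  induction h with
  | refl => rfl
  | tail _ h ih => rw [ih, h.wordProd_eq]

theorem IsReducedExpr.of_length_le {v w : List (Fin n)} {x : W n} (h : IsReducedExpr v x)
    (hl : w.length ≤ v.length) (hw : (coxeterMatrix n).toCoxeterSystem.wordProd w = x) :
    IsReducedExpr w x := by
  refine ⟨?_, hw⟩
  have h1 := h.1
  have h2 := (coxeterMatrix n).toCoxeterSystem.length_wordProd_le w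
  unfold CoxeterSystem.IsReduced at *
  rw [h.2, ← hw] at h1
  omega

/-- A factor `s s` would contradict minimal length. A factor `s t s` could be replaced by `t s t`,
giving a reduced expression with other letter multiplicities, which commutations cannot reach. -/
theorem IsReducedExpr.red {w : List (Fin n)} {x : W n} (h : IsReducedExpr w x)
    (hx : IsFullyCommutative x) : Red (w.map Fin.val) := by
  intro w' hw' hb
  obtain ⟨v, rfl, hv⟩ := hw'.lift
  have hlen : w.length = v.length := by simpa using hw'.length_eq
  have hvx := h.of_length_le hlen.ge ((wordProd_eq_of_reflTransGen hv).symm.trans h.2)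
  rcases hb with ⟨l, r, s, hb⟩ | ⟨l, r, s, t, hst, hb⟩
  · rw [List.map_eq_append_iff] at hb
    obtain ⟨l', r', rfl, rfl, hb⟩ := hb
    simp only [List.map_eq_cons_iff] at hb
    obtain ⟨s', r', rfl, rfl, t', r, rfl, hst, rfl⟩ := hb
    obtain rfl := Fin.ext hst
    have h1 := (coxeterMatrix n).toCoxeterSystem.length_wordProd_le (l' ++ r)
    have h2 := hvx.1
    unfold CoxeterSystem.IsReduced at h2
    simp only [CoxeterSystem.wordProd_append, CoxeterSystem.wordProd_cons,
      CoxeterSystem.simple_mul_simple_cancel_left] at h1 h2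
    rw [h2] at h1
    simp at h1
  · rw [List.map_eq_append_iff] at hb
    obtain ⟨l', r', rfl, rfl, hb⟩ := hb
    simp only [List.map_eq_cons_iff] at hb
    obtain ⟨s', r', rfl, rfl, t', r', rfl, rfl, s'', r, rfl, hss, rfl⟩ := hb
    obtain rfl := Fin.ext hss
    have h1 : IsReducedExpr (l' ++ t' :: s'' :: t' :: r) x := by
      refine hvx.of_length_le (by simp) (hvx.2 ▸ ?_)
      simp only [CoxeterSystem.wordProd_append, CoxeterSystem.wordProd_cons]
      have := simple_braid hst
      congr 1
      simp only [← mul_assoc] at this ⊢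
      rw [this]
    have h2 := (ceq_val_iff.2 (hx _ _ hvx h1)).perm.count_eq (s'' : ℕ)
    simp [hst.ne.symm] at h2

/-- Every word for the same element that is no longer than `w` is equivalent to `w`, by the
representation. Applied to a shortest word this gives that `w` is reduced, and applied to all
reduced words it gives full commutativity. -/
theorem Red.isReducedExpr {w : List (Fin n)} (h : Red (w.map Fin.val)) :
    IsReducedExpr w ((coxeterMatrix n).toCoxeterSystem.wordProd w) ∧
      IsFullyCommutative ((coxeterMatrix n).toCoxeterSystem.wordProd w) := by
  obtain ⟨v, hv, hvw⟩ := (coxeterMatrix n).toCoxeterSystem.exists_isReduced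
    ((coxeterMatrix n).toCoxeterSystem.wordProd w)
  have hlen : v.length ≤ w.length := by
    have h1 := (coxeterMatrix n).toCoxeterSystem.length_wordProd_le w
    unfold CoxeterSystem.IsReduced at hv
    rw [hvw] at h1
    omega
  have key : ∀ v : List (Fin n), v.length ≤ w.length →
      (coxeterMatrix n).toCoxeterSystem.wordProd v =
        (coxeterMatrix n).toCoxeterSystem.wordProd w → CEq (v.map Fin.val) (w.map Fin.val) :=
    fun v hl he => h.ceq_of_refl_prod_eq (by simpa using hl) (refl_prod_eq_of_wordProd_eq he)
  have h1 := (key v hlen hvw.symm).length_eq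
  have hr : IsReducedExpr w ((coxeterMatrix n).toCoxeterSystem.wordProd w) :=
    IsReducedExpr.of_length_le ⟨hv, hvw.symm⟩ (by simpa using h1.ge) rfl
  refine ⟨hr, fun u u' hu hu' => ceq_val_iff.1 ?_⟩
  have hl : ∀ u, IsReducedExpr u ((coxeterMatrix n).toCoxeterSystem.wordProd w) →
      u.length ≤ w.length := by
    intro u hu
    have h1 := hu.1
    have h2 := hr.1
    unfold CoxeterSystem.IsReduced at h1 h2
    rw [hu.2] at h1
    omega
  exact (key u (hl u hu) hu.2).trans (key u' (hl u' hu') hu'.2).symm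

/-! ## Planarity -/

section Planar

variable {V P : Type*} [LinearOrder P] (pos : V → P) (f : V → V)

/-- The edges given by `f` can be drawn without crossings. -/
def Noncrossing : Prop :=
  ∀ u v : V, ¬ (pos u < pos v ∧ pos v < pos (f u) ∧ pos (f u) < pos (f v))

/-- No edge separates the edge at `u` from the left wall. -/
def Exposed (u : V) : Prop :=
  ∀ v : V, ¬ (pos v < pos u ∧ pos v < pos (f u) ∧ pos u < pos (f v) ∧ pos (f u) < pos (f v))

variable {pos f}

theorem Noncrossing.side (h : Noncrossing pos f) (hp : Function.Injective pos)
    (hi : ∀ v, f (f v) = v) {v w : V} (h1 : w ≠ v) (h2 : w ≠ f v) :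
    (pos v < pos w ∧ pos w < pos (f v)) ↔ (pos v < pos (f w) ∧ pos (f w) < pos (f v)) := by
  have key : ∀ w, w ≠ v → w ≠ f v → pos v < pos w → pos w < pos (f v) →
      pos v < pos (f w) ∧ pos (f w) < pos (f v) := by
    intro w h1 h2 h3 h4
    have k1 := h v w
    have k2 := h (f w) v
    rw [hi] at k2
    have n1 : pos (f w) ≠ pos v := fun e => h2 (by rw [← hp e, hi])
    have n2 : pos (f w) ≠ pos (f v) := fun e => h1 (by rw [← hi w, hp e, hi])
    constructor
    · by_contra h5
      exact k2 ⟨lt_of_le_of_ne (not_lt.1 h5) n1, h3, h4⟩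
    · by_contra h5
      exact k1 ⟨h3, h4, lt_of_le_of_ne (not_lt.1 h5) n2.symm⟩
  constructor
  · exact fun ⟨h3, h4⟩ => key w h1 h2 h3 h4
  · intro ⟨h3, h4⟩
    have := key (f w) (fun e => h2 (by rw [← e, hi])) (fun e => h1 (by rw [← hi w, e, hi])) h3 h4
    rwa [hi] at this

theorem Noncrossing.side_symm (h : Noncrossing pos f) (hp : Function.Injective pos)
    (hi : ∀ v, f (f v) = v) {u w : V} (h1 : w ≠ u) (h2 : w ≠ f u)
    (k1 : pos (f w) < pos u ∧ pos (f w) < pos (f u) ∨ pos u < pos (f w) ∧ pos (f u) < pos (f w)) :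
    pos w < pos u ∧ pos w < pos (f u) ∨ pos u < pos w ∧ pos (f u) < pos w := by
  have n1 : pos w ≠ pos u := fun e => h1 (hp e)
  have n2 : pos w ≠ pos (f u) := fun e => h2 (hp e)
  rcases lt_trichotomy (pos u) (pos (f u)) with h3 | h3 | h3
  · have := h.side hp hi h1 h2
    grind
  · grind
  · have := h.side hp hi (v := f u) h2 (by rwa [hi])
    rw [hi] at this
    grind

variable [DecidableEq V] {a b : V}

/-- Since the nodes strictly between `a` and `b` are matched among themselves, the new edge crosses
nothing, and an old edge at other nodes never separates `a` from `b`. Hence it does not separate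
their partners either, which can be joined. -/
theorem Noncrossing.join (h : Noncrossing pos f) (hp : Function.Injective pos)
    (hi : ∀ v, f (f v) = v) (hn : ∀ v, f v ≠ v) (hab : pos a < pos b)
    (hc : ∀ v, pos a < pos v → pos v < pos b → pos a < pos (f v) ∧ pos (f v) < pos b) :
    Noncrossing pos (joinFun a b f) := by
  have hne : a ≠ b := fun e => hab.ne (congrArg pos e)
  have hi' : ∀ v, joinFun a b f (joinFun a b f v) = v := by grind [joinFun]
  have hc' : ∀ v, pos a < pos v → pos v < pos b →
      pos a < pos (joinFun a b f v) ∧ pos (joinFun a b f v) < pos b := by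
    intro v h1 h2
    have h3 := hc v h1 h2
    have n1 : v ≠ a := fun e => h1.ne (congrArg pos e.symm)
    have n2 : v ≠ b := fun e => h2.ne (congrArg pos e)
    have n3 : v ≠ f a := fun e => by rw [e, hi] at h3; exact lt_irrefl _ h3.1
    have n4 : v ≠ f b := fun e => by rw [e, hi] at h3; exact lt_irrefl _ h3.2
    rwa [joinFun, if_neg n1, if_neg n2, if_neg n3, if_neg n4]
  have key : ∀ v, v ≠ a → v ≠ b → v ≠ f a → v ≠ f b → pos v < pos (f v) →
      ((pos v < pos (f a) ∧ pos (f a) < pos (f v)) ↔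
        (pos v < pos (f b) ∧ pos (f b) < pos (f v))) := by
    intro v n1 n2 n3 n4 hv
    have n5 : a ≠ f v := fun e => n3 (by rw [e, hi])
    have n6 : b ≠ f v := fun e => n4 (by rw [e, hi])
    rw [← h.side hp hi n1.symm n5, ← h.side hp hi n2.symm n6]
    have m1 := hc v
    have m2 := hc (f v)
    rw [hi] at m2
    have l1 : pos a ≠ pos v := fun e => n1 (hp e.symm)
    have l2 : pos b ≠ pos v := fun e => n2 (hp e.symm)
    have l3 : pos a ≠ pos (f v) := fun e => n5 (hp e)
    have l4 : pos b ≠ pos (f v) := fun e => n6 (hp e)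
    grind
  intro u v ⟨h1, h2, h3⟩
  by_cases hua : u = a
  · subst hua
    have := hc' v h1 (by simpa [joinFun] using h2)
    simp only [joinFun, if_true] at h3 this
    exact lt_asymm h3 this.2
  by_cases hub : u = b
  · subst hub
    have : joinFun a u f u = a := by simp [joinFun, hne.symm]
    rw [this] at h2
    exact lt_asymm hab (h1.trans h2)
  by_cases hva : v = a
  · subst hva
    have : joinFun v b f v = b := by simp [joinFun]
    rw [this] at h3
    have := hc' _ h2 h3
    rw [hi'] at this
    exact lt_asymm h1 this.1
  by_cases hvb : v = b
  · subst hvb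
    have : joinFun a v f v = a := by simp [joinFun, hne.symm]
    rw [this] at h3
    exact lt_asymm hab (h2.trans h3)
  by_cases hu1 : u = f a ∨ u = f b <;> by_cases hv1 : v = f a ∨ v = f b
  · have l1 : ∀ w, w ≠ a → w ≠ b → (w = f a ∨ w = f b) →
      (joinFun a b f w = f a ∨ joinFun a b f w = f b) ∧
      joinFun a b f w ≠ w := by grind [joinFun]
    have l2 := l1 u hua hub hu1
    have l3 := l1 v hva hvb hv1
    grind
  · have hv2 : joinFun a b f v = f v := by grind [joinFun]
    rw [hv2] at h3
    have := key v hva hvb (by tauto) (by tauto) (h2.trans h3)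
    have : joinFun a b f u = if u = f a then f b else f a := by grind [joinFun]
    grind
  · have hu2 : joinFun a b f u = f u := by grind [joinFun]
    rw [hu2] at h2 h3
    have := key u hua hub (by tauto) (by tauto) (h1.trans h2)
    have : joinFun a b f v = if v = f a then f b else f a := by grind [joinFun]
    grind
  · have hu2 : joinFun a b f u = f u := by grind [joinFun]
    have hv2 : joinFun a b f v = f v := by grind [joinFun]
    rw [hu2] at h2 h3
    rw [hv2] at h3
    exact h u v ⟨h1, h2, h3⟩

theorem Exposed.join (h : Noncrossing pos f) (hp : Function.Injective pos)
    (hi : ∀ v, f (f v) = v) (hab : pos a < pos b)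
    {u : V} (n1 : u ≠ a) (n2 : u ≠ b) (n3 : u ≠ f a) (n4 : u ≠ f b)
    (hu : ¬ (pos a < pos u ∧ pos u < pos b)) (he : Exposed pos f u) :
    Exposed pos (joinFun a b f) u := by
  have e : joinFun a b f u = f u := by grind [joinFun]
  have n5 : a ≠ f u := fun e => n3 (by rw [e, hi])
  have n6 : b ≠ f u := fun e => n4 (by rw [e, hi])
  intro v
  rw [e]
  rintro ⟨h1, h2, h3, h4⟩
  have s1 := h.side_symm hp hi n1.symm n5
  have s2 := h.side_symm hp hi n2.symm n6
  have x1 := he a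
  have x2 := he (f a)
  have x3 := he b
  have x4 := he (f b)
  have x5 := he v
  rw [hi] at x2 x4
  have : joinFun a b f v = if v = a then b else if v = b then a else if v = f a then f b else
    if v = f b then f a else f v := rfl
  grind

/-- An edge that covers both partners would have covered the old edges at `a` and at `b`. So
exposure of one of these suffices, and so does `a` being the leftmost node. -/
theorem Exposed.join_partner (h : Noncrossing pos f) (hp : Function.Injective pos)
    (hi : ∀ v, f (f v) = v) (hab : pos a < pos b)
    (hc : ∀ v, pos a < pos v → pos v < pos b → pos a < pos (f v) ∧ pos (f v) < pos b)
    (he : Exposed pos f a ∨ Exposed pos f b ∨ ∀ v, pos a ≤ pos v) {u : V} (n1 : u ≠ a) (n2 : u ≠ b)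
    (hu : u = f a ∨ u = f b) : Exposed pos (joinFun a b f) u := by
  have hne : a ≠ b := fun e => hab.ne (congrArg pos e)
  have hfa : f a ≠ b := by grind
  have hfb : f b ≠ a := by grind
  have main : ∀ v, ¬ (pos v < pos (f a) ∧ pos v < pos (f b) ∧ pos (f a) < pos (joinFun a b f v) ∧
      pos (f b) < pos (joinFun a b f v)) := by
    rintro v ⟨h1, h2, h3, h4⟩
    by_cases hva : v = a
    · have := hc (f a)
      rw [hi] at this
      simp only [hva, joinFun, if_true] at h1 h3
      exact lt_irrefl _ (this h1 h3).1
    by_cases hvb : v = b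
    · have : joinFun a b f v = a := by simp [joinFun, hvb, hne.symm]
      rw [this] at h3
      rw [hvb] at h1
      exact lt_asymm hab (h1.trans h3)
    by_cases hv1 : v = f a
    · rw [hv1] at h1; exact lt_irrefl _ h1
    by_cases hv2 : v = f b
    · rw [hv2] at h2; exact lt_irrefl _ h2
    have hv : joinFun a b f v = f v := by grind [joinFun]
    rw [hv] at h3 h4
    have n5 : a ≠ f v := fun e => hv1 (by rw [e, hi])
    have n6 : b ≠ f v := fun e => hv2 (by rw [e, hi])
    have s1 := (h.side hp hi (Ne.symm hva) n5).2 ⟨h1, h3⟩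
    have s2 := (h.side hp hi (Ne.symm hvb) n6).2 ⟨h2, h4⟩
    rcases he with he | he | he
    · exact he v ⟨s1.1, h1, s1.2, h3⟩
    · exact he v ⟨s2.1, h2, s2.2, h4⟩
    · exact absurd (he v) (not_le.2 s1.1)
  intro v hv
  have := main v
  rcases hu with rfl | rfl
  · have e : joinFun a b f (f a) = f b := by grind [joinFun]
    rw [e] at hv
    tauto
  · have e : joinFun a b f (f b) = f a := by grind [joinFun]
    rw [e] at hv
    tauto

end Planar

/-! ## Every admissible matching comes from a word -/

/-- The position of a node on the boundary of the box of infinite width, read clockwise. -/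
def ndPos (u : Nd) : ℕ ⊕ₗ ℕᵒᵈ := toLex (u.map id OrderDual.toDual)

@[simp] theorem ndPos_inl_lt_inl {i j : ℕ} :
    ndPos (Sum.inl i) < ndPos (Sum.inl j) ↔ i < j := by
  simp [ndPos]

@[simp] theorem ndPos_inr_lt_inr {i j : ℕ} :
    ndPos (Sum.inr i) < ndPos (Sum.inr j) ↔ j < i := by
  simp [ndPos]

@[simp] theorem ndPos_inl_lt_inr {i j : ℕ} : ndPos (Sum.inl i) < ndPos (Sum.inr j) := by
  simp [ndPos]

@[simp] theorem not_ndPos_inr_lt_inl {i j : ℕ} : ¬ ndPos (Sum.inr i) < ndPos (Sum.inl j) := by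
  simp [ndPos]

theorem ndPos_injective : Function.Injective ndPos := by
  rintro (i | i) (j | j) <;> simp [ndPos]

/-- The nodes of index less than `m`. -/
def nodes (m : ℕ) : Finset Nd := (Finset.range m).disjSum (Finset.range m)

@[simp] theorem inl_mem_nodes {m i : ℕ} : Sum.inl i ∈ nodes m ↔ i < m := by simp [nodes]

@[simp] theorem inr_mem_nodes {m i : ℕ} : Sum.inr i ∈ nodes m ↔ i < m := by simp [nodes]

theorem f_mem_nodes {m : ℕ} {x : Cfg Nd} (h : ∀ i, m ≤ i → x.f (Sum.inl i) = Sum.inr i) {u : Nd}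
    (hu : u ∈ nodes m) : x.f u ∈ nodes m := by
  by_contra hk
  rcases hv : x.f u with i | i
  · rw [hv, inl_mem_nodes, not_lt] at hk
    have h2 := h i hk
    rw [← hv, x.invol] at h2
    rw [h2, inr_mem_nodes] at hu
    omega
  · rw [hv, inr_mem_nodes, not_lt] at hk
    have h2 := congrArg x.f (h i hk)
    rw [← hv, x.invol, x.invol] at h2
    rw [← h2, inl_mem_nodes] at hu
    omega

/-- The matchings on `2 m` nodes that are planar, exposed where decorated, without a decorated
loop, and with an even number of decorated edges. -/
structure Good (m : ℕ) (x : Cfg Nd) : Prop where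
  noncrossing : Noncrossing ndPos x.f
  exposed : ∀ u, x.g u ≠ 0 → Exposed ndPos x.f u
  not_flag : ¬ x.flag
  vert : ∀ i, m ≤ i → x.f (Sum.inl i) = Sum.inr i ∧ x.g (Sum.inl i) = 0
  sum : 4 ∣ ∑ u ∈ nodes m, (x.g u).val

/-- Each decorated edge is counted at both ends, so divisibility by 4 says that the number of
decorated edges is even. Parities `p`, `q` are replaced by `e` and `p + q + e`, with the same sum
mod 2. -/
theorem sum_joinDeco {V : Type*} [DecidableEq V] {T : Finset V} {x : Cfg V} {a b : V} (e : ZMod 2)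
    (hab : a ≠ b) (h : x.f a ≠ b) (ha : a ∈ T) (hb : b ∈ T) (hfa : x.f a ∈ T) (hfb : x.f b ∈ T) :
    4 ∣ ∑ u ∈ T, (joinDeco a b e x.f x.g u).val ↔ 4 ∣ ∑ u ∈ T, (x.g u).val := by
  have hi := x.invol
  have hn := x.ne
  have h' : x.f b ≠ a := fun k => h (by rw [← k, hi])
  have hff : x.f a ≠ x.f b := fun k => hab (by rw [← hi a, k, hi])
  have hsub : ({a, b, x.f a, x.f b} : Finset V) ⊆ T := by
    simp [Finset.insert_subset_iff, *]
  rw [← Finset.sum_sdiff hsub, ← Finset.sum_sdiff hsub]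
  have h1 : ∑ u ∈ T \ {a, b, x.f a, x.f b}, (joinDeco a b e x.f x.g u).val =
      ∑ u ∈ T \ {a, b, x.f a, x.f b}, (x.g u).val := by
    refine Finset.sum_congr rfl fun u hu => ?_
    simp only [Finset.mem_sdiff, Finset.mem_insert, Finset.mem_singleton, not_or] at hu
    simp [joinDeco, hu]
  have h2 : ∀ k : V → ℕ, ∑ u ∈ ({a, b, x.f a, x.f b} : Finset V), k u =
      k a + (k b + (k (x.f a) + k (x.f b))) := by
    intro k
    rw [Finset.sum_insert, Finset.sum_insert, Finset.sum_insert, Finset.sum_singleton] <;>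
      simp [hab, hff, h'.symm, h.symm, (hn a).symm, (hn b).symm]
  rw [h1, h2, h2, x.g_f, x.g_f]
  have h3 : joinDeco a b e x.f x.g a = e := by simp [joinDeco]
  have h4 : joinDeco a b e x.f x.g b = e := by simp [joinDeco]
  have h5 : joinDeco a b e x.f x.g (x.f a) = x.g a + x.g b + e := by
    simp [joinDeco, hn, h]
  have h6 : joinDeco a b e x.f x.g (x.f b) = x.g a + x.g b + e := by
    simp [joinDeco, hn, h']
  rw [h3, h4, h5, h6]
  generalize x.g a = p
  generalize x.g b = q
  generalize ∑ u ∈ T \ {a, b, x.f a, x.f b}, (x.g u).val = S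
  -- The difference of the new and old contributions is written with `2 - p` and `2 - q`, to stay in
  -- the natural numbers; this shifts it by a multiple of 4.
  have key : ∀ p q e : ZMod 2, 4 ∣ 2 * e.val + 2 * (p + q + e).val + 2 * (2 - p.val) +
    2 * (2 - q.val) ∧ p.val ≤ 1 ∧ q.val ≤ 1 := by decide
  have := key p q e
  omega

namespace Good

variable {m : ℕ} {x : Cfg Nd}

theorem f_mem (h : Good m x) {u : Nd} (hu : u ∈ nodes m) : x.f u ∈ nodes m :=
  f_mem_nodes (fun i hi => (h.vert i hi).1) hu

theorem join (h : Good m x) {a b : Nd} (hab : ndPos a < ndPos b) (ha : a ∈ nodes m)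
    (hb : b ∈ nodes m) (hf : x.f a ≠ b)
    (hc : ∀ v, ndPos a < ndPos v → ndPos v < ndPos b →
      (ndPos a < ndPos (x.f v) ∧ ndPos (x.f v) < ndPos b) ∧ x.g v = 0) :
    Good m (x.join a b 0 fun e => hab.ne (congrArg ndPos e)) := by
  have hne : a ≠ b := fun e => hab.ne (congrArg ndPos e)
  have hfl : ¬ (x.join a b 0 hne).flag := by simp [Cfg.join, hf, h.not_flag]
  have hc' := fun v h1 h2 => (hc v h1 h2).1
  refine ⟨h.noncrossing.join ndPos_injective x.invol x.ne hab hc', ?_, hfl, ?_, ?_⟩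
  · intro u hu
    rw [join_g _ _ hfl, joinDeco] at hu
    split_ifs at hu with h1 h2
    · simp at hu
    · refine Exposed.join_partner h.noncrossing ndPos_injective x.invol hab hc' ?_ (by tauto)
        (by tauto) h2
      by_cases k1 : x.g a = 0
      · exact .inr (.inl (h.exposed _ fun k2 => hu (by rw [k1, k2]; rfl)))
      · exact .inl (h.exposed _ k1)
    · exact Exposed.join h.noncrossing ndPos_injective x.invol hab (by tauto) (by tauto) (by tauto)
        (by tauto) (fun k => hu (hc _ k.1 k.2).2) (h.exposed _ hu)
  · intro i hi
    have key : ∀ u ∈ nodes m, Sum.inl i ≠ u := by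
      rintro u hu rfl
      simp at hu
      omega
    have k1 := key _ ha
    have k2 := key _ hb
    have k3 := key _ (h.f_mem ha)
    have k4 := key _ (h.f_mem hb)
    rw [join_g _ _ hfl]
    simpa [Cfg.join, joinFun, joinDeco, k1, k2, k3, k4] using h.vert i hi
  · have := (sum_joinDeco (T := nodes m) (x := x) 0 hne hf ha hb (h.f_mem ha) (h.f_mem hb)).2 h.sum
    simpa only [join_g _ _ hfl] using this

theorem of_succ (h : Good (m + 1) x) (h1 : x.f (Sum.inl m) = Sum.inr m)
    (h2 : x.g (Sum.inl m) = 0) : Good m x := by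
  refine ⟨h.noncrossing, h.exposed, h.not_flag, fun i hi => ?_, ?_⟩
  · rcases hi.eq_or_lt with rfl | hi
    · exact ⟨h1, h2⟩
    · exact h.vert i hi
  · have h3 : x.g (Sum.inr m) = 0 := by rw [← h1, x.g_f, h2]
    have := h.sum
    simpa [nodes, Finset.sum_disjSum, Finset.sum_range_succ, h2, h3] using this

theorem exists_adjacent (h : Noncrossing ndPos x.f) {i j : ℕ} (hij : i < j)
    (hf : x.f (Sum.inl i) = Sum.inl j) :
    ∃ k, i ≤ k ∧ k < j ∧ x.f (Sum.inl k) = Sum.inl (k + 1) := by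
  induction hd : j - i using Nat.strong_induction_on generalizing i j with
  | _ d ih =>
  by_cases h1 : j = i + 1
  · exact ⟨i, le_rfl, hij, by rw [hf, h1]⟩
  have h2 := (h.side ndPos_injective x.invol (v := Sum.inl i) (w := Sum.inl (i + 1))
    (by simp) (by simp [hf]; omega)).1 (by simp [hf]; omega)
  rw [hf] at h2
  rcases h3 : x.f (Sum.inl (i + 1)) with l | l
  · simp only [h3, ndPos_inl_lt_inl] at h2
    have h4 : l ≠ i + 1 := fun e => x.ne _ (h3.trans (by rw [e]))
    obtain ⟨k, k1, k2, k3⟩ := ih (l - (i + 1)) (by omega) (i := i + 1) (j := l) (by omega) h3 rfl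
    exact ⟨k, by omega, by omega, k3⟩
  · simp [h3] at h2

/-- Take the leftmost pair of adjacent north nodes that are joined. If it is not at the wall it is
undecorated, because otherwise the edge at the leftmost node either covers it or contains an
adjacent pair further left. -/
theorem exists_op_eq_self (h : Good m x) {i j : ℕ} (hf : x.f (Sum.inl i) = Sum.inl j) :
    ∃ s, s - 1 + 1 < m ∧ op s x = x := by
  have hex : ∃ k, x.f (Sum.inl k) = Sum.inl (k + 1) := by
    have hne : i ≠ j := fun e => x.ne (Sum.inl i) (by rw [hf, e])
    rcases hne.lt_or_gt with h1 | h1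
    · obtain ⟨k, -, -, hk⟩ := exists_adjacent h.noncrossing h1 hf
      exact ⟨k, hk⟩
    · obtain ⟨k, -, -, hk⟩ := exists_adjacent h.noncrossing h1 (by rw [← hf, x.invol])
      exact ⟨k, hk⟩
  classical
  obtain ⟨k, hk, hmin⟩ : ∃ k, x.f (Sum.inl k) = Sum.inl (k + 1) ∧
      ∀ l < k, x.f (Sum.inl l) ≠ Sum.inl (l + 1) :=
    ⟨Nat.find hex, Nat.find_spec hex, fun l => Nat.find_min hex⟩
  have hkm : k + 1 < m := by
    by_contra hlt
    have := (h.vert (k + 1) (by omega)).1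
    rw [← hk, x.invol] at this
    simp at this
  rcases Nat.eq_zero_or_pos k with rfl | hk0
  · rcases zmod_two_eq_zero_or_one (x.g (Sum.inl 0)) with h1 | h1
    · exact ⟨1, hkm, op_eq_self.2 ⟨hk, .inr h1⟩⟩
    · exact ⟨0, hkm, op_eq_self.2 ⟨hk, .inr h1⟩⟩
  · refine ⟨k + 1, hkm, op_eq_self.2 ⟨hk, .inr ?_⟩⟩
    simp only [ndL, add_tsub_cancel_right, par, Nat.add_eq_zero_iff, one_ne_zero, and_false,
      if_false]
    by_contra hg
    have := h.exposed _ hg (Sum.inl 0)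
    rw [hk] at this
    rcases h0 : x.f (Sum.inl 0) with l | l
    · have n0 : l ≠ 0 := fun e => x.ne _ (h0.trans (by rw [e]))
      have n1 : l ≠ k := fun e => by
        have := x.invol (Sum.inl 0)
        rw [h0, e, hk] at this
        simp at this
      have n2 : l ≠ k + 1 := fun e => by
        have := x.invol (Sum.inl 0)
        rw [h0, e, ← hk, x.invol] at this
        simp at this
        omega
      rcases n1.lt_or_gt with n1 | n1
      · obtain ⟨p, -, h2, h3⟩ := exists_adjacent h.noncrossing (by omega) h0
        exact hmin p (by omega) h3
      · rw [h0] at this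
        simp at this
        omega
    · rw [h0] at this
      simp at this
      omega

theorem eq_one (h : Good m x) (hf : ∀ i j, x.f (Sum.inl i) ≠ Sum.inl j) : x = one := by
  have hex : ∀ i, ∃ j, x.f (Sum.inl i) = Sum.inr j := by
    intro i
    rcases hi : x.f (Sum.inl i) with j | j
    · exact absurd hi (hf i j)
    · exact ⟨j, rfl⟩
  choose p hp using hex
  have hmono : StrictMono p := by
    intro i j hij
    have h1 := h.noncrossing (Sum.inl i) (Sum.inl j)
    rw [hp, hp] at h1
    have h2 : p i ≠ p j := fun e => by
      have := x.invol (Sum.inl i)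
      rw [hp, e, ← hp, x.invol] at this
      simp at this
      omega
    simp at h1
    have := h1 hij
    omega
  -- Strict monotonicity gives `i ≤ p i` and `m + p i ≤ p (m + i)`, and beyond `m` the map is the
  -- identity.
  have hpi : ∀ i, p i = i := by
    intro i
    have h1 := hmono.add_le_nat m i
    have h2 := hmono.id_le i
    have h3 : p (m + i) = m + i := by
      have := (h.vert (m + i) (by omega)).1
      rw [hp] at this
      simpa using this
    have h4 : m + p i ≤ p (m + i) := h1
    simp at h2
    omega
  have hL : ∀ i, x.f (Sum.inl i) = Sum.inr i := fun i => by rw [hp, hpi]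
  have hR : ∀ i, x.f (Sum.inr i) = Sum.inl i := fun i => by rw [← hL, x.invol]
  have hg1 : ∀ i, i ≠ 0 → x.g (Sum.inl i) = 0 := by
    intro i hi
    by_contra hg
    have := h.exposed _ hg (Sum.inl 0)
    simp [hL] at this
    omega
  have hgR : ∀ i, x.g (Sum.inr i) = x.g (Sum.inl i) := fun i => by rw [← hL, x.g_f]
  -- Only the leftmost vertical edge is exposed. If decorated, it would contribute 2 to the sum,
  -- which is divisible by 4.
  have hg0 : x.g (Sum.inl 0) = 0 := by
    rcases Nat.eq_zero_or_pos m with rfl | hm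
    · exact (h.vert 0 le_rfl).2
    · have := h.sum
      have h1 : ∑ i ∈ Finset.range m, (x.g (Sum.inl i)).val = (x.g (Sum.inl 0)).val :=
        Finset.sum_eq_single_of_mem 0 (by simpa using hm) fun i _ hi => by rw [hg1 i hi]; rfl
      rw [nodes, Finset.sum_disjSum] at this
      simp only [hgR, h1] at this
      generalize x.g (Sum.inl 0) = q at this
      revert this q
      decide
  have hg : ∀ i, x.g (Sum.inl i) = 0 := fun i => by
    by_cases hi : i = 0
    · rw [hi, hg0]
    · exact hg1 i hi
  ext1
  · ext1 (i | i)
    · exact hL i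
    · exact hR i
  · ext1 (i | i)
    · exact hg i
    · exact (hgR i).trans (hg i)
  · simpa [one] using h.not_flag

/-- If `x` is fixed by `s`, then `x = s t x` for the next letter `t` to the right, and `t x` is
again good and fixed by `t`. At the right end `x = op s (vert m x)`, where `vert m x` has a plain
vertical edge at `m` and so belongs to the narrower box. -/
theorem exists_word_of_op (ih : ∀ y, Good m y → ∃ w, (∀ k ∈ w, k < m) ∧ nf w = y) (d : ℕ) {s : ℕ}
    (h : Good (m + 1) x) (hs : op s x = x) (hd : s - 1 + 1 + d = m) :
    ∃ w, (∀ k ∈ w, k < m + 1) ∧ nf w = x := by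
  induction d generalizing s x with
  | zero =>
    have hR : ndR s = Sum.inl m := by simpa [ndR] using hd
    have hf : x.f (Sum.inl m) = ndL s := by rw [← hR, ← (op_eq_self.1 hs).1, x.invol]
    have hy : Good (m + 1) (TLD.vert m x) := by
      refine h.join (by simp) (by simp) (by simp) (by simp [hf, ndL]) ?_
      rintro (i | i)
      · intro h1 h2
        simp only [ndPos_inl_lt_inl] at h1
        have := h.vert i h1
        simp [this, h1]
      · intro h1 h2
        simp only [ndPos_inr_lt_inr] at h2
        have := h.vert i h2
        have h3 : x.f (Sum.inr i) = Sum.inl i := by rw [← this.1, x.invol]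
        have h4 : x.g (Sum.inr i) = 0 := by rw [← this.1, x.g_f, this.2]
        simp [h3, h4, h2]
    have hv := vert_eq_self.1 (show TLD.vert m (TLD.vert m x) = TLD.vert m x from join_idem _ _ _)
    obtain ⟨w, hw, hwx⟩ := ih _ (hy.of_succ hv.1 (hv.2.resolve_left hy.not_flag))
    refine ⟨s :: w, ?_, ?_⟩
    · simp only [List.mem_cons, forall_eq_or_imp]
      exact ⟨by omega, fun k hk => (hw k hk).trans (by omega)⟩
    · have := op_vert_op hR x
      rw [hs] at this
      exact (congrArg (op s) hwx).trans this
  | succ d ihd =>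
    -- This is `s + 1` for `s ≥ 1` and `2` for `s = 0`: in each case the linked letter to the right.
    obtain ⟨t, ht⟩ : ∃ t, t = s - 1 + 1 + 1 := ⟨_, rfl⟩
    have hst : Lk s t := by unfold Lk; omega
    have hf : x.f (ndL t) ≠ ndR t := op_f_ne (t := s) (s := t) (by unfold Lk at *; omega) hs
    have hpar : par t = 0 := by simp [par]; omega
    have hy : Good (m + 1) (op t x) := by
      have := h.join (a := ndL t) (b := ndR t) (by simp [ndL, ndR]) (by simp [ndL]; omega)
        (by simp [ndR]; omega) hf (by rintro (i | i) <;> simp [ndL, ndR]; omega)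
      simpa only [op, hpar] using this
    obtain ⟨w, hw, hwx⟩ := ihd hy (op_idem t x) (by omega)
    refine ⟨s :: w, ?_, ?_⟩
    · simp only [List.mem_cons, forall_eq_or_imp]
      exact ⟨by omega, hw⟩
    · have := op_braid hst x
      rw [hs] at this
      exact (congrArg (op s) hwx).trans this

theorem exists_word (h : Good m x) : ∃ w, (∀ k ∈ w, k < m) ∧ nf w = x := by
  induction m generalizing x with
  | zero => exact ⟨[], by simp, (h.eq_one fun i j => by simp [(h.vert i (by omega)).1]).symm⟩
  | succ m ih =>
    by_cases hf : ∃ i j, x.f (Sum.inl i) = Sum.inl j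
    · obtain ⟨i, j, hij⟩ := hf
      obtain ⟨s, h1, h2⟩ := h.exists_op_eq_self hij
      exact exists_word_of_op (fun y hy => ih hy) (m - (s - 1 + 1)) h h2 (by omega)
    · push Not at hf
      exact ⟨[], by simp, (h.eq_one hf).symm⟩

end Good

/-- An odd loop can be made without changing the edges drawn by `s`: for `s = 1` by `0 1`, and for
`s + 1` by enclosing the word for `s` between two copies of `s + 1`. -/
theorem exists_word_f_eq {s : ℕ} (hs : 1 ≤ s) (x : Cfg Nd) :
    ∃ w : List ℕ, (∀ k ∈ w, k ≤ s) ∧ (act w x).flag ∧ (act w x).f = (op s x).f := by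
  induction s, hs using Nat.le_induction generalizing x with
  | base => exact ⟨[0, 1], by simp, op_zero_one_flag x, op_zero_one_f x⟩
  | succ s hs ih =>
    obtain ⟨w, h1, h2, h3⟩ := ih (op (s + 1) x)
    refine ⟨(s + 1) :: w ++ [s + 1], ?_, ?_, ?_⟩
    · simp only [List.cons_append, List.mem_cons, List.mem_append, List.not_mem_nil, or_false]
      rintro k (rfl | hk | rfl)
      · rfl
      · exact (h1 k hk).trans (by omega)
      · rfl
    · rw [List.cons_append, act_cons, act_append]
      exact op_flag_of_flag h2 _
    · rw [List.cons_append, act_cons, act_append, act_cons, act_nil, op_f_congr h3,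
        op_braid (by unfold Lk; omega)]

/-- Planar matchings with a decorated loop, apart from the identity, come from words. -/
theorem exists_word_of_flag {m : ℕ} (hm : 2 ≤ m) {x : Cfg Nd} (hx : x.flag)
    (hn : Noncrossing ndPos x.f) (hv : ∀ i, m ≤ i → x.f (Sum.inl i) = Sum.inr i)
    (h1 : x.f ≠ Sum.swap) : ∃ w, (∀ k ∈ w, k < m) ∧ nf w = x := by
  -- Without the loop, the undecorated matching is good and comes from a word.
  have hy : Good m { x with g := fun _ => 0, flag := False, g_f := fun _ => rfl,
                            g_flag := fun h => h.elim } :=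
    ⟨hn, fun u hu => absurd rfl hu, id, fun i hi => ⟨hv i hi, rfl⟩, by simp⟩
  obtain ⟨w, hw, hwx⟩ := hy.exists_word
  have hf : (nf w).f = x.f := by rw [hwx]
  rcases w with _ | ⟨s, w⟩
  · exact absurd hf.symm h1
  -- The first letter will be replaced by a word that also creates an odd loop. A letter `0` is
  -- first exchanged for `1`, which joins the same nodes.
  obtain ⟨t, ht1, htm, ht⟩ : ∃ t, 1 ≤ t ∧ t < m ∧ (op t (nf w)).f = (op s (nf w)).f := by
    rcases Nat.eq_zero_or_pos s with rfl | hs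
    · exact ⟨1, le_rfl, by omega, op_zero_f _⟩
    · exact ⟨s, hs, hw s (by simp), rfl⟩
  obtain ⟨v, hv1, hv2, hv3⟩ := exists_word_f_eq ht1 (nf w)
  refine ⟨v ++ w, ?_, ?_⟩
  · simp only [List.mem_append]
    rintro k (hk | hk)
    · exact (hv1 k hk).trans_lt htm
    · exact hw k (by simp [hk])
  · rw [nf, act_append]
    exact Cfg.ext_of_flag hv2 hx (by rw [hv3, ht, ← hf]; rfl)

/-! ## Multiplication by a simple diagram -/

namespace Diagram

/-! ### Glued edges and loops as minimal saturated sets -/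

section Component

variable {k : ℕ} (D E : Diagram k)

/-- Sets of nodes of the stacked boxes that are unions of glued edges and loops. -/
def Saturated (C : Finset (Stacked k)) : Prop :=
  ∀ x ∈ C, glue x ∈ C ∧ cross D E x ∈ C

variable {D E}

theorem mem_component_self (x : Stacked k) : x ∈ component D E x := by
  simp [component, Equiv.Perm.SameCycle.refl]

theorem saturated_component (x : Stacked k) : Saturated D E (component D E x) := by
  have h1 : ∀ y, (step D E).SameCycle y (cross D E (glue y)) := fun y => ⟨1, by simp [step_apply]⟩
  intro y hy
  simp only [component, Finset.mem_filter, Finset.mem_univ, true_and] at hy ⊢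
  constructor
  · rw [glue_invol]; exact hy.symm
  · rcases hy with hy | hy
    · right
      refine hy.trans (Equiv.Perm.SameCycle.symm ?_)
      simpa [glue_invol _, cross_invol D E _] using h1 (glue (cross D E y))
    · left
      refine hy.trans ?_
      simpa [glue_invol _] using h1 (glue y)

theorem component_subset {C : Finset (Stacked k)} (hC : Saturated D E C) {x : Stacked k}
    (hx : x ∈ C) : component D E x ⊆ C := by
  have key : ∀ y, (step D E).SameCycle x y → y ∈ C := by
    intro y hy
    obtain ⟨i, -, rfl⟩ := hy.exists_pow_eq'
    clear hy
    induction i with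
    | zero => simpa using hx
    | succ i ih =>
      rw [pow_succ', Equiv.Perm.mul_apply, step_apply]
      exact (hC _ (hC _ ih).1).2
  intro y hy
  simp only [component, Finset.mem_filter, Finset.mem_univ, true_and] at hy
  rcases hy with hy | hy
  · exact key y hy
  · rw [← glue_invol y]; exact (hC _ (key _ hy)).1

/-- The end of a walk is found without following it: any saturated set through `u` that meets the
boundary only in `u` and `v` will do, because a walk never ends where it starts. -/
theorem walkEnd_eq {C : Finset (Stacked k)} (hC : Saturated D E C) {u v : Node k}
    (hu : outer u ∈ C) (h : ∀ w, outer w ∈ C → w = u ∨ w = v) : walkEnd D E u = v := by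
  have h1 : outer (walkEnd D E u) ∈ component D E (outer u) := by
    rw [← component_walkEnd]; exact mem_component_self _
  exact (h _ (component_subset hC hu h1)).resolve_left (walkEnd_ne D E u)

end Component

end Diagram

section Simple

open Diagram

variable {n : ℕ} (hn : 4 ≤ n) (s : Fin n) (E : Diagram n)

/-- The left one of the north nodes joined in the simple diagram. -/
abbrev northL : Node n := Sum.inl (leftNode s)

/-- The right one of the north nodes joined in the simple diagram. -/
abbrev northR : Node n := Sum.inl (rightNode hn s)

/-- The number of decorations on the non-propagating edges of the simple diagram. -/
def simpleDeco (s : Fin n) : ℕ := if (s : ℕ) = 0 then 1 else 0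

theorem northL_ne_northR : northL s ≠ northR hn s := by
  simpa using leftNode_ne_rightNode hn s

theorem simple_inl_left :
    (simpleDiagram hn s).partner (Sum.inl (leftNode s)) = Sum.inl (rightNode hn s) := by
  simp [simpleDiagram, simplePartner]

theorem simple_inl_right :
    (simpleDiagram hn s).partner (Sum.inl (rightNode hn s)) = Sum.inl (leftNode s) := by
  simp [simpleDiagram, simplePartner]

theorem simple_inr_left :
    (simpleDiagram hn s).partner (Sum.inr (leftNode s)) = Sum.inr (rightNode hn s) := by
  simp [simpleDiagram, simplePartner]

theorem simple_inr_right :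
    (simpleDiagram hn s).partner (Sum.inr (rightNode hn s)) = Sum.inr (leftNode s) := by
  simp [simpleDiagram, simplePartner]

variable {s} in
theorem simple_inl {i : Fin n} (h1 : i ≠ leftNode s) (h2 : i ≠ rightNode hn s) :
    (simpleDiagram hn s).partner (Sum.inl i) = Sum.inr i := by
  simp [simpleDiagram, simplePartner, h1, h2]

variable {s} in
theorem simple_inr {i : Fin n} (h1 : i ≠ leftNode s) (h2 : i ≠ rightNode hn s) :
    (simpleDiagram hn s).partner (Sum.inr i) = Sum.inl i := by
  simp [simpleDiagram, simplePartner, h1, h2]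

/-- The part of the stacked boxes below the north face edge that is attached to the nodes `V` of
the lower box. -/
def attached (V : Finset (Node n)) : Finset (Stacked n) :=
  ((Finset.univ.filter fun i => Sum.inl i ∈ V ∧ i ≠ leftNode s ∧ i ≠ rightNode hn s).disjSum
    (Finset.univ.filter fun i => Sum.inl i ∈ V)).disjSum V

variable {hn s E}

@[simp] theorem inr_mem_attached {V : Finset (Node n)} {v : Node n} :
    Sum.inr v ∈ attached hn s V ↔ v ∈ V := by simp [attached]

@[simp] theorem inl_inr_mem_attached {V : Finset (Node n)} {i : Fin n} :
    Sum.inl (Sum.inr i) ∈ attached hn s V ↔ Sum.inl i ∈ V := by simp [attached]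

@[simp] theorem inl_inl_mem_attached {V : Finset (Node n)} {i : Fin n} :
    Sum.inl (Sum.inl i) ∈ attached hn s V ↔
      Sum.inl i ∈ V ∧ i ≠ leftNode s ∧ i ≠ rightNode hn s := by simp [attached]

theorem outer_mem_attached {V : Finset (Node n)} {u : Node n} :
    outer u ∈ attached hn s V ↔ u ∈ V ∧ u ≠ northL s ∧ u ≠ northR hn s := by
  rcases u with i | i <;> simp [outer]

theorem saturated_attached {V : Finset (Node n)} (h1 : ∀ v ∈ V, E.partner v ∈ V)
    (h2 : northL s ∈ V ↔ northR hn s ∈ V) :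
    Saturated (simpleDiagram hn s) E (attached hn s V) := by
  rintro ((i | i) | (i | i)) hx
  · simp only [inl_inl_mem_attached] at hx
    simp [glue, cross, hx, simple_inl hn hx.2.1 hx.2.2]
  · simp only [inl_inr_mem_attached] at hx
    refine ⟨by simpa [glue] using hx, ?_⟩
    by_cases k1 : i = leftNode s
    · subst k1
      simpa [cross, simple_inr_left] using h2.1 hx
    by_cases k2 : i = rightNode hn s
    · subst k2
      simpa [cross, simple_inr_right] using h2.2 hx
    simp [cross, simple_inr hn k1 k2, hx, k1, k2]
  · simp only [inr_mem_attached] at hx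
    simp [glue, cross, hx, h1 _ hx]
  · simp only [inr_mem_attached] at hx
    simp [glue, cross, hx, h1 _ hx]

theorem Diagram.Saturated.partner_mem {C : Finset (Stacked n)}
    (hC : Saturated (simpleDiagram hn s) E C) {v : Node n} (hv : Sum.inr v ∈ C) :
    Sum.inr (E.partner v) ∈ C := (hC _ hv).2

theorem Diagram.Saturated.north_mem {C : Finset (Stacked n)}
    (hC : Saturated (simpleDiagram hn s) E C) :
    Sum.inr (northL s) ∈ C ↔ Sum.inr (northR hn s) ∈ C := by
  constructor
  · intro h
    have h1 := (hC _ (hC _ h).1).2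
    simp only [glue, cross, Sum.map_inl, simple_inr_left] at h1
    exact (hC _ h1).1
  · intro h
    have h1 := (hC _ (hC _ h).1).2
    simp only [glue, cross, Sum.map_inl, simple_inr_right] at h1
    exact (hC _ h1).1

theorem Diagram.Saturated.inr_mem {C : Finset (Stacked n)}
    (hC : Saturated (simpleDiagram hn s) E C) {u : Node n} (h1 : u ≠ northL s)
    (h2 : u ≠ northR hn s) : Sum.inr u ∈ C ↔ outer u ∈ C := by
  rcases u with i | i
  · have h3 : i ≠ leftNode s := fun e => h1 (by rw [e])
    have h4 : i ≠ rightNode hn s := fun e => h2 (by rw [e])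
    constructor
    · intro h
      have := (hC _ (hC _ h).1).2
      simpa only [outer, glue, cross, Sum.map_inl, simple_inr hn h3 h4] using this
    · intro h
      have := (hC _ (hC _ h).2).1
      simpa only [outer, glue, cross, Sum.map_inl, simple_inl hn h3 h4] using this
  · rfl

theorem component_eq_attached {V : Finset (Node n)} (h1 : ∀ v ∈ V, E.partner v ∈ V)
    (h2 : northL s ∈ V ↔ northR hn s ∈ V) {x : Stacked n} (hx : x ∈ attached hn s V)
    (h3 : ∀ v ∈ V, Sum.inr v ∈ component (simpleDiagram hn s) E x) :
    component (simpleDiagram hn s) E x = attached hn s V := by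
  refine (component_subset (saturated_attached h1 h2) hx).antisymm ?_
  have hC := saturated_component (D := simpleDiagram hn s) (E := E) x
  rintro ((i | i) | v) hy
  · simp only [inl_inl_mem_attached] at hy
    exact (hC.inr_mem (u := Sum.inl i) (by simpa using hy.2.1) (by simpa using hy.2.2)).1
      (h3 _ hy.1)
  · exact (hC _ (h3 (Sum.inl i) (by simpa using hy))).1
  · exact h3 v (by simpa using hy)

theorem decoOn_attached {V : Finset (Node n)} (h : northL s ∈ V ↔ northR hn s ∈ V) :
    decoOn (simpleDiagram hn s) E (attached hn s V) =
      (∑ v ∈ V, E.deco v + if northL s ∈ V then 2 * simpleDeco s else 0) / 2 := by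
  have hne := leftNode_ne_rightNode hn s
  rw [decoOn, attached, Finset.sum_disjSum, Finset.sum_disjSum, Finset.sum_filter,
    Finset.sum_filter]
  have h1 : (∑ i : Fin n, if Sum.inl i ∈ V ∧ i ≠ leftNode s ∧ i ≠ rightNode hn s then
      (simpleDiagram hn s).deco (Sum.inl i) else 0) = 0 := by
    refine Finset.sum_eq_zero fun i _ => ?_
    split_ifs with hi
    · simp [simpleDiagram, hi]
    · rfl
  have h2 : (∑ i : Fin n, if Sum.inl i ∈ V then (simpleDiagram hn s).deco (Sum.inr i) else 0) =
      if northL s ∈ V then 2 * simpleDeco s else 0 := by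
    have h3 : ∀ i : Fin n, (if Sum.inl i ∈ V then (simpleDiagram hn s).deco (Sum.inr i) else 0) =
        (if i = leftNode s then (if northL s ∈ V then simpleDeco s else 0) else 0) +
        (if i = rightNode hn s then (if northL s ∈ V then simpleDeco s else 0) else 0) := by
      intro i
      by_cases k1 : i = leftNode s
      · subst k1
        simp [hne, simpleDiagram, simpleDeco]
      by_cases k2 : i = rightNode hn s
      · subst k2
        simp [hne.symm, simpleDiagram, simpleDeco, h]
      simp [k1, k2, simpleDiagram]
    rw [Finset.sum_congr rfl fun i _ => h3 i, Finset.sum_add_distrib]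
    simp only [Finset.sum_ite_eq', Finset.mem_univ, if_true]
    split_ifs <;> ring
  simp only [Sum.elim_inl, Sum.elim_inr]
  rw [h1, h2, zero_add, add_comm]

variable (hn s E)

theorem north_edge {u : Node n} (hu : u = northL s ∨ u = northR hn s) :
    component (simpleDiagram hn s) E (outer u) = {outer (northL s), outer (northR hn s)} := by
  have hC := saturated_component (D := simpleDiagram hn s) (E := E) (outer u)
  have h0 := mem_component_self (D := simpleDiagram hn s) (E := E) (outer u)
  refine (component_subset ?_ ?_).antisymm ?_
  · simp [Saturated, outer, glue, cross, simple_inl_left, simple_inl_right]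
  · rcases hu with rfl | rfl <;> simp
  · have h1 := (hC _ h0).2
    rcases hu with rfl | rfl
    · simp only [outer, cross, Sum.map_inl, simple_inl_left] at h0 h1
      simp [Finset.insert_subset_iff, outer, h0, h1]
    · simp only [outer, cross, Sum.map_inl, simple_inl_right] at h0 h1
      simp [Finset.insert_subset_iff, outer, h0, h1]

/-- Three kinds of glued edges occur: the north edge of the simple diagram, the edge that runs
through its south edge and joins the former partners, and the edges of `E` continued by vertical
ones. For each, the component is identified with an explicit saturated set. -/
theorem simple_mul_aux (u : Node n) :
    (simpleDiagram hn s * E).partner u = joinFun (northL s) (northR hn s) E.partner u ∧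
    (simpleDiagram hn s * E).deco u =
      if u = northL s ∨ u = northR hn s then simpleDeco s
      else if u = E.partner (northL s) ∨ u = E.partner (northR hn s) then
        E.deco (northL s) + E.deco (northR hn s) + simpleDeco s
      else E.deco u := by
  change walkEnd (simpleDiagram hn s) E u = _ ∧
    decoOn (simpleDiagram hn s) E (component (simpleDiagram hn s) E (outer u)) = _
  have hne := northL_ne_northR hn s
  have hi := E.partner_invol
  have hnf := E.partner_ne
  have hC := saturated_component (D := simpleDiagram hn s) (E := E) (outer u)
  have h0 := mem_component_self (D := simpleDiagram hn s) (E := E) (outer u)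
  by_cases k1 : u = northL s ∨ u = northR hn s
  · have hc := north_edge hn s E k1
    rw [if_pos k1, hc]
    constructor
    · refine walkEnd_eq (hc ▸ hC) (hc ▸ h0) fun w hw => ?_
      simp only [Finset.mem_insert, Finset.mem_singleton] at hw
      have hw' : w = northL s ∨ w = northR hn s := by
        rcases hw with hw | hw <;> [left; right] <;>
        · have := congrArg boundary hw
          rw [boundary_outer, boundary_outer] at this
          exact Option.some.inj this
      grind [joinFun]
    · rw [decoOn, Finset.sum_pair (by simpa [outer] using leftNode_ne_rightNode hn s)]
      simp [outer, simpleDiagram, simpleDeco]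
      split_ifs <;> rfl
  rw [if_neg k1]
  have k1' := not_or.1 k1
  have hu := (hC.inr_mem k1'.1 k1'.2).2 h0
  by_cases k2 : u = E.partner (northL s) ∨ u = E.partner (northR hn s)
  · rw [if_pos k2]
    have hL : Sum.inr (northL s) ∈ component (simpleDiagram hn s) E (outer u) := by
      have := hC.partner_mem hu
      rcases k2 with rfl | rfl
      · rwa [hi] at this
      · rw [hi] at this
        exact hC.north_mem.2 this
    have hR := hC.north_mem.1 hL
    obtain ⟨V, hV⟩ : ∃ V : Finset (Node n), V = {northL s, northR hn s, E.partner (northL s),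
      E.partner (northR hn s)} := ⟨_, rfl⟩
    have hmem : ∀ v, v ∈ V ↔ v = northL s ∨ v = northR hn s ∨ v = E.partner (northL s) ∨
      v = E.partner (northR hn s) := by simp [hV]
    have hV1 : ∀ v ∈ V, E.partner v ∈ V := by
      intro v; rw [hmem, hmem]
      rintro (rfl | rfl | rfl | rfl) <;> simp [hi _]
    have hV2 : northL s ∈ V ↔ northR hn s ∈ V := by simp [hV]
    have huV : outer u ∈ attached hn s V := by
      rw [outer_mem_attached, hmem]; tauto
    have hc : component (simpleDiagram hn s) E (outer u) = attached hn s V := by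
      refine component_eq_attached hV1 hV2 huV fun v hv => ?_
      rw [hmem] at hv
      rcases hv with rfl | rfl | rfl | rfl
      · exact hL
      · exact hR
      · exact hC.partner_mem hL
      · exact hC.partner_mem hR
    constructor
    · refine walkEnd_eq (saturated_attached hV1 hV2) huV fun w hw => ?_
      rw [outer_mem_attached, hmem] at hw
      grind [joinFun]
    · rw [hc, decoOn_attached hV2, if_pos (by simp [hV]), hV]
      have e1 : E.partner (northL s) ≠ northR hn s := by
        intro e
        rcases k2 with k2 | k2
        · exact k1'.2 (k2.trans e)
        · exact k1'.1 (by rw [k2, ← e, hi])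
      have e2 : E.partner (northR hn s) ≠ northL s := fun e => e1 (by rw [← e, hi])
      rw [Finset.sum_insert, Finset.sum_insert, Finset.sum_pair, E.deco_partner, E.deco_partner]
      · omega
      · exact fun e => hne (E.partner_invol.injective e)
      · simp only [Finset.mem_insert, Finset.mem_singleton, not_or]
        exact ⟨e1.symm, (hnf _).symm⟩
      · simp only [Finset.mem_insert, Finset.mem_singleton, not_or]
        exact ⟨hne, (hnf _).symm, e2.symm⟩
  · rw [if_neg k2]
    obtain ⟨V, hV⟩ : ∃ V : Finset (Node n), V = {u, E.partner u} := ⟨_, rfl⟩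
    have hmem : ∀ v, v ∈ V ↔ v = u ∨ v = E.partner u := by simp [hV]
    have hV1 : ∀ v ∈ V, E.partner v ∈ V := by
      intro v; rw [hmem, hmem]
      rintro (rfl | rfl) <;> simp [hi _]
    have hL : northL s ∉ V := by rw [hmem]; grind
    have hR : northR hn s ∉ V := by rw [hmem]; grind
    have hV2 : northL s ∈ V ↔ northR hn s ∈ V := by simp [hL, hR]
    have huV : outer u ∈ attached hn s V := by
      rw [outer_mem_attached, hmem]; tauto
    have hc : component (simpleDiagram hn s) E (outer u) = attached hn s V := by
      refine component_eq_attached hV1 hV2 huV fun v hv => ?_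
      rw [hmem] at hv
      rcases hv with rfl | rfl
      · exact hu
      · exact hC.partner_mem hu
    constructor
    · refine walkEnd_eq (saturated_attached hV1 hV2) huV fun w hw => ?_
      rw [outer_mem_attached, hmem] at hw
      grind [joinFun]
    · rw [hc, decoOn_attached hV2, if_neg hL, hV, Finset.sum_pair (hnf u).symm, E.deco_partner]
      omega

theorem simple_mul_partner :
    (simpleDiagram hn s * E).partner = joinFun (northL s) (northR hn s) E.partner :=
  funext fun u => (simple_mul_aux hn s E u).1

theorem simple_mul_deco (u : Node n) :
    (simpleDiagram hn s * E).deco u =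
      if u = northL s ∨ u = northR hn s then simpleDeco s
      else if u = E.partner (northL s) ∨ u = E.partner (northR hn s) then
        E.deco (northL s) + E.deco (northR hn s) + simpleDeco s
      else E.deco u :=
  (simple_mul_aux hn s E u).2

theorem simple_mul_loops :
    (simpleDiagram hn s * E).loops = E.loops +
      if E.partner (northL s) = northR hn s then {E.deco (northL s) + simpleDeco s} else 0 := by
  change 0 + E.loops + _ = _
  rw [zero_add]
  congr 1
  have hne := northL_ne_northR hn s
  obtain ⟨V, hV⟩ : ∃ V : Finset (Node n), V = {northL s, northR hn s} := ⟨_, rfl⟩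
  have hmem : ∀ v, v ∈ V ↔ v = northL s ∨ v = northR hn s := by simp [hV]
  have hV2 : northL s ∈ V ↔ northR hn s ∈ V := by simp [hV]
  -- a component that avoids the boundary is the loop through the two joined nodes
  have key : ∀ x, (∀ y ∈ component (simpleDiagram hn s) E x, boundary y = none) →
      E.partner (northL s) = northR hn s ∧ x ∈ attached hn s V ∧
        Sum.inr (northL s) ∈ component (simpleDiagram hn s) E x := by
    intro x hx
    have hC := saturated_component (D := simpleDiagram hn s) (E := E) x
    have h0 := mem_component_self (D := simpleDiagram hn s) (E := E) x
    have hin : ∀ v, Sum.inr v ∈ component (simpleDiagram hn s) E x →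
        v = northL s ∨ v = northR hn s := by
      intro v hv
      by_contra hk
      have := hx _ ((hC.inr_mem (not_or.1 hk).1 (not_or.1 hk).2).1 hv)
      simp [boundary_outer] at this
    have hL : x ∈ attached hn s V ∧ Sum.inr (northL s) ∈ component (simpleDiagram hn s) E x := by
      rcases x with (i | i) | v
      · exact absurd (hx _ h0) (by simp [boundary])
      · have h1 := (hC _ h0).1
        simp only [glue] at h1
        rw [inl_inr_mem_attached, hmem]
        refine ⟨hin _ h1, ?_⟩
        rcases hin _ h1 with h | h
        · rwa [← h]
        · rw [hC.north_mem]; rwa [← h]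
      · rw [inr_mem_attached, hmem]
        refine ⟨hin _ h0, ?_⟩
        rcases hin _ h0 with h | h
        · rwa [← h]
        · rw [hC.north_mem]; rwa [← h]
    exact ⟨(hin _ (hC.partner_mem hL.2)).resolve_left (E.partner_ne _), hL⟩
  by_cases hp : E.partner (northL s) = northR hn s
  · have hp' : E.partner (northR hn s) = northL s := by rw [← hp, E.partner_invol]
    have hV1 : ∀ v ∈ V, E.partner v ∈ V := by
      intro v; rw [hmem, hmem]
      rintro (rfl | rfl) <;> simp [hp, hp']
    have hc : ∀ x ∈ attached hn s V, Sum.inr (northL s) ∈ component (simpleDiagram hn s) E x →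
        component (simpleDiagram hn s) E x = attached hn s V := by
      intro x hx hL
      refine component_eq_attached hV1 hV2 hx fun v hv => ?_
      rw [hmem] at hv
      rcases hv with rfl | rfl
      · exact hL
      · exact (saturated_component x).north_mem.1 hL
    have hnew : newLoops (simpleDiagram hn s) E = {attached hn s V} := by
      ext C
      simp only [newLoops, Finset.mem_filter, Finset.mem_image, Finset.mem_univ, true_and,
        Finset.mem_singleton]
      constructor
      · rintro ⟨⟨x, rfl⟩, hx⟩
        exact hc x (key x hx).2.1 (key x hx).2.2
      · rintro rfl
        refine ⟨⟨Sum.inr (northL s), hc _ (by simp [hmem]) (mem_component_self _)⟩, ?_⟩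
        rintro ((i | i) | (i | i)) hx <;> simp [hmem, boundary] at hx ⊢
        grind
    rw [hnew, if_pos hp]
    simp only [Finset.singleton_val, Multiset.map_singleton, Multiset.singleton_inj]
    rw [decoOn_attached hV2, if_pos (by simp [hV]), hV, Finset.sum_pair hne, ← hp, E.deco_partner]
    omega
  · have hnew : newLoops (simpleDiagram hn s) E = ∅ := by
      rw [newLoops, Finset.filter_eq_empty_iff]
      intro C hC hx
      obtain ⟨x, -, rfl⟩ := Finset.mem_image.1 hC
      exact hp (key x hx).1
    rw [hnew, if_neg hp]
    rfl

end Simple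

/-! ## Word diagrams are L-decorated -/

theorem Node.pos_injective {n : ℕ} : Function.Injective (Node.pos (k := n)) := by
  rintro (i | i) (j | j) h <;> simp only [Node.pos] at h
  · exact congrArg _ (Fin.ext h)
  · omega
  · omega
  · exact congrArg _ (Fin.ext (by omega))

theorem one_partner {n : ℕ} (u : Node n) : (1 : Diagram n).partner u = u.swap := rfl

theorem isLDecorated_one {n : ℕ} : (1 : Diagram n).IsLDecorated where
  planar := by
    rintro (i | i) (j | j) ⟨h1, h2, h3⟩ <;>
      simp only [one_partner, Sum.swap_inl, Sum.swap_inr, Node.pos] at h1 h2 h3 <;> omega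
  undecorated _ := ⟨fun _ => rfl, fun m hm => absurd hm (Multiset.notMem_zero m)⟩
  exposed u hu := absurd rfl hu

/-- The joined nodes are adjacent, so nothing lies between them and the planarity lemmas apply. New
decorations come only from index `0`, whose nodes are at the wall, so the edges that carry them are
exposed. -/
theorem isLDecorated_simple_mul {n : ℕ} (hn : 4 ≤ n) (s : Fin n) {E : Diagram n}
    (hE : E.IsLDecorated) : (simpleDiagram hn s * E).IsLDecorated := by
  have hp : Noncrossing Node.pos E.partner := hE.planar
  have he : ∀ u, E.deco u ≠ 0 → Exposed Node.pos E.partner u := hE.exposed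
  have hpa : (northL s).pos = (s : ℕ) - 1 := rfl
  have hpb : (northR hn s).pos = (s : ℕ) - 1 + 1 := rfl
  have hab : (northL s).pos < (northR hn s).pos := by omega
  have hc : ∀ v : Node n, (northL s).pos < v.pos → v.pos < (northR hn s).pos →
      (northL s).pos < (E.partner v).pos ∧ (E.partner v).pos < (northR hn s).pos :=
    fun v h1 h2 => by omega
  have hs : simpleDeco s ≠ 0 → (s : ℕ) = 0 := by simp [simpleDeco]
  refine ⟨?_, ?_, ?_⟩
  · intro u v
    rw [simple_mul_partner]
    exact hp.join Node.pos_injective E.partner_invol E.partner_ne hab hc u v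
  · intro h
    obtain ⟨j, hj⟩ := h (leftNode s)
    simp [simple_mul_partner, joinFun] at hj
  · intro u hu
    rw [simple_mul_deco] at hu
    change Exposed Node.pos _ u
    rw [simple_mul_partner]
    split_ifs at hu with h1 h2
    · have h0 := hs hu
      have e : joinFun (northL s) (northR hn s) E.partner u =
          if u = northL s then northR hn s else northL s := by grind [joinFun]
      intro v hv
      rw [e] at hv
      rcases h1 with rfl | rfl
      · omega
      · rw [if_neg (northL_ne_northR hn s).symm] at hv
        omega
    · refine Exposed.join_partner hp Node.pos_injective E.partner_invol hab hc ?_ (by tauto)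
        (by tauto) h2
      by_cases k1 : E.deco (northL s) = 0
      · by_cases k2 : E.deco (northR hn s) = 0
        · have h0 := hs (by omega)
          exact .inr (.inr fun v => by omega)
        · exact .inr (.inl (he _ k2))
      · exact .inl (he _ k1)
    · exact Exposed.join hp Node.pos_injective E.partner_invol hab (by tauto) (by tauto)
        (by tauto) (by tauto) (by omega) (he _ hu)

theorem isLDecorated_wordDiagram {n : ℕ} (hn : 4 ≤ n) (ω : List (Fin n)) :
    (wordDiagram hn ω).IsLDecorated := by
  induction ω with
  | nil => exact isLDecorated_one
  | cons s ω ih => exact isLDecorated_simple_mul hn s ih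

/-! ## The matching of a diagram -/

section ToCfg

variable {n : ℕ}

/-- The nodes of the box of width `n`, among the nodes of the box of infinite width. -/
def emb : Node n → Nd := Sum.map Fin.val Fin.val

theorem emb_injective : Function.Injective (emb (n := n)) :=
  Sum.map_injective.2 ⟨Fin.val_injective, Fin.val_injective⟩

@[simp] theorem emb_inj {u v : Node n} : emb u = emb v ↔ u = v := emb_injective.eq_iff

theorem emb_swap (u : Node n) : emb u.swap = (emb u).swap := by rcases u with i | i <;> rfl

theorem exists_emb_or (u : Nd) : (∃ v : Node n, emb v = u) ∨
    ((¬ ∃ v : Node n, emb v = u) ∧ (¬ ∃ v : Node n, emb v = u.swap) ∧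
      ∃ i, n ≤ i ∧ (u = Sum.inl i ∨ u = Sum.inr i)) := by
  rcases u with i | i
  · by_cases hi : i < n
    · exact .inl ⟨Sum.inl ⟨i, hi⟩, rfl⟩
    · refine .inr ⟨?_, ?_, i, not_lt.1 hi, .inl rfl⟩ <;> rintro ⟨j | j, hj⟩ <;>
        simp [emb] at hj <;> omega
  · by_cases hi : i < n
    · exact .inl ⟨Sum.inr ⟨i, hi⟩, rfl⟩
    · refine .inr ⟨?_, ?_, i, not_lt.1 hi, .inr rfl⟩ <;> rintro ⟨j | j, hj⟩ <;>
        simp [emb] at hj <;> omega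

namespace Diagram

/-- The edges of a diagram, with vertical edges added on the right. -/
noncomputable def edges (D : Diagram n) : Nd → Nd :=
  Function.extend emb (emb ∘ D.partner) Sum.swap

/-- There is a loop with an odd number of decorations. -/
def HasOddLoop (D : Diagram n) : Prop := ∃ m ∈ D.loops, Odd m

@[simp] theorem edges_emb (D : Diagram n) (u : Node n) : D.edges (emb u) = emb (D.partner u) :=
  emb_injective.extend_apply _ _ _

theorem edges_of_not (D : Diagram n) {u : Nd} (h : ¬ ∃ v : Node n, emb v = u) :
    D.edges u = u.swap :=
  Function.extend_apply' _ _ _ h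

open Classical in
/-- The class of a diagram modulo the relations, up to powers of `δ`. -/
noncomputable def toCfg (D : Diagram n) : Cfg Nd where
  f := D.edges
  g u := if D.HasOddLoop then 0 else Function.extend emb (fun v => (D.deco v : ZMod 2)) 0 u
  flag := D.HasOddLoop
  invol u := by
    rcases exists_emb_or (n := n) u with ⟨v, rfl⟩ | ⟨h1, h2, -⟩
    · simp [D.partner_invol v]
    · rw [D.edges_of_not h1, D.edges_of_not h2, Sum.swap_swap]
  ne u := by
    rcases exists_emb_or (n := n) u with ⟨v, rfl⟩ | ⟨h1, -, -⟩
    · simpa using D.partner_ne v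
    · rw [D.edges_of_not h1]
      rcases u with i | i <;> simp
  g_f u := by
    rcases exists_emb_or (n := n) u with ⟨v, rfl⟩ | ⟨h1, h2, -⟩
    · rw [D.edges_emb, emb_injective.extend_apply, emb_injective.extend_apply, D.deco_partner]
    · rw [D.edges_of_not h1, Function.extend_apply' _ _ _ h1, Function.extend_apply' _ _ _ h2]
      rfl
  g_flag h u := if_pos h

theorem toCfg_g_emb {D : Diagram n} (h : ¬ D.HasOddLoop) (u : Node n) :
    D.toCfg.g (emb u) = D.deco u :=
  (if_neg h).trans (emb_injective.extend_apply _ _ _)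

theorem toCfg_g_of_not (D : Diagram n) {u : Nd} (h : ¬ ∃ v : Node n, emb v = u) :
    D.toCfg.g u = 0 := by
  have : Function.extend emb (fun v => (D.deco v : ZMod 2)) 0 u = 0 :=
    Function.extend_apply' _ _ _ h
  simp [toCfg, this]

theorem toCfg_one : toCfg (1 : Diagram n) = one := by
  have hl : ¬ HasOddLoop (1 : Diagram n) := by
    rintro ⟨m, hm, -⟩
    exact absurd hm (Multiset.notMem_zero m)
  ext1
  · ext1 u
    change edges 1 u = u.swap
    rcases exists_emb_or (n := n) u with ⟨v, rfl⟩ | ⟨h1, -, -⟩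
    · rw [edges_emb, ← emb_swap]; rfl
    · exact edges_of_not _ h1
  · ext1 u
    rcases exists_emb_or (n := n) u with ⟨v, rfl⟩ | ⟨h1, -, -⟩
    · rw [toCfg_g_emb hl]
      exact Nat.cast_zero
    · exact toCfg_g_of_not _ h1
  · exact propext ⟨hl, fun h => h.elim⟩

variable (hn : 4 ≤ n) (s : Fin n) (E : Diagram n)

theorem emb_northL : emb (northL s) = ndL s := rfl

theorem emb_northR : emb (northR hn s) = ndR s := rfl

theorem cast_simpleDeco : (simpleDeco s : ZMod 2) = par s := by
  simp [simpleDeco, par]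

theorem hasOddLoop_simple_mul :
    (simpleDiagram hn s * E).HasOddLoop ↔ (op s E.toCfg).flag := by
  have h1 : E.toCfg.f (ndL s) = ndR s ↔ E.partner (northL s) = northR hn s := by
    rw [← emb_northL, ← emb_northR hn]
    exact (by rw [← emb_inj, ← edges_emb]; rfl)
  change _ ↔ E.HasOddLoop ∨ E.toCfg.f (ndL s) = ndR s ∧ E.toCfg.g (ndL s) ≠ par s
  by_cases hf : E.HasOddLoop
  · obtain ⟨m, hm, ho⟩ := hf
    exact ⟨fun _ => .inl ⟨m, hm, ho⟩,
      fun _ => ⟨m, by rw [simple_mul_loops]; exact Multiset.mem_add.2 (.inl hm), ho⟩⟩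
  · have h2 : E.toCfg.g (ndL s) ≠ par s ↔ Odd (E.deco (northL s) + simpleDeco s) := by
      rw [← emb_northL, toCfg_g_emb hf, ← cast_simpleDeco, ← ZMod.natCast_ne_zero_iff_odd]
      push_cast
      generalize ((simpleDeco s : ℕ) : ZMod 2) = p
      generalize ((E.deco (northL s) : ℕ) : ZMod 2) = q
      revert p q
      decide
    rw [h1, h2, HasOddLoop, simple_mul_loops]
    simp only [Multiset.mem_add, or_and_right, exists_or]
    refine or_congr Iff.rfl ?_
    by_cases h3 : E.partner (northL s) = northR hn s <;> simp [h3]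

/-- The bridge between diagrams and matchings: passing to the class turns concatenation into `op`.
-/
theorem toCfg_simple_mul : (simpleDiagram hn s * E).toCfg = op s E.toCfg := by
  have hfl := hasOddLoop_simple_mul hn s E
  ext1
  · ext1 u
    change edges _ u = joinFun (ndL s) (ndR s) E.edges u
    rw [← emb_northL, ← emb_northR hn]
    rcases exists_emb_or (n := n) u with ⟨v, rfl⟩ | ⟨h1, h2, -⟩
    · rw [edges_emb, simple_mul_partner]
      simp only [joinFun, edges_emb, emb_inj]
      split_ifs <;> rfl
    · have h3 : ∀ v : Node n, u ≠ emb v := fun v e => h1 ⟨v, e.symm⟩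
      rw [edges_of_not _ h1]
      simp [joinFun, h3, edges_of_not _ h1]
  · by_cases hf : (simpleDiagram hn s * E).HasOddLoop
    · ext1 u
      rw [g_flag _ (hfl.1 hf), g_flag _ hf]
    · have hf' := fun h => hf (hfl.2 h)
      have hfE : ¬ E.HasOddLoop := fun h => hf' (.inl h)
      ext1 u
      rw [op, join_g _ _ hf', ← emb_northL, ← emb_northR hn]
      change _ = joinDeco _ _ _ E.edges _ u
      rcases exists_emb_or (n := n) u with ⟨v, rfl⟩ | ⟨h1, h2, -⟩
      · rw [toCfg_g_emb hf, simple_mul_deco]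
        simp only [joinDeco, edges_emb, emb_inj, toCfg_g_emb hfE]
        split_ifs
        · exact cast_simpleDeco s
        · push_cast [cast_simpleDeco]; rfl
        · rfl
      · have h3 : ∀ v : Node n, u ≠ emb v := fun v e => h1 ⟨v, e.symm⟩
        rw [toCfg_g_of_not _ h1]
        simp [joinDeco, h3, toCfg_g_of_not _ h1]
  · exact propext hfl

open Classical in
-- A new loop either raises the flag or is counted by `em`. So the number of loops, less one if an
-- odd loop is present, grows by exactly `em`.
theorem card_loops_simple_mul :
    (simpleDiagram hn s * E).loops.card + (if E.HasOddLoop then 1 else 0) =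
      E.loops.card + em s E.toCfg + if (simpleDiagram hn s * E).HasOddLoop then 1 else 0 := by
  have h1 : E.toCfg.f (ndL s) = ndR s ↔ E.partner (northL s) = northR hn s := by
    rw [← emb_northL, ← emb_northR hn]
    exact (by rw [← emb_inj, ← edges_emb]; rfl)
  have h2 : (op s E.toCfg).flag ↔
    E.HasOddLoop ∨ E.toCfg.f (ndL s) = ndR s ∧ E.toCfg.g (ndL s) ≠ par s := Iff.rfl
  have h3 : em s E.toCfg = if E.toCfg.f (ndL s) = ndR s ∧
    (E.HasOddLoop ∨ E.toCfg.g (ndL s) = par s) then 1 else 0 := rfl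
  rw [h3, if_congr (hasOddLoop_simple_mul hn s E) rfl rfl, if_congr h2 rfl rfl, simple_mul_loops,
    Multiset.card_add]
  simp only [h1]
  by_cases k1 : E.partner (northL s) = northR hn s <;> by_cases k2 : E.HasOddLoop <;>
    by_cases k3 : E.toCfg.g (ndL s) = par s <;> simp [k1, k2, k3]

theorem toCfg_wordDiagram (ω : List (Fin n)) :
    (wordDiagram hn ω).toCfg = nf (ω.map Fin.val) := by
  induction ω with
  | nil => exact toCfg_one
  | cons s ω ih =>
    change (simpleDiagram hn s * wordDiagram hn ω).toCfg = op s (nf (ω.map Fin.val))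
    rw [toCfg_simple_mul, ih]

open Classical in
theorem card_loops_wordDiagram (ω : List (Fin n)) :
    (wordDiagram hn ω).loops.card =
      expo (ω.map Fin.val) one + if (wordDiagram hn ω).HasOddLoop then 1 else 0 := by
  induction ω with
  | nil =>
    have : ¬ HasOddLoop (1 : Diagram n) := fun h =>
      (show (one.flag) from toCfg_one (n := n) ▸ h).elim
    change 0 = 0 + if HasOddLoop (1 : Diagram n) then 1 else 0
    simp [this]
  | cons s ω ih =>
    have h1 := card_loops_simple_mul hn s (wordDiagram hn ω)
    change (simpleDiagram hn s * wordDiagram hn ω).loops.card =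
      em s (nf (ω.map Fin.val)) + expo (ω.map Fin.val) one +
        if (simpleDiagram hn s * wordDiagram hn ω).HasOddLoop then 1 else 0
    rw [toCfg_wordDiagram] at h1
    omega

end Diagram

end ToCfg

/-! ## Planar diagrams and planar matchings -/

section Transfer

variable {n : ℕ}

theorem ndPos_emb_lt {u v : Node n} : ndPos (emb u) < ndPos (emb v) ↔ u.pos < v.pos := by
  rcases u with i | i <;> rcases v with j | j <;> simp [emb, Node.pos] <;> omega

theorem not_emb_inl {i : ℕ} (hi : n ≤ i) : ¬ ∃ v : Node n, emb v = Sum.inl i := by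
  rintro ⟨j | j, hj⟩ <;> simp [emb] at hj
  omega

theorem not_emb_inr {i : ℕ} (hi : n ≤ i) : ¬ ∃ v : Node n, emb v = Sum.inr i := by
  rintro ⟨j | j, hj⟩ <;> simp [emb] at hj
  omega

theorem Diagram.edges_inl (D : Diagram n) {i : ℕ} (hi : n ≤ i) :
    D.edges (Sum.inl i) = Sum.inr i := D.edges_of_not (not_emb_inl hi)

theorem Diagram.edges_inr (D : Diagram n) {i : ℕ} (hi : n ≤ i) :
    D.edges (Sum.inr i) = Sum.inl i := D.edges_of_not (not_emb_inr hi)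

/-- The added vertical edges lie to the right of all other edges. -/
theorem emb_pos {i : ℕ} (hi : n ≤ i) (u : Node n) :
    (ndPos (emb u) < ndPos (Sum.inl i) ∨ ndPos (Sum.inr i) < ndPos (emb u)) ∧
    (ndPos (Sum.inr i) < ndPos (emb u) ↔ ¬ ndPos (emb u) < ndPos (Sum.inl i)) ∧
    (ndPos (emb u) < ndPos (Sum.inr i) ↔ ndPos (emb u) < ndPos (Sum.inl i)) ∧
    (ndPos (Sum.inl i) < ndPos (emb u) ↔ ndPos (Sum.inr i) < ndPos (emb u)) := by
  rcases u with j | j <;> simp [emb] <;> omega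

theorem Diagram.IsPlanar.noncrossing {D : Diagram n} (h : D.IsPlanar) :
    Noncrossing ndPos D.edges := by
  intro u v
  rcases exists_emb_or (n := n) u with ⟨u, rfl⟩ | ⟨-, -, i, hi, rfl | rfl⟩
  · rcases exists_emb_or (n := n) v with ⟨v, rfl⟩ | ⟨-, -, i, hi, rfl | rfl⟩
    · simp only [edges_emb, ndPos_emb_lt]
      exact h u v
    · rw [edges_emb, D.edges_inl hi]
      have := emb_pos hi (D.partner u)
      tauto
    · rw [edges_emb, D.edges_inr hi]
      have h1 := emb_pos hi (D.partner u)
      have h2 : ndPos (Sum.inl i) < ndPos (Sum.inr i) := by simp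
      rintro ⟨-, h3, h4⟩
      exact lt_asymm (h2.trans h3) h4
  · rw [D.edges_inl hi]
    rcases exists_emb_or (n := n) v with ⟨v, rfl⟩ | ⟨-, -, j, hj, rfl | rfl⟩
    · have := emb_pos hi v
      tauto
    · rw [D.edges_inl hj]; simp; omega
    · rw [D.edges_inr hj]; simp
  · rw [D.edges_inr hi]
    rintro ⟨h1, h2, -⟩
    exact absurd (h1.trans h2) (by simp)

theorem Diagram.IsLeftExposed.exposed {D : Diagram n} {u : Node n} (h : D.IsLeftExposed u) :
    Exposed ndPos D.edges (emb u) := by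
  intro v
  rcases exists_emb_or (n := n) v with ⟨v, rfl⟩ | ⟨-, -, i, hi, rfl | rfl⟩
  · simp only [edges_emb, ndPos_emb_lt]
    exact h v
  · rw [D.edges_inl hi]
    have := emb_pos hi u
    tauto
  · rw [D.edges_inr hi]
    rintro ⟨h1, -, h2, -⟩
    exact absurd (h1.trans h2) (by simp)

theorem sum_nodes (F : Nd → ℕ) : ∑ u ∈ nodes n, F u = ∑ u : Node n, F (emb u) := by
  rw [nodes, Finset.sum_disjSum, Fintype.sum_sum_type, Finset.sum_range, Finset.sum_range]
  rfl

end Transfer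

/-! ## Normal forms of diagrams -/

namespace Diagram

variable {n : ℕ}

/-- Either no loops and at most one decoration on each edge, or one loop with one decoration and
no other decorations. -/
def IsNormal (D : Diagram n) : Prop :=
  (D.loops = 0 ∧ ∀ u, D.deco u ≤ 1) ∨ (D.loops = {1} ∧ ∀ u, D.deco u = 0)

theorem not_hasOddLoop {D : Diagram n} (h : D.loops = 0) : ¬ D.HasOddLoop := by
  simp [HasOddLoop, h]

theorem hasOddLoop_of_eq {D : Diagram n} (h : D.loops = {1}) : D.HasOddLoop := by
  simp [HasOddLoop, h]

/-- In a normal diagram the decoration numbers are determined by their parities, and the loops by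
the flag. -/
theorem IsNormal.eq_of_toCfg_eq {D E : Diagram n} (hD : D.IsNormal) (hE : E.IsNormal)
    (h : D.toCfg = E.toCfg) : D = E := by
  have hp : D.partner = E.partner := by
    ext1 u
    have := congrFun (congrArg Cfg.f h) (emb u)
    change D.edges (emb u) = E.edges (emb u) at this
    simpa using this
  have hf : D.HasOddLoop ↔ E.HasOddLoop := iff_of_eq (congrArg Cfg.flag h)
  rcases hD with ⟨h1, h2⟩ | ⟨h1, h2⟩ <;> rcases hE with ⟨h3, h4⟩ | ⟨h3, h4⟩
  · ext1
    · exact hp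
    · ext1 u
      have := congrFun (congrArg Cfg.g h) (emb u)
      rw [toCfg_g_emb (not_hasOddLoop h1), toCfg_g_emb (not_hasOddLoop h3),
        ZMod.natCast_eq_natCast_iff'] at this
      have := h2 u
      have := h4 u
      omega
    · rw [h1, h3]
  · exact absurd (hf.2 (hasOddLoop_of_eq h3)) (not_hasOddLoop h1)
  · exact absurd (hf.1 (hasOddLoop_of_eq h1)) (not_hasOddLoop h3)
  · ext1
    · exact hp
    · ext1 u
      rw [h2, h4]
    · rw [h1, h3]

theorem toCfg_congr {D E : Diagram n} (hp : D.partner = E.partner)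
    (hf : D.HasOddLoop ↔ E.HasOddLoop)
    (hd : ¬ D.HasOddLoop → ∀ u, (D.deco u : ZMod 2) = E.deco u) : D.toCfg = E.toCfg := by
  ext1
  · change D.edges = E.edges
    rw [edges, edges, hp]
  · ext1 u
    by_cases h : D.HasOddLoop
    · rw [g_flag _ h, g_flag _ (hf.1 h)]
    · rcases exists_emb_or (n := n) u with ⟨u, rfl⟩ | ⟨h1, -, -⟩
      · rw [toCfg_g_emb h, toCfg_g_emb (fun k => h (hf.2 k)), hd h]
      · rw [toCfg_g_of_not _ h1, toCfg_g_of_not _ h1]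
  · exact propext hf

theorem IsLDecorated.of_partner_eq {D E : Diagram n} (hD : D.IsLDecorated)
    (hp : E.partner = D.partner) (hd : ∀ u, D.deco u = 0 → E.deco u = 0)
    (hl : (∀ m ∈ D.loops, m = 0) → ∀ m ∈ E.loops, m = 0) : E.IsLDecorated where
  planar u v := by rw [hp]; exact hD.planar u v
  undecorated h := by
    rw [hp] at h
    have := hD.undecorated h
    exact ⟨fun u => hd u (this.1 u), hl this.2⟩
  exposed u hu v := by rw [hp]; exact hD.exposed u (fun k => hu (hd u k)) v

/-- The diagram with `c` decorations removed from the edge at `u`. -/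
def undecorate (D : Diagram n) (u : Node n) (c : ℕ) : Diagram n where
  partner := D.partner
  partner_invol := D.partner_invol
  partner_ne := D.partner_ne
  deco v := if v = u ∨ v = D.partner u then D.deco v - c else D.deco v
  deco_partner v := by
    have h : (D.partner v = u ∨ D.partner v = D.partner u) ↔ (v = u ∨ v = D.partner u) := by
      rw [D.partner_invol.injective.eq_iff, D.partner_invol.eq_iff, or_comm]
    simp only [h, D.deco_partner]
  loops := D.loops

theorem undecorate_deco_of_ne (D : Diagram n) {u v : Node n} (c : ℕ) (h1 : v ≠ u)
    (h2 : v ≠ D.partner u) : D.deco v = (D.undecorate u c).deco v := by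
  simp [undecorate, h1, h2]

theorem IsLDecorated.undecorate {D : Diagram n} (hD : D.IsLDecorated) (u : Node n) (c : ℕ) :
    (D.undecorate u c).IsLDecorated :=
  hD.of_partner_eq rfl (fun v hv => by simp [Diagram.undecorate, hv]) id

theorem sum_undecorate_lt (D : Diagram n) {u : Node n} {c : ℕ} (hc : c ≠ 0) (hu : c ≤ D.deco u) :
    ∑ v, (D.undecorate u c).deco v < ∑ v, D.deco v := by
  refine Finset.sum_lt_sum (fun v _ => ?_) ⟨u, Finset.mem_univ u, ?_⟩
  · simp only [Diagram.undecorate]; split_ifs <;> omega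
  · simp only [Diagram.undecorate, true_or, if_true]; omega

/-- The same diagram with other loops. -/
def withLoops (D : Diagram n) (L : Multiset ℕ) : Diagram n := { D with loops := L }

end Diagram

/-! ### Reduction in the algebra and the admissible diagrams -/

open Diagram

variable {n : ℕ}

theorem toAlgebra_eq_of_reduces {D E : LDiagram n} (h : D.1.Reduces 1 E.1) :
    D.toAlgebra = E.toAlgebra := by
  unfold LDiagram.toAlgebra
  rw [← sub_eq_zero, ← map_sub, Submodule.mkQ_apply, Submodule.Quotient.mk_eq_zero]
  exact Submodule.subset_span ⟨D, E, 1, h, rfl⟩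

open Classical in
-- Since there is no loop, or a single odd one, only relations with coefficient 1 are needed. Each
-- lowers the total number of decorations and keeps the diagram L-decorated, the parity data and the
-- number of loops.
theorem exists_normal (D : LDiagram n)
    (hD : D.1.loops.card = if D.1.HasOddLoop then 1 else 0) :
    ∃ E : LDiagram n, E.1.IsNormal ∧ E.1.toCfg = D.1.toCfg ∧ D.toAlgebra = E.toAlgebra := by
  induction hN : ∑ u, D.1.deco u + D.1.loops.sum using Nat.strong_induction_on generalizing D with
  | _ N ih =>
  subst hN
  obtain ⟨D, hL⟩ := D
  have step : ∀ E : LDiagram n, D.Reduces 1 E.1 → E.1.toCfg = D.toCfg →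
      E.1.loops.card = D.loops.card →
      ∑ u, E.1.deco u + E.1.loops.sum < ∑ u, D.deco u + D.loops.sum →
      ∃ E : LDiagram n, E.1.IsNormal ∧ E.1.toCfg = D.toCfg ∧
        LDiagram.toAlgebra ⟨D, hL⟩ = E.toAlgebra := by
    intro E hr hc hl hlt
    have hf : E.1.HasOddLoop ↔ D.HasOddLoop := iff_of_eq (congrArg Cfg.flag hc)
    obtain ⟨F, h1, h2, h3⟩ := ih _ hlt E (by rw [hl, hD]; exact if_congr hf.symm rfl rfl) rfl
    exact ⟨F, h1, h2.trans hc, (toAlgebra_eq_of_reduces (D := ⟨D, hL⟩) hr).trans h3⟩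
  by_cases hf : D.HasOddLoop
  · obtain ⟨m, hm⟩ := Multiset.card_eq_one.1 (hD.trans (if_pos hf))
    change D.loops = {m} at hm
    have hodd : Odd m := by
      obtain ⟨m', h1, h2⟩ := hf
      rw [hm, Multiset.mem_singleton] at h1
      rwa [← h1]
    by_cases h1 : m = 1
    · subst h1
      by_cases h2 : ∀ u, D.deco u = 0
      · exact ⟨⟨D, hL⟩, .inr ⟨hm, h2⟩, rfl, rfl⟩
      · push Not at h2
        obtain ⟨u, hu⟩ := h2
        refine step ⟨D.undecorate u 1, hL.undecorate u 1⟩ ?_ ?_ rfl ?_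
        · refine .absorbEdge _ _ u rfl ?_ (fun v => D.undecorate_deco_of_ne 1) rfl (by simp [hm])
          simp only [undecorate, true_or, if_true]; omega
        · exact toCfg_congr rfl Iff.rfl fun h => absurd hf h
        · exact Nat.add_lt_add_right (D.sum_undecorate_lt one_ne_zero (by omega)) _
    · obtain ⟨l, rfl⟩ : ∃ l, m = l + 2 := ⟨m - 2, by obtain ⟨k, rfl⟩ := hodd; omega⟩
      have hodd' : Odd l := by
        obtain ⟨k, hk⟩ := hodd
        exact ⟨k - 1, by omega⟩
      refine step ⟨D.withLoops {l}, hL.of_partner_eq rfl (fun _ => id) ?_⟩ ?_ ?_ ?_ ?_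
      -- The clause on diagrams whose edges all propagate is preserved because the loop of `D` is
      -- itself decorated.
      · intro h
        exact absurd (h (l + 2) (by simp [hm])) (by omega)
      · exact .cancelLoop _ _ l 0 rfl rfl hm rfl
      · exact toCfg_congr rfl ⟨fun _ => hf, fun _ => ⟨l, by simp [withLoops], hodd'⟩⟩
          fun _ _ => rfl
      · simp [withLoops, hm]
      · simp [withLoops, hm]
  · have hm : D.loops = 0 := Multiset.card_eq_zero.1 (hD.trans (if_neg hf))
    by_cases h2 : ∀ u, D.deco u ≤ 1
    · exact ⟨⟨D, hL⟩, .inl ⟨hm, h2⟩, rfl, rfl⟩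
    · push Not at h2
      obtain ⟨u, hu⟩ := h2
      refine step ⟨D.undecorate u 2, hL.undecorate u 2⟩ ?_ ?_ rfl ?_
      · refine .cancelEdge _ _ u rfl ?_ (fun v => D.undecorate_deco_of_ne 2) rfl
        simp only [undecorate, true_or, if_true]; omega
      · refine toCfg_congr rfl Iff.rfl fun _ v => ?_
        rw [ZMod.natCast_eq_natCast_iff']
        simp only [undecorate]
        split_ifs with h
        · have : D.deco v = D.deco u := by
            rcases h with rfl | rfl
            · rfl
            · exact D.deco_partner u
          omega
        · rfl
      · exact Nat.add_lt_add_right (D.sum_undecorate_lt two_ne_zero (by omega)) _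

theorem isTypeI_iff {D : LDiagram n} :
    D.IsTypeI ↔ D.1.loops = {1} ∧ ∀ u, D.1.deco u = 0 := by
  constructor
  · rintro ⟨hi, ⟨m, hm0, hm⟩, hd⟩
    refine ⟨?_, hd⟩
    by_cases h1 : m = 1
    · rw [hm, h1]
    · exact absurd (.cancelLoop D.1 (D.1.withLoops {m - 2}) (m - 2) 0 rfl rfl
        (by rw [hm, show m - 2 + 2 = m by omega]; rfl) rfl) (hi 1 _)
  · rintro ⟨hl, hd⟩
    refine ⟨?_, ⟨1, one_ne_zero, hl⟩, hd⟩
    intro c E hr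
    cases hr with
    | loop _ _ _ h => have := congrArg (0 ∈ ·) h; simp [hl] at this
    | cancelEdge _ u _ hu => rw [hd] at hu; omega
    | cancelLoop _ m L _ _ h => have := congrArg (m + 2 ∈ ·) h; simp [hl] at this
    | absorbEdge _ u _ hu => rw [hd] at hu; omega
    | absorbLoop _ m L _ _ h => have := congrArg Multiset.card h; simp [hl] at this

theorem even_sum_deco (D : Diagram n) : 2 ∣ ∑ u, D.deco u := by
  rw [← ZMod.natCast_eq_zero_iff]
  push_cast
  refine Finset.sum_involution (fun u _ => D.partner u) (fun u _ => ?_)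
    (fun u _ _ => D.partner_ne u) (fun u _ => Finset.mem_univ _) (fun u _ => D.partner_invol u)
  rw [D.deco_partner]
  exact CharTwo.add_self_eq_zero _

/-- Irreducibility bounds the decorations by one per edge. The sum over nodes counts each edge at
both ends, whence 4 in place of 2. -/
theorem isTypeII_iff {D : LDiagram n} :
    D.IsTypeII ↔ D.1.loops = 0 ∧ (∀ u, D.1.deco u ≤ 1) ∧ 4 ∣ ∑ u, D.1.deco u := by
  have heven := even_sum_deco D.1
  constructor
  · rintro ⟨hi, hl, he⟩
    refine ⟨hl, fun u => ?_, ?_⟩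
    · by_contra hu
      refine hi 1 (D.1.undecorate u 2) (.cancelEdge _ _ u rfl ?_
        (fun v => D.1.undecorate_deco_of_ne 2) rfl)
      simp only [undecorate, true_or, if_true]; omega
    · rw [LDiagram.numDecorations, hl, Multiset.sum_zero, add_zero, Nat.even_iff] at he
      omega
  · rintro ⟨hl, hd, hs⟩
    refine ⟨?_, hl, ?_⟩
    · intro c E hr
      cases hr with
      | loop _ _ _ h => have := congrArg (0 ∈ ·) h; simp [hl] at this
      | cancelEdge _ u _ hu => have := hd u; omega
      | cancelLoop _ m L _ _ h => have := congrArg (m + 2 ∈ ·) h; simp [hl] at this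
      | absorbEdge _ u _ _ _ _ h => simp [hl] at h
      | absorbLoop _ m L _ _ h => have := congrArg Multiset.card h; simp [hl] at this
    · rw [LDiagram.numDecorations, hl, Multiset.sum_zero, add_zero, Nat.even_iff]
      omega

/-! ## The correspondence -/

/-- A letter that closes no loop preserves the parity of the number of decorated edges, and a letter
that closes an even loop changes nothing. -/
theorem dvd_sum_nf {m : ℕ} (hm : 2 ≤ m) {w : List ℕ} (hw : ∀ k ∈ w, k < m)
    (hf : ¬ (nf w).flag) : 4 ∣ ∑ u ∈ nodes m, ((nf w).g u).val := by
  induction w with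
  | nil => simp [nf, one]
  | cons s w ih =>
    have hw' : ∀ k ∈ w, k < m := fun k hk => hw k (by simp [hk])
    have hs := hw s (by simp)
    have hf' : ¬ (nf w).flag := fun h => hf (op_flag_of_flag h s)
    have ih := ih hw' hf'
    change ¬ (op s (nf w)).flag at hf
    change 4 ∣ ∑ u ∈ nodes m, ((op s (nf w)).g u).val
    by_cases h : (nf w).f (ndL s) = ndR s
    · have : op s (nf w) = nf w := op_eq_self.2 ⟨h, .inr (by
        by_contra h1
        exact hf (.inr ⟨h, h1⟩))⟩
      rwa [this]
    · have hv : ∀ i, m ≤ i → (nf w).f (Sum.inl i) = Sum.inr i := fun i hi =>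
        (vert_eq_self.1 (vert_nf (hm.trans hi) fun k hk => (hw' k hk).trans_le hi)).1
      have h1 : ndL s ∈ nodes m := by simp [ndL]; omega
      have h2 : ndR s ∈ nodes m := by simp [ndR]; omega
      have := (sum_joinDeco (par s) (ndL_ne_ndR s) h h1 h2 (f_mem_nodes hv h1)
        (f_mem_nodes hv h2)).2 ih
      simpa only [op, join_g _ _ hf] using this

theorem toCfg_sum {D : Diagram n} (hl : D.loops = 0) (hd : ∀ u, D.deco u ≤ 1) :
    ∑ u ∈ nodes n, (D.toCfg.g u).val = ∑ u, D.deco u := by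
  rw [sum_nodes]
  refine Finset.sum_congr rfl fun u _ => ?_
  rw [toCfg_g_emb (not_hasOddLoop hl), ZMod.val_natCast]
  exact Nat.mod_eq_of_lt (Nat.lt_succ_of_le (hd u))

theorem exists_word_of_isTypeI (hn : 4 ≤ n) {D : LDiagram n} (h : D.IsTypeI) :
    ∃ w, (∀ k ∈ w, k < n) ∧ nf w = D.1.toCfg := by
  obtain ⟨hl, hd⟩ := isTypeI_iff.1 h
  refine exists_word_of_flag (by omega) (hasOddLoop_of_eq hl) D.2.planar.noncrossing
    (fun i hi => D.1.edges_inl hi) fun hs => ?_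
  -- The identity matching is excluded because a diagram with only propagating edges may not contain
  -- a decorated loop.
  have := (D.2.undecorated fun i => ⟨i, ?_⟩).2 1 (by simp [hl])
  · omega
  · have := congrFun hs (emb (Sum.inl i))
    change D.1.edges _ = _ at this
    rw [edges_emb, ← emb_swap, emb_inj] at this
    exact this

theorem exists_word_of_isTypeII {D : LDiagram n} (h : D.IsTypeII) :
    ∃ w, (∀ k ∈ w, k < n) ∧ nf w = D.1.toCfg := by
  obtain ⟨hl, hd, hs⟩ := isTypeII_iff.1 h
  have hf := not_hasOddLoop hl
  refine Good.exists_word ⟨D.2.planar.noncrossing, fun u hu => ?_, hf,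
    fun i hi => ⟨D.1.edges_inl hi, D.1.toCfg_g_of_not (not_emb_inl hi)⟩, ?_⟩
  · rcases exists_emb_or (n := n) u with ⟨v, rfl⟩ | ⟨h1, -, -⟩
    · refine (D.2.exposed v fun h0 => hu ?_).exposed
      rw [toCfg_g_emb hf, h0, Nat.cast_zero]
    · exact absurd (D.1.toCfg_g_of_not h1) hu
  · rwa [toCfg_sum hl hd]

theorem exists_map_val {w : List ℕ} (h : ∀ k ∈ w, k < n) : ∃ ω : List (Fin n), ω.map Fin.val = w :=
  ⟨w.pmap (fun k hk => ⟨k, hk⟩) h, by simp [List.map_pmap]⟩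

theorem IsReducedExpr.nf_eq {ω ω' : List (Fin n)} {w : W n} (hw : IsFullyCommutative w)
    (h : IsReducedExpr ω w) (h' : IsReducedExpr ω' w) :
    nf (ω.map Fin.val) = nf (ω'.map Fin.val) :=
  act_ceq (ceq_val_iff.2 (hw ω ω' h h')) one

/-- A factor `0 1` creates an odd loop, which persists under further multiplication; the converse is
`Red.exists_fork_of_flag`. -/
theorem heapTypeI_iff {ω : List (Fin n)} {w : W n} (hw : IsFullyCommutative w)
    (h : IsReducedExpr ω w) : HeapTypeI w ↔ (nf (ω.map Fin.val)).flag := by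
  constructor
  · rintro ⟨ω', h', l, r, hlr⟩
    rw [h.nf_eq hw h', ← hlr, nf, List.append_assoc, act_append]
    exact act_flag_of_flag (op_zero_one_flag _) _
  · intro hf
    obtain ⟨l, r, hlr⟩ := (h.red hw).exists_fork_of_flag hf
    obtain ⟨ω', h1, h2⟩ := hlr.lift
    have hlen : ω.length = ω'.length := by
      have := hlr.length_eq
      rw [h1] at this
      simpa using this
    exact ⟨ω', h.of_length_le hlen.ge ((wordProd_eq_of_reflTransGen h2).symm.trans h.2),
      l, r, by rw [← h1]; simp⟩

/-- Rewriting a word to a `Red` one keeps its diagram and introduces no new letters, and a `Red`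
word is a reduced expression of a fully commutative element. -/
theorem exists_fc {w : List ℕ} (h : ∀ k ∈ w, k < n) :
    ∃ (x : FC n) (ω : List (Fin n)), IsReducedExpr ω x.1 ∧ nf (ω.map Fin.val) = nf w := by
  obtain ⟨v, hv, -, -, h1, h2⟩ := exists_red w
  obtain ⟨ω, rfl⟩ := exists_map_val fun k hk => h k (h2 k hk)
  exact ⟨⟨_, hv.isReducedExpr.2⟩, ω, hv.isReducedExpr.1, h1 one⟩

theorem exists_normal_wordDiagram (hn : 4 ≤ n) {w : W n} (hw : IsFullyCommutative w)
    {ω : List (Fin n)} (h : IsReducedExpr ω w) :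
    ∃ E : LDiagram n, E.1.IsNormal ∧ E.1.toCfg = nf (ω.map Fin.val) ∧
      LDiagram.toAlgebra ⟨wordDiagram hn ω, isLDecorated_wordDiagram hn ω⟩ = E.toAlgebra := by
  classical
  have hc := card_loops_wordDiagram hn ω
  rw [(h.red hw).expo_eq_zero, zero_add] at hc
  rw [← toCfg_wordDiagram hn]
  exact exists_normal ⟨wordDiagram hn ω, isLDecorated_wordDiagram hn ω⟩ hc

theorem exists_isReducedExpr (w : W n) : ∃ ω, IsReducedExpr ω w := by
  obtain ⟨ω, h1, h2⟩ := (coxeterMatrix n).toCoxeterSystem.exists_isReduced w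
  exact ⟨ω, h1, h2.symm⟩

end TLD

theorem mainTheorem4 (n : ℕ) (hn : 4 ≤ n) :
    ∃ d : TLD.FC n → TLD.LDiagram n,
      (∀ (w : TLD.FC n) (ω : List (Fin n)), TLD.IsReducedExpr ω w.1 →
        ∃ h : (TLD.wordDiagram hn ω).IsLDecorated,
          TLD.LDiagram.toAlgebra ⟨TLD.wordDiagram hn ω, h⟩ = (d w).toAlgebra) ∧
      (∀ w : TLD.FC n, (d w).IsTypeI ↔ TLD.HeapTypeI w.1) ∧
      (∀ w : TLD.FC n, (d w).IsTypeII ↔ TLD.HeapTypeII w.1) ∧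
      Set.BijOn d {w | TLD.HeapTypeI w.1} {D | D.IsTypeI} ∧
      Set.BijOn d {w | TLD.HeapTypeII w.1} {D | D.IsTypeII} := by
  open TLD Diagram in
  choose e he using fun w : FC n => exists_isReducedExpr w.1
  -- The map sends `w` to the normal form for one chosen reduced expression. Independence of the
  -- choice follows since a normal diagram is determined by its class.
  choose d hd1 hd2 hd3 using fun w : FC n => exists_normal_wordDiagram hn w.2 (he w)
  have heq : ∀ (w : FC n) (D : LDiagram n), D.1.IsNormal → D.1.toCfg = (d w).1.toCfg → D = d w :=
    fun w D h1 h2 => Subtype.ext (h1.eq_of_toCfg_eq (hd1 w) h2)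
  have hI : ∀ w : FC n, (d w).IsTypeI ↔ HeapTypeI w.1 := by
    intro w
    rw [heapTypeI_iff w.2 (he w), ← hd2, isTypeI_iff]
    constructor
    · exact fun h => hasOddLoop_of_eq h.1
    · intro h
      exact (hd1 w).resolve_left fun k => not_hasOddLoop k.1 h
  have hII : ∀ w : FC n, (d w).IsTypeII ↔ HeapTypeII w.1 := by
    intro w
    rw [HeapTypeII, heapTypeI_iff w.2 (he w), ← hd2, isTypeII_iff]
    constructor
    · exact fun h => not_hasOddLoop h.1
    · intro h
      have h1 := (hd1 w).resolve_right fun k => h (hasOddLoop_of_eq k.1)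
      refine ⟨h1.1, h1.2, ?_⟩
      rw [← toCfg_sum h1.1 h1.2]
      rw [hd2] at h ⊢
      refine dvd_sum_nf (by omega) (fun k hk => ?_) h
      obtain ⟨i, -, rfl⟩ := List.mem_map.1 hk
      exact i.2
  -- Equal diagrams give commutation equivalent words, and these represent the same group element.
  have hinj : Function.Injective d := by
    intro w w' h
    have h1 : nf ((e w).map Fin.val) = nf ((e w').map Fin.val) := by rw [← hd2, ← hd2, h]
    have h2 := ceq_val_iff.1 (((he w).red w.2).ceq_of_nf_eq ((he w').red w'.2) h1)
    exact Subtype.ext (by rw [← (he w).2, ← (he w').2, wordProd_eq_of_reflTransGen h2])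
  have hsurj : ∀ D : LDiagram n, D.1.IsNormal → (∃ w, (∀ k ∈ w, k < n) ∧ nf w = D.1.toCfg) →
      ∃ w, d w = D := by
    rintro D hD ⟨v, hv, hvD⟩
    obtain ⟨w, ω, h1, h2⟩ := exists_fc hv
    exact ⟨w, (heq w D hD (by rw [hd2, (he w).nf_eq w.2 h1, h2, hvD])).symm⟩
  refine ⟨d, fun w ω h => ⟨isLDecorated_wordDiagram hn ω, ?_⟩, hI, hII,
    ⟨fun w hw => (hI w).2 hw, hinj.injOn, fun D hD => ?_⟩,
    ⟨fun w hw => (hII w).2 hw, hinj.injOn, fun D hD => ?_⟩⟩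
  · obtain ⟨E, h1, h2, h3⟩ := exists_normal_wordDiagram hn w.2 h
    rw [h3, heq w E h1 (by rw [h2, hd2, h.nf_eq w.2 (he w)])]
  · obtain ⟨w, rfl⟩ := hsurj D (.inr (isTypeI_iff.1 hD)) (exists_word_of_isTypeI hn hD)
    exact ⟨w, (hI w).1 hD, rfl⟩
  · have h := isTypeII_iff.1 hD
    obtain ⟨w, rfl⟩ := hsurj D (.inl ⟨h.1, h.2.1⟩) (exists_word_of_isTypeII hD)
    exact ⟨w, (hII w).1 hD, rfl⟩
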